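/- Let $\mathbb F_q$ be a finite field with $q$ elements and let $E:\ y^2+c_1ty+c_3y=t^3+c_2t^2+c_4t+c_6$ be an elliptic curve over $\mathbb F_q$ with point at infinity $\infty$, $\mathbf A=\mathbb F_q[t,y]$, and invariant differential $\lambda=dt/(2y+c_1t+c_3)$. Let $(\theta,\eta)$ be a second copy of the coordinates $(t,y)$, $K=\mathbb F_q(\theta,\eta)$, with absolute value $|g|=q^{\deg g}$ at the infinite place ($\deg\theta=2$, $\deg\eta=3$), let $K_\infty$ be the completion and $\mathbb C_\infty$ the completion of an algebraic closure of $K_\infty$. Put $\Xi=(\theta,\eta)\in E(\mathbb C_\infty)$. The superscript $(i)$ denotes the $i$-th Frobenius twist (raise coefficients, or coordinates of points, to the power $q^i$). Every nonzero function on $E$ over $\mathbb C_\infty$ is a quotient of elements of $\mathbb C_\infty[t,y]$, and $\widetilde{\mathrm{sgn}}$ denotes the quotient of the coefficients of the monomials of highest degree among the $t^i,\ t^iy$ ($\deg t=2$, $\deg y=3$). Let $V=(\alpha,\beta)\in E(\mathbb C_\infty)$ be the point with $V-V^{(1)}=\Xi$ and $|\alpha|,|\beta|>1$, and let $f$ be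 the function with divisor $(V^{(1)})-(V)+(\Xi)-(\infty)$ and $\widetilde{\mathrm{sgn}}(f)=1$. Let $n\ge1$, and assume that $[j]V^{(1)}+[n-j]V\neq\infty$ for $1\le j\le n-1$. For $1\le j\le n$ let $g_j$ be the function with $\widetilde{\mathrm{sgn}}(g_j)=1$ and divisor $$-n(V)+(n-j)(\infty)+(j-1)(\Xi)+\big([j-1]V^{(1)}+[n-(j-1)]V\big),$$ and put $\tau h=f^nh^{(1)}$ and $g_{jn+k}=\tau^jg_k$ for $j\ge0$, $1\le k\le n$. There are unique constants $a_i,y_i,z_i\in\mathbb C_\infty$ ($1\le i\le n$) with $$tg_i=\theta g_i+a_ig_{i+1}+g_{i+2},\qquad yg_i=\eta g_i+y_ig_{i+1}+z_ig_{i+2}+g_{i+3}.$$ Let $\rho_t^{\otimes n}$ and $\rho_y^{\otimes n}$ be the elements of $\mathrm{Mat}_n(\mathbb C_\infty)[\tau]$ (where $\tau M=M^{(1)}\tau$) such that the $(i,k)$ entry of the coefficient of $\tau^j$ is the coefficient of $g_{jn+k}$ in the expression for $tg_i$, respectively $yg_i$; for $a=p(t)+y\,r(t)\in\mathbf A$ with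 $p,r\in\mathbb F_q[t]$ put $\rho_a^{\otimes n}=p(\rho_t^{\otimes n})+\rho_y^{\otimes n}\,r(\rho_t^{\otimes n})$, and let $d[a]$ be its constant coefficient; write $d[\theta]$, $d[\eta]$ for $d[t]$, $d[y]$. Let $\mathrm{Exp}_\rho^{\otimes n}(\mathbf z)=\sum_{i\ge0}Q_i\mathbf z^{(i)}$ be the power series with $Q_0=I$ and $\mathrm{Exp}_\rho^{\otimes n}(d[a]\mathbf z)=\rho_a^{\otimes n}(\mathrm{Exp}_\rho^{\otimes n}(\mathbf z))$ for all $a\in\mathbf A$. For $\mathbf u\in\mathbb C_\infty^n$ put $$E_{\mathbf u}^{\otimes n}(t)=\sum_{i=0}^\infty\mathrm{Exp}_\rho^{\otimes n}\big(d[\theta]^{-i-1}\mathbf u\big)t^i,\qquad G_{\mathbf u}^{\otimes n}(t,y)=E_{d[\eta]\mathbf u}^{\otimes n}(t)+(y+c_1t+c_3)E_{\mathbf u}^{\otimes n}(t).$$ Then the series $\mathrm{Exp}_\rho^{\otimes n}$ converges on all of $\mathbb C_\infty^n$; for every $\mathbf u=(u_1,\dots,u_n)^\top\in\mathbb C_\infty^n$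 the coordinates of $G_{\mathbf u}^{\otimes n}$ lie in $\mathbb T[y]$, where $\mathbb T$ is the ring of power series in $t$ over $\mathbb C_\infty$ that converge for $|t|\le1$, and have meromorphic continuations to $E\setminus\{\infty\}$ over $\mathbb C_\infty$; and, taking residues of these continuations coordinatewise, $$\mathrm{RES}_\Xi(G_{\mathbf u}^{\otimes n}):=\big(\mathrm{Res}_\Xi(G_{\mathbf u,1}^{\otimes n}\lambda),\dots,\mathrm{Res}_\Xi(G_{\mathbf u,n}^{\otimes n}\lambda)\big)^\top=-(u_1,\dots,u_n)^\top.$$ -/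

import Mathlib

open Polynomial nonZeroDivisors
open WeierstrassCurve.Affine (CoordinateRing FunctionField Point)

namespace TensorDrinfeld

/-! ## The field `ℂ_∞` -/

section CInfty

variable {F : Type*} [Field F] [Fintype F] {C : Type*} [NormedField C] [Algebra F C]

/-- The subfield `K_∞` of `C`: the closure of `K = 𝔽_q(θ, η)` in the complete field `C`. -/
def KInfty (F : Type*) [Field F] {C : Type*} [NormedField C] [Algebra F C] (θ η : C) :
    Subfield C :=
  (IntermediateField.adjoin F ({θ, η} : Set C)).toSubfield.topologicalClosure

/-- Together with `[IsUltrametricDist C] [CompleteSpace C] [IsAlgClosed C]` and the fact that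
`(θ, η)` is a point of the curve, this says that `C` is `ℂ_∞`, the completion of an algebraic
closure of the completion `K_∞` of `K = 𝔽_q(θ, η)` at the infinite place, with the absolute value
`|g| = q ^ deg g`, `deg θ = 2`, `deg η = 3`. (The monomials `θ ^ i`, `θ ^ i * η` have pairwise
distinct degrees, so the two normalizations determine the absolute value on all of `K`.) -/
structure IsCInfty (F : Type*) [Field F] [Fintype F] {C : Type*} [NormedField C] [Algebra F C]
    (θ η : C) : Prop where
  norm_theta : ‖θ‖ = (Fintype.card F : ℝ) ^ 2
  norm_eta : ‖η‖ = (Fintype.card F : ℝ) ^ 3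
  dense_algebraic : Dense {x : C | IsAlgebraic (KInfty F θ η) x}

end CInfty

/-! ## Degree, leading coefficient and divisors on a Weierstrass curve over a field -/

section Divisors

variable {R : Type*} [CommRing R] (E : WeierstrassCurve.Affine R)

/-- The polynomial `p` in the unique expression `a = p(t) + r(t) y`. -/
noncomputable def partOne (a : E.CoordinateRing) : R[X] := (CoordinateRing.basis E).repr a 0

/-- The polynomial `r` in the unique expression `a = p(t) + r(t) y`. -/
noncomputable def partY (a : E.CoordinateRing) : R[X] := (CoordinateRing.basis E).repr a 1

open Classical in
/-- The pole order at `∞` of `a = p(t) + r(t) y`, where `t` has degree 2 and `y` has degree 3. -/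
noncomputable def degA (a : E.CoordinateRing) : ℕ :=
  max (2 * (partOne E a).natDegree)
    (if partY E a = 0 then 0 else 2 * (partY E a).natDegree + 3)

open Classical in
/-- The coefficient of the monomial `t ^ i` or `t ^ i * y` of highest degree in `a`. -/
noncomputable def sgnA (a : E.CoordinateRing) : R :=
  if partY E a ≠ 0 ∧ 2 * (partOne E a).natDegree < 2 * (partY E a).natDegree + 3 then
    (partY E a).leadingCoeff
  else (partOne E a).leadingCoeff

variable {L : Type*} [Field L] (E : WeierstrassCurve.Affine L)

/-- The function `t`. -/
noncomputable def tFun : E.FunctionField :=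
  algebraMap E.CoordinateRing E.FunctionField (CoordinateRing.mk E (C X))

/-- The function `y`. -/
noncomputable def yFun : E.FunctionField :=
  algebraMap E.CoordinateRing E.FunctionField (CoordinateRing.mk E X)

/-- The order of vanishing at `∞` of a nonzero function, written as a quotient of two elements of
the coordinate ring. -/
noncomputable def ordInfty (h : E.FunctionField) : ℤ :=
  (degA E ((IsLocalization.sec E.CoordinateRing⁰ h).2 : E.CoordinateRing) : ℤ) -
    degA E (IsLocalization.sec E.CoordinateRing⁰ h).1

/-- The extended sign: the ratio of the leading coefficients of numerator and denominator. -/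
noncomputable def sgn (h : E.FunctionField) : L :=
  sgnA E (IsLocalization.sec E.CoordinateRing⁰ h).1 /
    sgnA E ((IsLocalization.sec E.CoordinateRing⁰ h).2 : E.CoordinateRing)

/-- The maximal ideal of an affine point, as an invertible fractional ideal of the coordinate
ring; the unit ideal for the point `∞`. -/
noncomputable def pointIdeal : E.Point → (FractionalIdeal E.CoordinateRing⁰ E.FunctionField)ˣ
  | .zero => 1
  | .some _ _ h => CoordinateRing.XYIdeal' (W := E) h

/-- `h` is a nonzero function with divisor `∑ D(P) (P)`. Away from `∞` this is the factorization
of the principal fractional ideal of `h` into maximal ideals; at `∞` (the zero of the group of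
points) it is the order of `h` at `∞`. -/
def HasDivisor (h : E.FunctionField) (D : E.Point →₀ ℤ) : Prop :=
  h ≠ 0 ∧
  FractionalIdeal.spanSingleton E.CoordinateRing⁰ h =
    ((D.prod fun P m => pointIdeal E P ^ m :
      (FractionalIdeal E.CoordinateRing⁰ E.FunctionField)ˣ) :
        FractionalIdeal E.CoordinateRing⁰ E.FunctionField) ∧
  ordInfty E h = D 0

end Divisors

/-! ## Frobenius twisting -/

section Twist

variable {F : Type*} [Field F] [Fintype F] {L : Type*} [Field L] [Algebra F L]

/-- The `q`-th power Frobenius on points, `X ↦ X^{(1)}`. -/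
noncomputable def frobPoint [DecidableEq L] (W : WeierstrassCurve F) :
    (W.baseChange L).toAffine.Point →+ (W.baseChange L).toAffine.Point :=
  Point.map (W' := W) (FiniteField.frobeniusAlgHom F L)

/-- Twisting on `L[t, y]`: raise the coefficients to the `q`-th power and fix `t` and `y`. -/
noncomputable def twistA (W : WeierstrassCurve F) :
    (W.baseChange L).toAffine.CoordinateRing →+* (W.baseChange L).toAffine.CoordinateRing :=
  AdjoinRoot.lift
    ((AdjoinRoot.of _).comp (mapRingHom (FiniteField.frobeniusAlgHom F L : L →+* L)))
    (AdjoinRoot.root (W.baseChange L).toAffine.polynomial) (by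
      have h : (W.baseChange L).toAffine.polynomial.map
          (mapRingHom (FiniteField.frobeniusAlgHom F L : L →+* L)) =
          (W.baseChange L).toAffine.polynomial :=
        (WeierstrassCurve.Affine.baseChange_polynomial (W := W)
          (f := FiniteField.frobeniusAlgHom F L)).symm
      rw [← eval₂_map, h, AdjoinRoot.eval₂_root])

theorem twistA_injective (W : WeierstrassCurve F) :
    Function.Injective (twistA (L := L) W) := by
  have hmk : ∀ x : L[X][X], twistA W (CoordinateRing.mk _ x) =
      CoordinateRing.mk (W.baseChange L).toAffine
        (x.map (mapRingHom (FiniteField.frobeniusAlgHom F L : L →+* L))) := fun x => by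
    rw [twistA, AdjoinRoot.lift_mk, ← eval₂_map]
    exact AdjoinRoot.aeval_eq _
  have hsm : ∀ (p : L[X]) (z : (W.baseChange L).toAffine.CoordinateRing),
      twistA W (p • z) = p.map (FiniteField.frobeniusAlgHom F L : L →+* L) • twistA W z :=
    fun p z => by
      rw [CoordinateRing.smul, map_mul, hmk, map_C, CoordinateRing.smul]
      rfl
  refine (injective_iff_map_eq_zero _).mpr fun z hz => ?_
  obtain ⟨p, r, rfl⟩ := CoordinateRing.exists_smul_basis_eq z
  simp_rw [map_add, hsm, map_one, hmk, map_X] at hz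
  obtain ⟨hp, hr⟩ := CoordinateRing.smul_basis_eq_zero hz
  rw [Polynomial.map_eq_zero_iff (RingHom.injective _)] at hp hr
  simp_rw [hp, hr, zero_smul, add_zero]

/-- Twisting on the function field `L(t, y)`. -/
noncomputable def twist (W : WeierstrassCurve F) :
    (W.baseChange L).toAffine.FunctionField →+* (W.baseChange L).toAffine.FunctionField :=
  IsFractionRing.map (K := (W.baseChange L).toAffine.FunctionField)
    (L := (W.baseChange L).toAffine.FunctionField) (twistA_injective (F := F) (L := L) W)

end Twist

/-! ## The shtuka function and the basis of the tensor power of the motive -/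

section Motive

variable {F : Type*} [Field F] [Fintype F] {L : Type*} [Field L] [DecidableEq L] [Algebra F L]
  (W : WeierstrassCurve F)

/-- The shtuka function: `div f = (V^{(1)}) - (V) + (Ξ) - (∞)` and `sgn f = 1`. -/
def IsShtuka (V Ξ : (W.baseChange L).toAffine.Point)
    (f : (W.baseChange L).toAffine.FunctionField) : Prop :=
  HasDivisor (W.baseChange L).toAffine f
    (Finsupp.single (frobPoint W V) 1 - Finsupp.single V 1 + Finsupp.single Ξ 1 -
      Finsupp.single 0 1) ∧
  sgn (W.baseChange L).toAffine f = 1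

/-- The functions `g_1, …, g_n` (`g j` is the function `g_{j+1}` since `j` starts at `0`):
`sgn g_{j+1} = 1` and
`div g_{j+1} = -n (V) + (n-1-j) (∞) + j (Ξ) + (j V^{(1)} + (n-j) V)`,
where the last point is a sum in the group of points. -/
def IsMotiveBasis (V Ξ : (W.baseChange L).toAffine.Point) (n : ℕ)
    (g : Fin n → (W.baseChange L).toAffine.FunctionField) : Prop :=
  ∀ j : Fin n,
    HasDivisor (W.baseChange L).toAffine (g j)
      (Finsupp.single V (-(n : ℤ)) + Finsupp.single 0 ((n : ℤ) - 1 - (j : ℤ)) +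
        Finsupp.single Ξ (j : ℤ) +
        Finsupp.single ((j : ℕ) • frobPoint W V + (n - (j : ℕ)) • V) 1) ∧
    sgn (W.baseChange L).toAffine (g j) = 1

variable {n : ℕ} [NeZero n] (f : (W.baseChange L).toAffine.FunctionField)
  (g : Fin n → (W.baseChange L).toAffine.FunctionField)

/-- The functions `g_i` for all `i` (again numbered from `0`): if `m = j n + k` with `0 ≤ k < n`
then `gExt m = τ ^ j g_k`, where `τ h = f ^ n * h^{(1)}`. -/
noncomputable def gExt (m : ℕ) : (W.baseChange L).toAffine.FunctionField :=
  (fun h => f ^ n * twist W h)^[m / n] (g (Fin.ofNat n m))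

/-- The constants `a_i` with `t g_i = θ g_i + a_i g_{i+1} + g_{i+2}`. -/
noncomputable def aConst (θ : L) (i : Fin n) : L :=
  Classical.epsilon fun a : L =>
    tFun (W.baseChange L).toAffine * g i = θ • g i + a • gExt W f g ((i : ℕ) + 1) + gExt W f g ((i : ℕ) + 2)

/-- The pairs of constants `(y_i, z_i)` with
`y g_i = η g_i + y_i g_{i+1} + z_i g_{i+2} + g_{i+3}`. -/
noncomputable def yzConst (η : L) (i : Fin n) : L × L :=
  Classical.epsilon fun b : L × L =>
    yFun (W.baseChange L).toAffine * g i =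
      η • g i + b.1 • gExt W f g ((i : ℕ) + 1) + b.2 • gExt W f g ((i : ℕ) + 2) + gExt W f g ((i : ℕ) + 3)

/-! ## Twisted power series and the Anderson module

A sequence `A : ℕ → Matrix (Fin n) (Fin n) L` stands for the twisted power series `∑ A_i τ^i`. -/

/-- The twist `M^{(j)}` of a matrix of constants. -/
def twistMat (F : Type*) [Field F] [Fintype F] {L : Type*} [Field L] {n : ℕ} (j : ℕ)
    (M : Matrix (Fin n) (Fin n) L) : Matrix (Fin n) (Fin n) L :=
  M.map fun x => x ^ Fintype.card F ^ j

/-- The product of twisted power series, determined by `τ M = M^{(1)} τ`. -/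
def twMul (F : Type*) [Field F] [Fintype F] {L : Type*} [Field L] {n : ℕ}
    (A B : ℕ → Matrix (Fin n) (Fin n) L) : ℕ → Matrix (Fin n) (Fin n) L := fun i =>
  ∑ p ∈ Finset.HasAntidiagonal.antidiagonal i, A p.1 * twistMat F p.1 (B p.2)

/-- Powers of a twisted power series. -/
def twPow (F : Type*) [Field F] [Fintype F] {L : Type*} [Field L] {n : ℕ}
    (A : ℕ → Matrix (Fin n) (Fin n) L) : ℕ → ℕ → Matrix (Fin n) (Fin n) L
  | 0 => Pi.single 0 1
  | k + 1 => twMul F (twPow F A k) A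

/-- The operator `ρ_t`: row `i` holds the coefficients of `t g_i` in the `τ`-basis `g_1, …, g_n`,
so that the coefficient of `g_{jn+k} = τ^j g_k` is the `(i, k)` entry of the coefficient of
`τ^j`. -/
noncomputable def rhoT (θ : L) : ℕ → Matrix (Fin n) (Fin n) L := fun j => Matrix.of fun i k =>
  if j * n + (k : ℕ) = (i : ℕ) then θ
  else if j * n + (k : ℕ) = (i : ℕ) + 1 then aConst W f g θ i
  else if j * n + (k : ℕ) = (i : ℕ) + 2 then 1
  else 0

/-- The operator `ρ_y`, formed in the same way from the coefficients of `y g_i`. -/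
noncomputable def rhoY (η : L) : ℕ → Matrix (Fin n) (Fin n) L := fun j => Matrix.of fun i k =>
  if j * n + (k : ℕ) = (i : ℕ) then η
  else if j * n + (k : ℕ) = (i : ℕ) + 1 then (yzConst W f g η i).1
  else if j * n + (k : ℕ) = (i : ℕ) + 2 then (yzConst W f g η i).2
  else if j * n + (k : ℕ) = (i : ℕ) + 3 then 1
  else 0

/-- `p(ρ_t)` for a polynomial `p` over `𝔽_q`. -/
noncomputable def rhoPoly (θ : L) (p : F[X]) : ℕ → Matrix (Fin n) (Fin n) L :=
  p.sum fun i c => c • twPow F (rhoT W f g θ) i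

/-- The Anderson module `ρ_a`, for `a = p(t) + y r(t)` in `𝔽_q[t, y]`. -/
noncomputable def rho (θ η : L) (a : W.toAffine.CoordinateRing) :
    ℕ → Matrix (Fin n) (Fin n) L :=
  rhoPoly W f g θ (partOne W.toAffine a) +
    twMul F (rhoY W f g η) (rhoPoly W f g θ (partY W.toAffine a))

/-- The coefficients `Q_i` of the exponential series `Exp(z) = ∑ Q_i z^{(i)}` of `ρ`: the series
with `Q_0 = I` and `Exp (d[a] z) = ρ_a (Exp z)` for all `a` in `𝔽_q[t, y]`, where `d[a]` is the
constant coefficient of `ρ_a`. -/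
noncomputable def expCoeff (θ η : L) : ℕ → Matrix (Fin n) (Fin n) L :=
  Classical.epsilon fun Q : ℕ → Matrix (Fin n) (Fin n) L =>
    Q 0 = 1 ∧ ∀ a : W.toAffine.CoordinateRing,
      twMul F Q (Pi.single 0 (rho W f g θ η a 0)) = twMul F (rho W f g θ η a) Q

end Motive

/-! ## Anderson generating functions -/

section Generating

variable {F : Type*} [Field F] [Fintype F] {C : Type*} [NormedField C] [DecidableEq C]
  [Algebra F C] (W : WeierstrassCurve F) {n : ℕ} [NeZero n]
  (f : (W.baseChange C).toAffine.FunctionField)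
  (g : Fin n → (W.baseChange C).toAffine.FunctionField) (θ η : C)

/-- The `i`-th term `Q_i z^{(i)}` of the exponential series. -/
noncomputable def expTerm (z : Fin n → C) (i : ℕ) : Fin n → C :=
  (expCoeff W f g θ η i).mulVec fun k => z k ^ Fintype.card F ^ i

/-- The exponential function `Exp(z) = ∑ Q_i z^{(i)}`. -/
noncomputable def expFun (z : Fin n → C) : Fin n → C :=
  fun k => ∑' i, expTerm W f g θ η z i k

/-- `E_u(t) = ∑ Exp(d[θ]^{-i-1} u) t^i`, coordinatewise. -/
noncomputable def andersonE (u : Fin n → C) (k : Fin n) : PowerSeries C :=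
  PowerSeries.mk fun i =>
    expFun W f g θ η ((((rhoT W f g θ 0)⁻¹) ^ (i + 1)).mulVec u) k

/-- `G_u(t, y) = E_{d[η] u}(t) + (y + c₁ t + c₃) E_u(t)`. A pair `(a, b)` of power series stands
for the function `a(t) + b(t) y`. -/
noncomputable def andersonG (u : Fin n → C) (k : Fin n) : PowerSeries C × PowerSeries C :=
  (andersonE W f g θ η ((rhoY W f g η 0).mulVec u) k +
      (PowerSeries.C (algebraMap F C W.a₁) * PowerSeries.X + PowerSeries.C (algebraMap F C W.a₃)) *
        andersonE W f g θ η u k,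
    andersonE W f g θ η u k)

end Generating

/-! ## Meromorphic functions on `U = E ∖ {∞}` and residues at `Ξ` -/

section Residues

variable {F : Type*} [Field F] {C : Type*} [NormedField C] [Algebra F C]

/-- `d` is a common denominator, on the preimage `U_r` in `E` of the disk `|t| ≤ r`, of the
function `a(t) + b(t) y`: it is a nonzero element of the Tate algebra `𝕋_r` of power series
converging for `|t| ≤ r`, and `d a` and `d b` lie in `𝕋_r`. -/
def IsDenominator (r : ℝ) (h : PowerSeries C × PowerSeries C) (d : PowerSeries C) : Prop :=
  d ≠ 0 ∧ PowerSeries.IsRestricted r d ∧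
    PowerSeries.IsRestricted r (d * h.1) ∧ PowerSeries.IsRestricted r (d * h.2)

/-- The elements `h = a(t) + b(t) y` of `𝕋[y]` that have a meromorphic continuation to `U`, which
is the union of the `U_r`, `r ≥ 1`. The ring of functions on `U_r` is `𝕋_r[y] = 𝕋_r ⊕ 𝕋_r y`, and
a meromorphic function on `U_r` is a quotient of an element of `𝕋_r[y]` by a nonzero element
of `𝕋_r`. -/
def IsMeromorphicOnU (h : PowerSeries C × PowerSeries C) : Prop :=
  PowerSeries.IsRestricted 1 h.1 ∧ PowerSeries.IsRestricted 1 h.2 ∧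
    ∀ r : ℝ, 1 ≤ r → ∃ d, IsDenominator r h d

/-- The Taylor expansion of `s` at `θ`, in powers of `x = t - θ`. -/
noncomputable def recenter (θ : C) (s : PowerSeries C) : PowerSeries C :=
  PowerSeries.mk fun k =>
    ∑' i : ℕ, ((i + k).choose k : C) * PowerSeries.coeff (i + k) s * θ ^ i

/-- The expansion of `y` at `Ξ = (θ, η)` in powers of the uniformizer `x = t - θ`: the power
series `Y` with `Y(0) = η` for which `(θ + x, Y)` satisfies the equation of the curve. -/
noncomputable def yExpansion (W : WeierstrassCurve F) (θ η : C) : PowerSeries C :=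
  Classical.epsilon fun Y : PowerSeries C =>
    PowerSeries.constantCoeff Y = η ∧
      (W.baseChange (PowerSeries C)).toAffine.Equation (PowerSeries.C θ + PowerSeries.X) Y

/-- `ℓ` is the Laurent expansion at `Ξ`, in powers of `x = t - θ`, of the meromorphic continuation
`(d a + d b y) / d` of `h = a + b y`, where `d` is a denominator on some `U_r` containing `Ξ`. -/
def IsLaurentExpansion (W : WeierstrassCurve F) (θ η : C) (h : PowerSeries C × PowerSeries C)
    (l : LaurentSeries C) : Prop :=
  ∃ r : ℝ, 1 ≤ r ∧ ‖θ‖ ≤ r ∧ ∃ d, IsDenominator r h d ∧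
    HahnSeries.ofPowerSeries ℤ C (recenter θ d) * l =
      HahnSeries.ofPowerSeries ℤ C
        (recenter θ (d * h.1) + recenter θ (d * h.2) * yExpansion W θ η)

/-- The expansion at `Ξ` of `1 / (2 y + c₁ t + c₃)`, so that the invariant differential is
`λ = lambdaExpansion dx` with `x = t - θ`. -/
noncomputable def lambdaExpansion (W : WeierstrassCurve F) (θ η : C) : LaurentSeries C :=
  (HahnSeries.ofPowerSeries ℤ C
    (2 * yExpansion W θ η +
      PowerSeries.C (algebraMap F C W.a₁) * (PowerSeries.C θ + PowerSeries.X) +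
      PowerSeries.C (algebraMap F C W.a₃)))⁻¹

/-- The residue at `Ξ` of `h λ`. -/
noncomputable def residueXi (W : WeierstrassCurve F) (θ η : C)
    (h : PowerSeries C × PowerSeries C) : C :=
  HahnSeries.coeff
    ((Classical.epsilon fun l : LaurentSeries C => IsLaurentExpansion W θ η h l) *
      lambdaExpansion W θ η) (-1)

/-- `RES_Ξ` of a vector of functions. -/
noncomputable def RES (W : WeierstrassCurve F) (θ η : C) {n : ℕ}
    (h : Fin n → PowerSeries C × PowerSeries C) : Fin n → C :=
  fun k => residueXi W θ η (h k)

end Residues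

end TensorDrinfeld

open TensorDrinfeld

/-! Let `D = d[θ]` and `Y = d[η]`: upper triangular matrices with constant diagonal `θ`,
respectively `η`. Formally `E_u = ∑_j Q_j (D^{(j)} - t)⁻¹ u^{(j)}`, since `∑ D^{-i-1} t^i` is the
geometric series of `(D - t)⁻¹`. The `j`-th summand has its only pole at `t = θ^{q^j}`, so at `Ξ`
only `j = 0`, with `Q_0 = 1`, is singular. Up to a holomorphic term, `G_u` is therefore `(D - t)⁻¹
(Y + y + c₁t + c₃) u`.

The pair `(D, Y)` satisfies the Weierstrass equation because `(ρ_t, ρ_y)` does. Subtracting it from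
the equation for `(t, y)` gives `(y - Y)(Y + y + c₁t + c₃) = (t - D) S` (`weierstrass_factor`). The
second factor on the left is invertible at `Ξ`, hence `y - Y` is divisible by `t - D`, and `Y + y +
c₁t + c₃` is `2y + c₁t + c₃` modulo `D - t` (`exists_conjSum_eq`). The denominator of `λ` cancels
this scalar, and what is left is `(D - t)⁻¹ u` plus a holomorphic term. With `x = t - θ` and `N = D
- θ` nilpotent, `(N - x)⁻¹ = -∑ N^k x^{-k-1}` has residue `-1` (`coeff_laurentInv_mulVec`).

Three things support this computation.

The module structure. The functions `g_m` have order `n - 1 - m` at `∞` and sign `1`. They form a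
basis of the functions whose only poles off `∞` are of order at most `n` at `V`: leading terms are
subtracted one at a time (`IsMotiveData.exists_eq_sum_gExt`), and the orders are distinct
(`IsMotiveData.eq_zero_of_sum_gExt`). So identities between functions, such as commutation and the
Weierstrass equation, pass to twisted polynomials (`IsMotiveData.eq_of_represents`). The argument
needs the last zero of every `g_j` to be affine. For `g_1` this says that `nV ≠ ∞`, which follows
from the transcendence of `V`, `V^{(1)}` and `V - V^{(1)} = Ξ` over `𝔽_q`
(`nsmul_ne_zero_of_transcendental`).

The exponential. Its coefficients solve Sylvester equations `Q_i D^{(i)} - D Q_i = R_i`, which are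
nonsingular because `|θ^{q^i}| > |θ|`. Since `ρ_t` has degree at most `2` in `τ` and `|θ| = q²`,
induction gives `|Q_i| ≤ (K / q^i)^{q^i}` (`IsUpperWithDiag.exists_growth`), so the series is
entire.

The continuation. The tail `j ≥ J` of `E_u` converges for `|t| < |θ|^{q^J}`, and the finitely many
other summands are rational (`HasGrowth.isRestricted_andersonE`). Taylor expansion at `θ` is an
injective ring homomorphism, so the Laurent expansion at `Ξ` does not depend on the chosen
denominator (`IsLaurentExpansion.unique`). -/

namespace TensorDrinfeld

/-! ### Degree and leading coefficient on the coordinate ring. -/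

section Degree

variable {L : Type*} [Field L] (E : WeierstrassCurve.Affine L)

theorem partOne_smul_add_partY_smul (a : E.CoordinateRing) :
    partOne E a • (1 : E.CoordinateRing) + partY E a • CoordinateRing.mk E X = a := by
  have h := (CoordinateRing.basis E).sum_repr a
  rwa [Fin.sum_univ_two, CoordinateRing.basis_zero, CoordinateRing.basis_one] at h

theorem partOne_smul_add_smul (p r : L[X]) :
    partOne E (p • (1 : E.CoordinateRing) + r • CoordinateRing.mk E X) = p := by
  rw [partOne, ← CoordinateRing.basis_zero, ← CoordinateRing.basis_one, map_add, map_smul,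
    map_smul, Module.Basis.repr_self, Module.Basis.repr_self]
  simp

theorem partY_smul_add_smul (p r : L[X]) :
    partY E (p • (1 : E.CoordinateRing) + r • CoordinateRing.mk E X) = r := by
  rw [partY, ← CoordinateRing.basis_zero, ← CoordinateRing.basis_one, map_add, map_smul,
    map_smul, Module.Basis.repr_self, Module.Basis.repr_self]
  simp

/-- The polynomial `p(s²) + r(s²) s³` attached to `a = p(t) + r(t) y`. -/
noncomputable def weightPoly (a : E.CoordinateRing) : L[X] :=
  expand L 2 (partOne E a) + expand L 2 (partY E a) * X ^ 3

theorem weightPoly_add (a b : E.CoordinateRing) :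
    weightPoly E (a + b) = weightPoly E a + weightPoly E b := by
  simp only [weightPoly, partOne, partY, map_add, Finsupp.add_apply]; ring

theorem weightPoly_smul_add_smul (p r : L[X]) :
    weightPoly E (p • (1 : E.CoordinateRing) + r • CoordinateRing.mk E X) =
      expand L 2 p + expand L 2 r * X ^ 3 := by
  rw [weightPoly, partOne_smul_add_smul, partY_smul_add_smul]

theorem weightPoly_zero : weightPoly E 0 = 0 := by
  simp [weightPoly, partOne, partY]

theorem weightPoly_smul (c : L[X]) (a : E.CoordinateRing) :
    weightPoly E (c • a) = expand L 2 c * weightPoly E a := by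
  simp only [weightPoly, partOne, partY, map_smul, Finsupp.smul_apply, smul_eq_mul, map_mul]; ring

theorem weightPoly_const_smul (c : L) (a : E.CoordinateRing) :
    weightPoly E (c • a) = C c * weightPoly E a := by
  have : c • a = (C c : L[X]) • a := by
    rw [← algebraMap_smul L[X] c a]; rfl
  rw [this, weightPoly_smul, expand_C]

/-- The first summand of `weightPoly` has only even exponents and the second only odd ones, so their
leading terms cannot cancel. -/
theorem natDegree_leadingCoeff_weightPoly (a : E.CoordinateRing) :
    (weightPoly E a).natDegree = degA E a ∧ (weightPoly E a).leadingCoeff = sgnA E a := by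
  classical
  rw [weightPoly, degA, sgnA]
  set p := partOne E a
  set r := partY E a
  have hp : (expand L 2 p).natDegree = 2 * p.natDegree := by rw [natDegree_expand, mul_comm]
  by_cases hr : r = 0
  · simp [hr, hp, leadingCoeff_expand (by norm_num : 0 < 2)]
  have hr' : expand L 2 r ≠ 0 := by simpa using (expand_ne_zero (by norm_num : 0 < 2)).mpr hr
  have hq : (expand L 2 r * X ^ 3).natDegree = 2 * r.natDegree + 3 := by
    rw [natDegree_mul_X_pow _ hr', natDegree_expand, mul_comm]
  have hl : (expand L 2 r * X ^ 3).leadingCoeff = r.leadingCoeff := by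
    rw [leadingCoeff_mul_X_pow, leadingCoeff_expand (by norm_num)]
  rw [if_neg hr]
  rcases lt_or_ge (2 * p.natDegree) (2 * r.natDegree + 3) with h | h
  · rw [if_pos ⟨hr, h⟩, natDegree_add_eq_right_of_natDegree_lt (by omega), hq,
      leadingCoeff_add_of_degree_lt (degree_lt_degree (by omega)), hl]
    exact ⟨by omega, rfl⟩
  · rw [if_neg (by omega), natDegree_add_eq_left_of_natDegree_lt (by omega), hp,
      leadingCoeff_add_of_degree_lt' (degree_lt_degree (by omega)),
      leadingCoeff_expand (by norm_num)]
    exact ⟨by omega, rfl⟩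

theorem natDegree_weightPoly (a : E.CoordinateRing) : (weightPoly E a).natDegree = degA E a :=
  (natDegree_leadingCoeff_weightPoly E a).1

theorem leadingCoeff_weightPoly (a : E.CoordinateRing) :
    (weightPoly E a).leadingCoeff = sgnA E a :=
  (natDegree_leadingCoeff_weightPoly E a).2

open Classical in
theorem degA_eq (a : E.CoordinateRing) : degA E a = max (2 * (partOne E a).natDegree)
    (if partY E a = 0 then 0 else 2 * (partY E a).natDegree + 3) := by
  rfl

theorem weightPoly_eq_zero_iff {a : E.CoordinateRing} : weightPoly E a = 0 ↔ a = 0 := by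
  refine ⟨fun h => ?_, fun h => h ▸ weightPoly_zero E⟩
  have hd : degA E a = 0 := by rw [← natDegree_weightPoly, h, natDegree_zero]
  have hs : sgnA E a = 0 := by rw [← leadingCoeff_weightPoly, h, leadingCoeff_zero]
  rw [degA_eq] at hd
  have hr : partY E a = 0 := by
    by_contra hr
    rw [if_neg hr] at hd
    omega
  rw [sgnA, if_neg (by simp [hr])] at hs
  rw [← partOne_smul_add_partY_smul E a, hr, leadingCoeff_eq_zero.mp hs]
  simp

theorem sgnA_ne_zero {a : E.CoordinateRing} (ha : a ≠ 0) : sgnA E a ≠ 0 := by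
  rwa [← leadingCoeff_weightPoly, Ne, leadingCoeff_eq_zero, weightPoly_eq_zero_iff]

/-- The substitution `t = s²`, `y = s³` is multiplicative on the cusp `y² = t³`. The other terms of
the Weierstrass equation have weight at most `5 < 6`, so it is multiplicative on leading terms here,
and degree and sign inherit this. -/
theorem degree_weightPoly_mul_sub_lt {a b : E.CoordinateRing} (ha : a ≠ 0) (hb : b ≠ 0) :
    (weightPoly E (a * b) - weightPoly E a * weightPoly E b).degree <
      (weightPoly E a * weightPoly E b).degree := by
  have ha' := (weightPoly_eq_zero_iff E).not.mpr ha
  have hb' := (weightPoly_eq_zero_iff E).not.mpr hb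
  set p := partOne E a with hp
  set r := partY E a with hr
  set p' := partOne E b with hp'
  set r' := partY E b with hr'
  have hab : a * b = (p * p' + r * r' * (X ^ 3 + C E.a₂ * X ^ 2 + C E.a₄ * X + C E.a₆)) •
      (1 : E.CoordinateRing) +
      (p * r' + r * p' - r * r' * (C E.a₁ * X + C E.a₃)) • CoordinateRing.mk E X := by
    conv_lhs => rw [← partOne_smul_add_partY_smul E a, ← partOne_smul_add_partY_smul E b]
    rw [mul_add, mul_smul_comm, mul_smul_comm, mul_one, CoordinateRing.smul_basis_mul_Y]
    rw [smul_add, smul_add, smul_smul, smul_smul, smul_smul, smul_smul]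
    simp only [← hp, ← hr, ← hp', ← hr', add_smul, sub_smul, mul_sub, mul_comm, mul_left_comm,
      mul_assoc]
    abel
  have hdiff : weightPoly E (a * b) - weightPoly E a * weightPoly E b =
      expand L 2 (r * r') * (C E.a₂ * X ^ 4 + C E.a₄ * X ^ 2 + C E.a₆ -
        (C E.a₁ * X ^ 2 + C E.a₃) * X ^ 3) := by
    rw [hab, weightPoly_smul_add_smul, weightPoly, weightPoly]
    simp only [← hp, ← hr, ← hp', ← hr', map_add, map_sub, map_mul, map_pow, expand_X, expand_C]
    ring
  rw [hdiff]
  by_cases h0 : r * r' = 0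
  · rw [h0, map_zero, zero_mul, degree_zero, bot_lt_iff_ne_bot, Ne, degree_eq_bot]
    exact mul_ne_zero ha' hb'
  have h1 : r ≠ 0 := left_ne_zero_of_mul h0
  have h2 : r' ≠ 0 := right_ne_zero_of_mul h0
  have hS : (C E.a₂ * X ^ 4 + C E.a₄ * X ^ 2 + C E.a₆ -
        (C E.a₁ * X ^ 2 + C E.a₃) * X ^ 3).natDegree ≤ 5 := by compute_degree
  apply degree_lt_degree
  refine natDegree_mul_le.trans_lt ?_
  rw [natDegree_mul ha' hb', natDegree_weightPoly, natDegree_weightPoly, degA_eq, degA_eq,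
    natDegree_expand, natDegree_mul h1 h2, ← hr, ← hr', if_neg h1, if_neg h2]
  omega

theorem degA_mul {a b : E.CoordinateRing} (ha : a ≠ 0) (hb : b ≠ 0) :
    degA E (a * b) = degA E a + degA E b := by
  have h := degree_weightPoly_mul_sub_lt E ha hb
  have ha' := (weightPoly_eq_zero_iff E).not.mpr ha
  have hb' := (weightPoly_eq_zero_iff E).not.mpr hb
  rw [← natDegree_weightPoly, ← natDegree_weightPoly, ← natDegree_weightPoly,
    ← natDegree_mul ha' hb', ← sub_add_cancel (weightPoly E (a * b)) (weightPoly E a * _)]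
  exact natDegree_eq_of_degree_eq (degree_add_eq_right_of_degree_lt h)

theorem sgnA_zero : sgnA E 0 = 0 := by
  rw [← leadingCoeff_weightPoly, weightPoly_zero, leadingCoeff_zero]

theorem sgnA_mul (a b : E.CoordinateRing) : sgnA E (a * b) = sgnA E a * sgnA E b := by
  by_cases ha : a = 0
  · rw [ha, zero_mul, sgnA_zero, zero_mul]
  by_cases hb : b = 0
  · rw [hb, mul_zero, sgnA_zero, mul_zero]
  have h := degree_weightPoly_mul_sub_lt E ha hb
  rw [← leadingCoeff_weightPoly, ← leadingCoeff_weightPoly, ← leadingCoeff_weightPoly,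
    ← leadingCoeff_mul, ← sub_add_cancel (weightPoly E (a * b)) (weightPoly E a * _)]
  exact leadingCoeff_add_of_degree_lt h

end Degree

/-! ### Order and sign at infinity of rational functions. -/

section Order

variable {L : Type*} [Field L] (E : WeierstrassCurve.Affine L)

/-- Order and sign are defined from an arbitrarily chosen fraction; cross-multiplication allows them
to be computed from any other fraction. -/
theorem sec_spec (h : E.FunctionField) (hh : h ≠ 0) {a b : E.CoordinateRing} (hb : b ≠ 0)
    (hab : h * algebraMap _ _ b = algebraMap _ _ a) :
    (IsLocalization.sec E.CoordinateRing⁰ h).1 ≠ 0 ∧ a ≠ 0 ∧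
    (IsLocalization.sec E.CoordinateRing⁰ h).1 * b =
      a * ((IsLocalization.sec E.CoordinateRing⁰ h).2 : E.CoordinateRing) := by
  have hs := IsLocalization.sec_spec E.CoordinateRing⁰ h
  have hinj := IsFractionRing.injective E.CoordinateRing E.FunctionField
  have h2 : ((IsLocalization.sec E.CoordinateRing⁰ h).2 : E.CoordinateRing) ≠ 0 :=
    nonZeroDivisors.ne_zero (IsLocalization.sec E.CoordinateRing⁰ h).2.2
  refine ⟨fun h0 => ?_, fun h0 => ?_, hinj ?_⟩
  · rw [h0, map_zero] at hs
    exact mul_ne_zero hh ((map_ne_zero_iff _ hinj).mpr h2) hs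
  · rw [h0, map_zero] at hab
    exact mul_ne_zero hh ((map_ne_zero_iff _ hinj).mpr hb) hab
  · rw [map_mul, map_mul, ← hs, ← hab]; ring

theorem ordInfty_eq {h : E.FunctionField} (hh : h ≠ 0) {a b : E.CoordinateRing} (hb : b ≠ 0)
    (hab : h * algebraMap _ _ b = algebraMap _ _ a) :
    ordInfty E h = (degA E b : ℤ) - degA E a := by
  obtain ⟨h1, ha, he⟩ := sec_spec E h hh hb hab
  have h2 : ((IsLocalization.sec E.CoordinateRing⁰ h).2 : E.CoordinateRing) ≠ 0 :=
    nonZeroDivisors.ne_zero (IsLocalization.sec E.CoordinateRing⁰ h).2.2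
  have := congr_arg (degA E) he
  rw [degA_mul E h1 hb, degA_mul E ha h2] at this
  rw [ordInfty]; omega

theorem sgn_eq {h : E.FunctionField} (hh : h ≠ 0) {a b : E.CoordinateRing} (hb : b ≠ 0)
    (hab : h * algebraMap _ _ b = algebraMap _ _ a) :
    sgn E h = sgnA E a / sgnA E b := by
  obtain ⟨h1, ha, he⟩ := sec_spec E h hh hb hab
  have h2 : ((IsLocalization.sec E.CoordinateRing⁰ h).2 : E.CoordinateRing) ≠ 0 :=
    nonZeroDivisors.ne_zero (IsLocalization.sec E.CoordinateRing⁰ h).2.2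
  have := congr_arg (sgnA E) he
  rw [sgnA_mul, sgnA_mul] at this
  rw [sgn, div_eq_div_iff (sgnA_ne_zero E h2) (sgnA_ne_zero E hb), this]

theorem exists_mul_eq (h : E.FunctionField) :
    ∃ a b : E.CoordinateRing, b ≠ 0 ∧ h * algebraMap _ _ b = algebraMap _ _ a :=
  ⟨_, _, nonZeroDivisors.ne_zero (IsLocalization.sec E.CoordinateRing⁰ h).2.2,
    IsLocalization.sec_spec E.CoordinateRing⁰ h⟩

/-- Two functions over a common denominator. -/
theorem exists_mul_eq₂ (h k : E.FunctionField) : ∃ a a' b : E.CoordinateRing, b ≠ 0 ∧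
    h * algebraMap _ _ b = algebraMap _ _ a ∧ k * algebraMap _ _ b = algebraMap _ _ a' := by
  obtain ⟨a, b, hb, hab⟩ := exists_mul_eq E h
  obtain ⟨a', b', hb', hab'⟩ := exists_mul_eq E k
  refine ⟨a * b', a' * b, b * b', mul_ne_zero hb hb', ?_, ?_⟩
  · rw [map_mul, map_mul, ← hab]; ring
  · rw [map_mul, map_mul, ← hab']; ring

theorem num_ne_zero {h : E.FunctionField} (hh : h ≠ 0) {a b : E.CoordinateRing} (hb : b ≠ 0)
    (hab : h * algebraMap _ _ b = algebraMap _ _ a) : a ≠ 0 :=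
  (sec_spec E h hh hb hab).2.1

theorem ordInfty_mul {h k : E.FunctionField} (hh : h ≠ 0) (hk : k ≠ 0) :
    ordInfty E (h * k) = ordInfty E h + ordInfty E k := by
  obtain ⟨a, b, hb, hab⟩ := exists_mul_eq E h
  obtain ⟨a', b', hb', hab'⟩ := exists_mul_eq E k
  rw [ordInfty_eq E hh hb hab, ordInfty_eq E hk hb' hab',
    ordInfty_eq E (mul_ne_zero hh hk) (mul_ne_zero hb hb') (a := a * a')
      (by rw [map_mul, map_mul, ← hab, ← hab']; ring),
    degA_mul E hb hb', degA_mul E (num_ne_zero E hh hb hab) (num_ne_zero E hk hb' hab')]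
  push_cast; ring

theorem sgn_mul {h k : E.FunctionField} (hh : h ≠ 0) (hk : k ≠ 0) :
    sgn E (h * k) = sgn E h * sgn E k := by
  obtain ⟨a, b, hb, hab⟩ := exists_mul_eq E h
  obtain ⟨a', b', hb', hab'⟩ := exists_mul_eq E k
  rw [sgn_eq E hh hb hab, sgn_eq E hk hb' hab',
    sgn_eq E (mul_ne_zero hh hk) (mul_ne_zero hb hb') (a := a * a')
      (by rw [map_mul, map_mul, ← hab, ← hab']; ring), sgnA_mul, sgnA_mul, div_mul_div_comm]

theorem ordInfty_algebraMap {a : E.CoordinateRing} (ha : a ≠ 0) :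
    ordInfty E (algebraMap _ _ a) = -(degA E a : ℤ) := by
  have h1 : degA E 1 = 0 := by
    have := degA_mul E (one_ne_zero (α := E.CoordinateRing)) one_ne_zero
    rw [one_mul] at this; omega
  rw [ordInfty_eq E ((map_ne_zero_iff _ (IsFractionRing.injective _ _)).mpr ha) one_ne_zero
    (a := a) (by rw [map_one, mul_one]), h1]
  simp

theorem sgn_algebraMap {a : E.CoordinateRing} (ha : a ≠ 0) :
    sgn E (algebraMap _ _ a) = sgnA E a := by
  have h1 : sgnA E 1 = 1 := by
    have := sgnA_mul E 1 1
    rw [one_mul] at this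
    exact (mul_eq_left₀ (sgnA_ne_zero E one_ne_zero)).mp this.symm
  rw [sgn_eq E ((map_ne_zero_iff _ (IsFractionRing.injective _ _)).mpr ha) one_ne_zero
    (a := a) (by rw [map_one, mul_one]), h1, div_one]

theorem ordInfty_one : ordInfty E 1 = 0 := by
  have := ordInfty_mul E (one_ne_zero (α := E.FunctionField)) one_ne_zero
  rw [one_mul] at this; omega

theorem sgn_ne_zero {h : E.FunctionField} (hh : h ≠ 0) : sgn E h ≠ 0 := by
  obtain ⟨a, b, hb, hab⟩ := exists_mul_eq E h
  rw [sgn_eq E hh hb hab]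
  exact div_ne_zero (sgnA_ne_zero E (num_ne_zero E hh hb hab)) (sgnA_ne_zero E hb)

theorem sgn_one : sgn E 1 = 1 := by
  have := sgn_mul E (one_ne_zero (α := E.FunctionField)) one_ne_zero
  rw [one_mul] at this
  exact (mul_eq_left₀ (sgn_ne_zero E one_ne_zero)).mp this.symm

theorem ordInfty_pow {h : E.FunctionField} (hh : h ≠ 0) (n : ℕ) :
    ordInfty E (h ^ n) = n * ordInfty E h := by
  induction n with
  | zero => simp [ordInfty_one]
  | succ n ih => rw [pow_succ, ordInfty_mul E (pow_ne_zero n hh) hh, ih]; push_cast; ring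

theorem sgn_pow {h : E.FunctionField} (hh : h ≠ 0) (n : ℕ) :
    sgn E (h ^ n) = sgn E h ^ n := by
  induction n with
  | zero => simp [sgn_one]
  | succ n ih => rw [pow_succ, sgn_mul E (pow_ne_zero n hh) hh, ih, pow_succ]

theorem algebraMap_const_smul (c : L) (a : E.CoordinateRing) :
    algebraMap E.CoordinateRing E.FunctionField (c • a) = c • algebraMap _ E.FunctionField a := by
  rw [Algebra.smul_def, Algebra.smul_def, map_mul, ← IsScalarTower.algebraMap_apply]

theorem ordInfty_const_smul {c : L} (hc : c ≠ 0) {h : E.FunctionField} (hh : h ≠ 0) :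
    ordInfty E (c • h) = ordInfty E h := by
  obtain ⟨a, b, hb, hab⟩ := exists_mul_eq E h
  rw [ordInfty_eq E hh hb hab, ordInfty_eq E (smul_ne_zero hc hh) hb (a := c • a)
    (by rw [algebraMap_const_smul, ← hab, smul_mul_assoc]), ← natDegree_weightPoly E (c • a),
    weightPoly_const_smul, natDegree_C_mul hc, natDegree_weightPoly]

/-- Adding a function of larger order changes neither order nor sign. -/
theorem ordInfty_sgn_add_of_lt {h k : E.FunctionField} (hh : h ≠ 0)
    (hk : k = 0 ∨ ordInfty E h < ordInfty E k) :
    h + k ≠ 0 ∧ ordInfty E (h + k) = ordInfty E h ∧ sgn E (h + k) = sgn E h := by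
  rcases eq_or_ne k 0 with rfl | hk0
  · simpa using hh
  replace hk := hk.resolve_left hk0
  obtain ⟨a, a', b, hb, hab, hab'⟩ := exists_mul_eq₂ E h k
  have ha := num_ne_zero E hh hb hab
  have ha' := num_ne_zero E hk0 hb hab'
  rw [ordInfty_eq E hh hb hab, ordInfty_eq E hk0 hb hab'] at hk
  have hlt : (weightPoly E a').degree < (weightPoly E a).degree := by
    apply degree_lt_degree
    rw [natDegree_weightPoly, natDegree_weightPoly]; omega
  have hne : a + a' ≠ 0 := fun h0 => by
    have := congr_arg (weightPoly E) h0
    rw [weightPoly_add, weightPoly_zero] at this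
    have hd := degree_add_eq_left_of_degree_lt hlt
    rw [this, degree_zero] at hd
    exact ha ((weightPoly_eq_zero_iff E).mp (degree_eq_bot.mp hd.symm))
  have hsum : (h + k) * algebraMap _ _ b = algebraMap _ _ (a + a') := by
    rw [map_add, add_mul, hab, hab']
  have hne' : h + k ≠ 0 := fun h0 => by
    rw [h0, zero_mul, eq_comm, map_eq_zero_iff _ (IsFractionRing.injective _ _)] at hsum
    exact hne hsum
  refine ⟨hne', ?_, ?_⟩
  · rw [ordInfty_eq E hne' hb hsum, ordInfty_eq E hh hb hab, ← natDegree_weightPoly E (a + a'),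
      weightPoly_add, natDegree_eq_of_degree_eq (degree_add_eq_left_of_degree_lt hlt),
      natDegree_weightPoly]
  · rw [sgn_eq E hne' hb hsum, sgn_eq E hh hb hab, ← leadingCoeff_weightPoly E (a + a'),
      weightPoly_add, leadingCoeff_add_of_degree_lt' hlt, leadingCoeff_weightPoly]

/-- Subtracting the right multiple of a function of the same order increases the order. -/
theorem exists_ordInfty_sub_smul {h k : E.FunctionField} (hk : k ≠ 0)
    (hh : h = 0 ∨ ordInfty E k ≤ ordInfty E h) :
    ∃ c : L, (h - c • k = 0 ∨ ordInfty E k < ordInfty E (h - c • k)) ∧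
      (h ≠ 0 → ordInfty E h = ordInfty E k → c = sgn E h / sgn E k) := by
  rcases eq_or_ne h 0 with rfl | hh0
  · exact ⟨0, by simp⟩
  replace hh := hh.resolve_left hh0
  rcases hh.lt_or_eq with hlt | heq
  · exact ⟨0, by simpa using Or.inr hlt, fun _ h => absurd h hlt.ne'⟩
  -- For equal orders this quotient of signs is the constant that cancels the leading terms of the
  -- numerators over a common denominator.
  refine ⟨sgn E h / sgn E k, ?_, fun _ _ => rfl⟩
  by_contra! hcon
  obtain ⟨hne, hle⟩ := hcon
  set c := sgn E h / sgn E k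
  have hc : c ≠ 0 := div_ne_zero (sgn_ne_zero E hh0) (sgn_ne_zero E hk)
  obtain ⟨a, a', b, hb, hab, hab'⟩ := exists_mul_eq₂ E h k
  have ha := num_ne_zero E hh0 hb hab
  have ha' := num_ne_zero E hk hb hab'
  have hd : (h - c • k) * algebraMap _ _ b = algebraMap _ _ (a - c • a') := by
    rw [map_sub, sub_mul, hab, smul_mul_assoc, hab', algebraMap_const_smul]
  have hne' := num_ne_zero E hne hb hd
  rw [ordInfty_eq E hne hb hd, ordInfty_eq E hk hb hab'] at hle
  rw [ordInfty_eq E hh0 hb hab, ordInfty_eq E hk hb hab'] at heq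
  have hcs : c = sgnA E a / sgnA E a' := by
    simp only [c]
    rw [sgn_eq E hh0 hb hab, sgn_eq E hk hb hab', div_div_div_cancel_right₀ (sgnA_ne_zero E hb)]
  have hw : weightPoly E (a - c • a') = weightPoly E a - C c * weightPoly E a' := by
    have : a - c • a' = a + (-c) • a' := by rw [neg_smul, sub_eq_add_neg]
    rw [this, weightPoly_add, weightPoly_const_smul, C_neg]; ring
  have hlt : (weightPoly E (a - c • a')).degree < (weightPoly E a).degree := by
    rw [hw]
    apply degree_sub_lt_left
    · rw [degree_C_mul hc, degree_eq_natDegree ((weightPoly_eq_zero_iff E).not.mpr ha),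
        degree_eq_natDegree ((weightPoly_eq_zero_iff E).not.mpr ha'), natDegree_weightPoly,
        natDegree_weightPoly]
      norm_cast; omega
    · exact (weightPoly_eq_zero_iff E).not.mpr ha
    · rw [leadingCoeff_mul, leadingCoeff_C, leadingCoeff_weightPoly, leadingCoeff_weightPoly, hcs,
        div_mul_cancel₀ _ (sgnA_ne_zero E ha')]
  have := natDegree_lt_natDegree ((weightPoly_eq_zero_iff E).not.mpr hne') hlt
  rw [natDegree_weightPoly, natDegree_weightPoly] at this
  omega

end Order

end TensorDrinfeld

namespace TensorDrinfeld

/-! ### Effect of twisting on order and sign. -/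

section TwistOrder

variable {F : Type*} [Field F] [Fintype F] {L : Type*} [Field L] [Algebra F L]
  (W : WeierstrassCurve F)

theorem twistA_mk (x : L[X][X]) : twistA W (CoordinateRing.mk _ x) =
    CoordinateRing.mk (W.baseChange L).toAffine
      (x.map (mapRingHom (FiniteField.frobeniusAlgHom F L : L →+* L))) := by
  rw [twistA, AdjoinRoot.lift_mk, ← eval₂_map]
  exact AdjoinRoot.aeval_eq _

theorem twistA_smul (p : L[X]) (z : (W.baseChange L).toAffine.CoordinateRing) :
    twistA W (p • z) = p.map (FiniteField.frobeniusAlgHom F L : L →+* L) • twistA W z := by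
  rw [CoordinateRing.smul, map_mul, twistA_mk, map_C, CoordinateRing.smul]
  rfl

theorem weightPoly_twistA (a : (W.baseChange L).toAffine.CoordinateRing) :
    weightPoly _ (twistA W a) =
      (weightPoly _ a).map (FiniteField.frobeniusAlgHom F L : L →+* L) := by
  conv_lhs => rw [← partOne_smul_add_partY_smul _ a, map_add, twistA_smul, twistA_smul, map_one,
    twistA_mk, map_X, weightPoly_smul_add_smul]
  rw [weightPoly, Polynomial.map_add, Polynomial.map_mul, map_expand, map_expand,
    Polynomial.map_pow, map_X]

theorem degA_twistA (a : (W.baseChange L).toAffine.CoordinateRing) :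
    degA _ (twistA W a) = degA _ a := by
  rw [← natDegree_weightPoly, weightPoly_twistA, natDegree_map, natDegree_weightPoly]

theorem sgnA_twistA (a : (W.baseChange L).toAffine.CoordinateRing) :
    sgnA _ (twistA W a) = sgnA _ a ^ Fintype.card F := by
  rw [← leadingCoeff_weightPoly, weightPoly_twistA, leadingCoeff_map, leadingCoeff_weightPoly]
  rfl

theorem twist_algebraMap (a : (W.baseChange L).toAffine.CoordinateRing) :
    twist W (algebraMap _ (W.baseChange L).toAffine.FunctionField a) =
      algebraMap _ (W.baseChange L).toAffine.FunctionField (twistA W a) :=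
  IsLocalization.map_eq (nonZeroDivisors_le_comap_nonZeroDivisors_of_injective _
    (twistA_injective (F := F) (L := L) W)) a

theorem twist_const_smul (c : L) (h : (W.baseChange L).toAffine.FunctionField) :
    twist W (c • h) = c ^ Fintype.card F • twist W h := by
  have h1 : algebraMap L (W.baseChange L).toAffine.FunctionField c =
      algebraMap _ _ (CoordinateRing.mk (W.baseChange L).toAffine (C (C c))) := by
    rw [IsScalarTower.algebraMap_apply L (W.baseChange L).toAffine.CoordinateRing]; rfl
  have h2 : algebraMap L (W.baseChange L).toAffine.FunctionField (c ^ Fintype.card F) =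
      algebraMap _ _ (CoordinateRing.mk (W.baseChange L).toAffine (C (C (c ^ Fintype.card F)))) := by
    rw [IsScalarTower.algebraMap_apply L (W.baseChange L).toAffine.CoordinateRing]; rfl
  rw [Algebra.smul_def, Algebra.smul_def, map_mul, h1, h2, twist_algebraMap, twistA_mk, map_C,
    coe_mapRingHom, map_C]
  rfl

theorem twist_tFun : twist W (tFun (W.baseChange L).toAffine) = tFun _ := by
  rw [tFun, twist_algebraMap, twistA_mk, map_C, coe_mapRingHom, map_X]

theorem twist_yFun : twist W (yFun (W.baseChange L).toAffine) = yFun _ := by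
  rw [yFun, twist_algebraMap, twistA_mk, map_X]

theorem twist_ne_zero {h : (W.baseChange L).toAffine.FunctionField} (hh : h ≠ 0) :
    twist W h ≠ 0 := (_root_.map_ne_zero _).mpr hh

theorem ordInfty_twist {h : (W.baseChange L).toAffine.FunctionField} (hh : h ≠ 0) :
    ordInfty _ (twist W h) = ordInfty _ h := by
  obtain ⟨a, b, hb, hab⟩ := exists_mul_eq _ h
  rw [ordInfty_eq _ hh hb hab, ordInfty_eq _ (twist_ne_zero W hh)
    ((map_ne_zero_iff _ (twistA_injective W)).mpr hb) (a := twistA W a)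
    (by rw [← twist_algebraMap, ← map_mul, hab, twist_algebraMap]), degA_twistA, degA_twistA]

theorem sgn_twist {h : (W.baseChange L).toAffine.FunctionField} (hh : h ≠ 0) :
    sgn _ (twist W h) = sgn _ h ^ Fintype.card F := by
  obtain ⟨a, b, hb, hab⟩ := exists_mul_eq _ h
  rw [sgn_eq _ hh hb hab, sgn_eq _ (twist_ne_zero W hh)
    ((map_ne_zero_iff _ (twistA_injective W)).mpr hb) (a := twistA W a)
    (by rw [← twist_algebraMap, ← map_mul, hab, twist_algebraMap]), sgnA_twistA, sgnA_twistA,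
    div_pow]

end TwistOrder

/-! ### Fractional ideals of points, and vanishing criteria. -/

section Ideals

variable {L : Type*} [Field L] (E : WeierstrassCurve.Affine L)

theorem XYIdeal_ne_top {x y : L} (h : E.Nonsingular x y) :
    CoordinateRing.XYIdeal E x (C y) ≠ ⊤ := by
  intro htop
  have e := CoordinateRing.quotientXYIdealEquiv (W' := E) (x := x) (y := C y) h.left
  rw [htop] at e
  have : Subsingleton (E.CoordinateRing ⧸ (⊤ : Ideal E.CoordinateRing)) :=
    Ideal.Quotient.subsingleton_iff.mpr rfl
  exact not_subsingleton L e.symm.injective.subsingleton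

/-- The pole orders at `∞` are `0, 2, 3, …`; the gap at `1` is where the genus enters. -/
theorem eq_const_of_degA_le_one {b : E.CoordinateRing} (hb : degA E b ≤ 1) :
    ∃ c : L, b = algebraMap L _ c := by
  classical
  rw [degA_eq] at hb
  have hr : partY E b = 0 := by
    by_contra hr
    rw [if_neg hr] at hb
    omega
  have hp : (partOne E b).natDegree = 0 := by omega
  obtain ⟨c, hc⟩ := natDegree_eq_zero.mp hp
  refine ⟨c, ?_⟩
  rw [← partOne_smul_add_partY_smul E b, hr, ← hc, zero_smul, add_zero, CoordinateRing.smul,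
    mul_one]
  rfl

theorem degA_sgnA_XClass (x : L) : degA E (CoordinateRing.XClass E x) = 2 ∧
    sgnA E (CoordinateRing.XClass E x) = 1 := by
  have h : weightPoly E (CoordinateRing.XClass E x) = X ^ 2 - C x := by
    have : CoordinateRing.XClass E x = (X - C x : L[X]) • (1 : E.CoordinateRing) +
        (0 : L[X]) • CoordinateRing.mk E X := by
      rw [zero_smul, add_zero, CoordinateRing.smul, mul_one]; rfl
    rw [this, weightPoly_smul_add_smul]
    simp
  rw [← natDegree_weightPoly, ← leadingCoeff_weightPoly, h]
  exact ⟨natDegree_X_pow_sub_C, leadingCoeff_X_pow_sub_C (by norm_num)⟩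

theorem degA_sgnA_YClass (y : L) : degA E (CoordinateRing.YClass E (C y)) = 3 ∧
    sgnA E (CoordinateRing.YClass E (C y)) = 1 := by
  have h : weightPoly E (CoordinateRing.YClass E (C y)) = X ^ 3 - C y := by
    have : CoordinateRing.YClass E (C y) = (-C y : L[X]) • (1 : E.CoordinateRing) +
        (1 : L[X]) • CoordinateRing.mk E X := by
      rw [one_smul, CoordinateRing.smul, mul_one, CoordinateRing.YClass, map_sub, map_neg C,
        map_neg]; ring
    rw [this, weightPoly_smul_add_smul]
    simp; ring
  rw [← natDegree_weightPoly, ← leadingCoeff_weightPoly, h]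
  exact ⟨natDegree_X_pow_sub_C, leadingCoeff_X_pow_sub_C (by norm_num)⟩

theorem pointIdeal_le_one (P : E.Point) :
    (pointIdeal E P : FractionalIdeal E.CoordinateRing⁰ E.FunctionField) ≤ 1 := by
  cases P with
  | zero => exact le_rfl
  | some x y h =>
    rw [pointIdeal, CoordinateRing.XYIdeal'_eq]
    exact FractionalIdeal.coeIdeal_le_one

theorem pointIdeal_pow_le_one (P : E.Point) (k : ℕ) :
    ((pointIdeal E P ^ k : (FractionalIdeal E.CoordinateRing⁰ E.FunctionField)ˣ) :
      FractionalIdeal E.CoordinateRing⁰ E.FunctionField) ≤ 1 := by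
  rw [Units.val_pow_eq_pow_val]
  exact pow_le_one' (pointIdeal_le_one E P) k

/-- A function with at most a simple pole, at the affine point `P`, that vanishes at `∞` is zero. -/
theorem eq_zero_of_mem_inv_pointIdeal {P : E.Point} (hP : P ≠ 0) {h : E.FunctionField}
    (hh : h ∈ (((pointIdeal E P)⁻¹ : (FractionalIdeal E.CoordinateRing⁰ E.FunctionField)ˣ) :
      FractionalIdeal E.CoordinateRing⁰ E.FunctionField))
    (hord : h = 0 ∨ 0 < ordInfty E h) : h = 0 := by
  cases P with
  | zero => exact absurd rfl hP
  | some x y hxy =>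
    by_contra h0
    replace hord := hord.resolve_left h0
    -- The ideal of `t - x` is the product of the ideals of `P` and `-P`. So `h (t - x)` is regular,
    -- vanishes at `-P`, and has degree at most `1`; it is a constant in a proper ideal.
    have hmem : h * algebraMap _ _ (CoordinateRing.XClass E x) ∈
        (CoordinateRing.XYIdeal E x (C (E.negY x y)) :
          FractionalIdeal E.CoordinateRing⁰ E.FunctionField) := by
      have h1 : (CoordinateRing.XYIdeal E x (C (E.negY x y)) :
          FractionalIdeal E.CoordinateRing⁰ E.FunctionField) =
          ((pointIdeal E (.some x y hxy))⁻¹ : (FractionalIdeal E.CoordinateRing⁰ E.FunctionField)ˣ)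
          * (CoordinateRing.XIdeal E x : FractionalIdeal E.CoordinateRing⁰ E.FunctionField) := by
        rw [← CoordinateRing.XYIdeal_neg_mul hxy, mul_comm (CoordinateRing.XYIdeal E x _),
          FractionalIdeal.coeIdeal_mul, ← CoordinateRing.XYIdeal'_eq hxy, pointIdeal,
          ← mul_assoc, Units.inv_mul, one_mul]
      rw [h1]
      exact FractionalIdeal.mul_mem_mul hh
        (FractionalIdeal.mem_coeIdeal_of_mem _ (Ideal.mem_span_singleton_self _))
    obtain ⟨b, hb, hbe⟩ := (FractionalIdeal.mem_coeIdeal _).mp hmem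
    have hX0 := CoordinateRing.XClass_ne_zero (W' := E) x
    have hb0 : b ≠ 0 := num_ne_zero E h0 hX0 hbe.symm
    have hdeg : degA E b ≤ 1 := by
      have := ordInfty_eq E h0 hX0 hbe.symm
      rw [(degA_sgnA_XClass E x).1] at this
      omega
    obtain ⟨c, rfl⟩ := eq_const_of_degA_le_one E hdeg
    have hc : c ≠ 0 := fun hc => hb0 (by rw [hc, map_zero])
    exact XYIdeal_ne_top E ((WeierstrassCurve.Affine.nonsingular_neg ..).mpr hxy)
      (Ideal.eq_top_of_isUnit_mem _ hb ((IsUnit.mk0 c hc).map _))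

/-- If `(g) = N · P` for a point `P ≠ ∞`, then `0` is the only `h` in `N` that vanishes at `∞` to
higher order than `g`. -/
theorem eq_zero_of_ordInfty_lt {P : E.Point} (hP : P ≠ 0) {g h : E.FunctionField} (hg : g ≠ 0)
    {N : (FractionalIdeal E.CoordinateRing⁰ E.FunctionField)ˣ}
    (hgN : FractionalIdeal.spanSingleton E.CoordinateRing⁰ g = (N * pointIdeal E P :
      (FractionalIdeal E.CoordinateRing⁰ E.FunctionField)ˣ))
    (hh : h ∈ (N : FractionalIdeal E.CoordinateRing⁰ E.FunctionField))
    (hord : h = 0 ∨ ordInfty E g < ordInfty E h) : h = 0 := by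
  -- Dividing by `g` reduces to a quotient that has at most a simple pole at `P` and vanishes at
  -- `∞`.
  have hN : (N : FractionalIdeal E.CoordinateRing⁰ E.FunctionField) =
      FractionalIdeal.spanSingleton E.CoordinateRing⁰ g *
        ((pointIdeal E P)⁻¹ : (FractionalIdeal E.CoordinateRing⁰ E.FunctionField)ˣ) := by
    rw [hgN, ← Units.val_mul, mul_inv_cancel_right]
  rw [hN, FractionalIdeal.mem_singleton_mul] at hh
  obtain ⟨k, hk, rfl⟩ := hh
  rcases eq_or_ne k 0 with rfl | hk0
  · rw [mul_zero]
  have := hord.resolve_left (mul_ne_zero hg hk0)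
  rw [ordInfty_mul E hg hk0] at this
  exact absurd (eq_zero_of_mem_inv_pointIdeal E hP hk (Or.inr (by omega))) hk0

theorem const_smul_mem {I : FractionalIdeal E.CoordinateRing⁰ E.FunctionField} (c : L)
    {h : E.FunctionField} (hh : h ∈ I) : c • h ∈ I :=
  Submodule.smul_of_tower_mem (I : Submodule E.CoordinateRing E.FunctionField) c hh

theorem sub_mem_fractionalIdeal {I : FractionalIdeal E.CoordinateRing⁰ E.FunctionField}
    {h k : E.FunctionField} (hh : h ∈ I) (hk : k ∈ I) : h - k ∈ I :=
  Submodule.sub_mem (I : Submodule E.CoordinateRing E.FunctionField) hh hk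

end Ideals

/-! ### Frobenius twist of fractional ideals. -/

section TwistIdeals

variable {F : Type*} [Field F] [Fintype F] {L : Type*} [Field L] [Algebra F L]
  (W : WeierstrassCurve F)

/-- Twisting of fractional ideals. -/
noncomputable def twistIdeal : FractionalIdeal (W.baseChange L).toAffine.CoordinateRing⁰
      (W.baseChange L).toAffine.FunctionField →+*
    FractionalIdeal (W.baseChange L).toAffine.CoordinateRing⁰
      (W.baseChange L).toAffine.FunctionField :=
  FractionalIdeal.extendedHom' _
    (nonZeroDivisors_le_comap_nonZeroDivisors_of_injective _ (twistA_injective (F := F) (L := L) W))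

theorem twist_mem_twistIdeal {I : FractionalIdeal (W.baseChange L).toAffine.CoordinateRing⁰
    (W.baseChange L).toAffine.FunctionField} {h : (W.baseChange L).toAffine.FunctionField}
    (hh : h ∈ I) : twist W h ∈ twistIdeal W I :=
  (FractionalIdeal.mem_extended_iff _ _ _ _).mpr (Submodule.subset_span ⟨h, hh, rfl⟩)

theorem twistIdeal_spanSingleton (h : (W.baseChange L).toAffine.FunctionField) :
    twistIdeal W (FractionalIdeal.spanSingleton _ h) =
      FractionalIdeal.spanSingleton _ (twist W h) :=
  FractionalIdeal.extended_spanSingleton _ _ h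

theorem twistIdeal_val (u : (FractionalIdeal (W.baseChange L).toAffine.CoordinateRing⁰
    (W.baseChange L).toAffine.FunctionField)ˣ) :
    twistIdeal W (u : FractionalIdeal (W.baseChange L).toAffine.CoordinateRing⁰
      (W.baseChange L).toAffine.FunctionField) =
        (Units.map (twistIdeal (L := L) W).toMonoidHom u :) := rfl

theorem map_twistIdeal_pointIdeal [DecidableEq L] (P : (W.baseChange L).toAffine.Point) :
    Units.map (twistIdeal (L := L) W).toMonoidHom (pointIdeal _ P) = pointIdeal _ (frobPoint W P) := by
  cases P with
  | zero => exact map_one _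
  | some x y h =>
    ext1
    rw [Units.coe_map, pointIdeal, CoordinateRing.XYIdeal'_eq]
    rw [frobPoint, WeierstrassCurve.Affine.Point.map_some, pointIdeal, CoordinateRing.XYIdeal'_eq]
    refine (FractionalIdeal.extended_coeIdeal_eq_map _ _ _).trans ?_
    rw [CoordinateRing.XYIdeal, Ideal.map_span, Set.image_pair, CoordinateRing.XYIdeal,
      CoordinateRing.XClass, CoordinateRing.YClass, twistA_mk, twistA_mk]
    simp [CoordinateRing.XClass, CoordinateRing.YClass]

end TwistIdeals

end TensorDrinfeld

namespace TensorDrinfeld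

/-! ### Divisors as products of point ideals. -/

section PoleModule

variable {L : Type*} [Field L]

/-- The invertible module of functions with poles of order at most `n` at `V` and zeros of order at
least `s` at `Ξ`, and no condition at `∞`. -/
noncomputable def poleModule {E : WeierstrassCurve.Affine L} (V Ξ : E.Point) (n s : ℕ) :
    (FractionalIdeal E.CoordinateRing⁰ E.FunctionField)ˣ :=
  pointIdeal E V ^ (-(n : ℤ)) * pointIdeal E Ξ ^ s

theorem poleModule_anti {E : WeierstrassCurve.Affine L} (V Ξ : E.Point) (n : ℕ) {s s' : ℕ}
    (h : s ≤ s') : (poleModule V Ξ n s' : FractionalIdeal E.CoordinateRing⁰ E.FunctionField) ≤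
      poleModule V Ξ n s := by
  obtain ⟨k, rfl⟩ := Nat.exists_eq_add_of_le h
  have : poleModule V Ξ n (s + k) = poleModule V Ξ n s * pointIdeal E Ξ ^ k := by
    rw [poleModule, poleModule, pow_add, mul_assoc]
  rw [this, Units.val_mul]
  calc _ ≤ (poleModule V Ξ n s : FractionalIdeal E.CoordinateRing⁰ E.FunctionField) * 1 :=
        mul_le_mul_right (pointIdeal_pow_le_one E Ξ k) _
    _ = _ := mul_one _

theorem prod_shtuka_divisor {E : WeierstrassCurve.Affine L} (V V' Ξ : E.Point) :
    ((Finsupp.single V' 1 - Finsupp.single V 1 + Finsupp.single Ξ 1 -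
      Finsupp.single 0 1 : E.Point →₀ ℤ).prod fun P m => pointIdeal E P ^ m) =
    pointIdeal E V' * (pointIdeal E V)⁻¹ * pointIdeal E Ξ := by
  classical
  have h0 : pointIdeal E 0 = 1 := rfl
  rw [sub_eq_add_neg, sub_eq_add_neg, ← Finsupp.single_neg, ← Finsupp.single_neg]
  rw [Finsupp.prod_add_index' (fun _ => zpow_zero _) (fun _ _ _ => zpow_add _ _ _),
    Finsupp.prod_add_index' (fun _ => zpow_zero _) (fun _ _ _ => zpow_add _ _ _),
    Finsupp.prod_add_index' (fun _ => zpow_zero _) (fun _ _ _ => zpow_add _ _ _)]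
  simp only [Finsupp.prod_single_index, zpow_zero, zpow_neg, zpow_one, h0, inv_one, mul_one]

theorem prod_basis_divisor {E : WeierstrassCurve.Affine L} (V Ξ P : E.Point) (n s : ℕ) (m : ℤ) :
    ((Finsupp.single V (-(n : ℤ)) + Finsupp.single 0 m + Finsupp.single Ξ (s : ℤ) +
      Finsupp.single P 1 : E.Point →₀ ℤ).prod fun P m => pointIdeal E P ^ m) =
    poleModule V Ξ n s * pointIdeal E P := by
  classical
  have h0 : pointIdeal E 0 = 1 := rfl
  rw [Finsupp.prod_add_index' (fun _ => zpow_zero _) (fun _ _ _ => zpow_add _ _ _),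
    Finsupp.prod_add_index' (fun _ => zpow_zero _) (fun _ _ _ => zpow_add _ _ _),
    Finsupp.prod_add_index' (fun _ => zpow_zero _) (fun _ _ _ => zpow_add _ _ _)]
  simp only [Finsupp.prod_single_index, zpow_zero, zpow_one, zpow_natCast, h0, one_zpow, mul_one,
    poleModule]

variable (E : WeierstrassCurve.Affine L)

theorem tFun_sub_const (x : L) (h : E.FunctionField) :
    algebraMap _ _ (CoordinateRing.XClass E x) * h =
      tFun E * h - x • h := by
  rw [CoordinateRing.XClass, tFun, C_sub, map_sub, map_sub, sub_mul, Algebra.smul_def,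
    IsScalarTower.algebraMap_apply L E.CoordinateRing]
  rfl

theorem yFun_sub_const (x : L) (h : E.FunctionField) :
    algebraMap _ _ (CoordinateRing.YClass E (C x)) * h =
      yFun E * h - x • h := by
  rw [CoordinateRing.YClass, yFun, map_sub, map_sub, sub_mul, Algebra.smul_def,
    IsScalarTower.algebraMap_apply L E.CoordinateRing]
  rfl

end PoleModule

section GExt

variable {F : Type*} [Field F] [Fintype F] {L : Type*} [Field L] [Algebra F L]
  {W : WeierstrassCurve F} {f : (W.baseChange L).toAffine.FunctionField} {n : ℕ} [NeZero n]
  {g : Fin n → (W.baseChange L).toAffine.FunctionField}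

theorem gExt_of_lt {m : ℕ} (hm : m < n) : gExt W f g m = g ⟨m, hm⟩ := by
  rw [gExt, Nat.div_eq_of_lt hm]
  simp only [Function.iterate_zero, id]
  congr 1
  ext
  exact Nat.mod_eq_of_lt hm

theorem gExt_add (m : ℕ) :
    gExt W f g (m + n) = f ^ n * twist W (gExt W f g m) := by
  rw [gExt, Nat.add_div_right _ (NeZero.pos n), Function.iterate_succ_apply', gExt]
  congr 4
  ext
  exact Nat.add_mod_right m n

end GExt

/-! ### The functions `g_m` as a basis of the motive. -/

section MotiveBasis

variable {F : Type*} [Field F] [Fintype F] {L : Type*} [Field L] [DecidableEq L] [Algebra F L]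

/-- A shtuka function `f` and functions `g_1, …, g_n` none of whose last zeros
`j V^{(1)} + (n - j) V` is the point at infinity. -/
structure IsMotiveData (W : WeierstrassCurve F) {θ η : L}
    (hΞ : (W.baseChange L).toAffine.Nonsingular θ η) (V : (W.baseChange L).toAffine.Point)
    (f : (W.baseChange L).toAffine.FunctionField) {n : ℕ}
    (g : Fin n → (W.baseChange L).toAffine.FunctionField) : Prop where
  ne_zero : V ≠ 0
  shtuka : IsShtuka W V (Point.some θ η hΞ) f
  basis : IsMotiveBasis W V (Point.some θ η hΞ) n g
  last_ne_zero : ∀ j < n, j • frobPoint W V + (n - j) • V ≠ 0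

variable {W : WeierstrassCurve F} {θ η : L} {hΞ : (W.baseChange L).toAffine.Nonsingular θ η}
  {V : (W.baseChange L).toAffine.Point} {f : (W.baseChange L).toAffine.FunctionField}
  {n : ℕ} {g : Fin n → (W.baseChange L).toAffine.FunctionField}

theorem frobPoint_ne_zero {P : (W.baseChange L).toAffine.Point} (hP : P ≠ 0) :
    frobPoint W P ≠ 0 := fun h =>
  hP (WeierstrassCurve.Affine.Point.map_injective (W' := W) (f := FiniteField.frobeniusAlgHom F L)
    (h.trans (map_zero _).symm))

namespace IsMotiveData

theorem f_ne_zero (D : IsMotiveData W hΞ V f g) : f ≠ 0 := D.shtuka.1.1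

theorem span_f (D : IsMotiveData W hΞ V f g) :
    FractionalIdeal.spanSingleton (W.baseChange L).toAffine.CoordinateRing⁰ f =
      (pointIdeal _ (frobPoint W V) * (pointIdeal _ V)⁻¹ * pointIdeal _ (Point.some θ η hΞ) :
        (FractionalIdeal (W.baseChange L).toAffine.CoordinateRing⁰
          (W.baseChange L).toAffine.FunctionField)ˣ) := by
  rw [D.shtuka.1.2.1, prod_shtuka_divisor]

theorem ordInfty_f (D : IsMotiveData W hΞ V f g) : ordInfty _ f = -1 := by
  rw [D.shtuka.1.2.2]
  simp [D.ne_zero, frobPoint_ne_zero D.ne_zero]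

theorem sgn_f (D : IsMotiveData W hΞ V f g) : sgn _ f = 1 := D.shtuka.2

theorem span_g (D : IsMotiveData W hΞ V f g) (j : Fin n) :
    FractionalIdeal.spanSingleton (W.baseChange L).toAffine.CoordinateRing⁰ (g j) =
      (poleModule V (Point.some θ η hΞ) n j *
        pointIdeal _ ((j : ℕ) • frobPoint W V + (n - (j : ℕ)) • V) :
        (FractionalIdeal (W.baseChange L).toAffine.CoordinateRing⁰
          (W.baseChange L).toAffine.FunctionField)ˣ) := by
  rw [(D.basis j).1.2.1, prod_basis_divisor]

theorem ordInfty_g (D : IsMotiveData W hΞ V f g) (j : Fin n) :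
    ordInfty _ (g j) = (n : ℤ) - 1 - j := by
  rw [(D.basis j).1.2.2]
  simp [D.ne_zero, D.last_ne_zero j j.2]

theorem g_mem (D : IsMotiveData W hΞ V f g) (j : Fin n) :
    g j ∈ (poleModule V (Point.some θ η hΞ) n j :
      FractionalIdeal (W.baseChange L).toAffine.CoordinateRing⁰
        (W.baseChange L).toAffine.FunctionField) := by
  have h := FractionalIdeal.mem_spanSingleton_self
    (W.baseChange L).toAffine.CoordinateRing⁰ (g j)
  rw [D.span_g, Units.val_mul] at h
  exact (mul_le_mul_right (pointIdeal_le_one _ _) _).trans_eq (mul_one _) h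

theorem mul_mem_poleModule (D : IsMotiveData W hΞ V f g) (i : Fin n)
    {a : (W.baseChange L).toAffine.CoordinateRing}
    (ha : a ∈ CoordinateRing.XYIdeal (W.baseChange L).toAffine θ (C η)) :
    algebraMap _ _ a * g i ∈ (poleModule V (Point.some θ η hΞ) n (i + 1) :
      FractionalIdeal (W.baseChange L).toAffine.CoordinateRing⁰
        (W.baseChange L).toAffine.FunctionField) := by
  have : poleModule V (Point.some θ η hΞ) n (i + 1) =
      pointIdeal _ (Point.some θ η hΞ) * poleModule V (Point.some θ η hΞ) n i := by
    rw [poleModule, poleModule, pow_succ', mul_left_comm]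
  rw [this, Units.val_mul]
  exact FractionalIdeal.mul_mem_mul (FractionalIdeal.mem_coeIdeal_of_mem _ ha) (D.g_mem i)

/-- Twisting moves the pole from `V` to `V^{(1)}`. The factor `f ^ n` has zeros of order `n` at
`V^{(1)}`, which cancel it, a pole of order `n` at `V`, and `n` zeros at `Ξ`. -/
theorem tau_mem (D : IsMotiveData W hΞ V f g) {h : (W.baseChange L).toAffine.FunctionField}
    (hh : h ∈ (poleModule V (Point.some θ η hΞ) n 0 :
      FractionalIdeal (W.baseChange L).toAffine.CoordinateRing⁰
        (W.baseChange L).toAffine.FunctionField)) :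
    f ^ n * twist W h ∈ (poleModule V (Point.some θ η hΞ) n n :
      FractionalIdeal (W.baseChange L).toAffine.CoordinateRing⁰
        (W.baseChange L).toAffine.FunctionField) := by
  have h1 : (poleModule V (Point.some θ η hΞ) n n :
      FractionalIdeal (W.baseChange L).toAffine.CoordinateRing⁰
        (W.baseChange L).toAffine.FunctionField) =
      FractionalIdeal.spanSingleton _ (f ^ n) *
        twistIdeal W ((poleModule V (Point.some θ η hΞ) n 0 :
          (FractionalIdeal (W.baseChange L).toAffine.CoordinateRing⁰
            (W.baseChange L).toAffine.FunctionField)ˣ) :) := by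
    rw [twistIdeal_val, ← FractionalIdeal.spanSingleton_pow, D.span_f, ← Units.val_pow_eq_pow_val,
      ← Units.val_mul, poleModule, poleModule, pow_zero, mul_one, map_zpow,
      map_twistIdeal_pointIdeal, mul_pow, mul_pow, zpow_neg, zpow_neg, zpow_natCast, zpow_natCast]
    congr 1
    rw [inv_pow, mul_right_comm, mul_right_comm (_ ^ n), mul_inv_cancel, one_mul]
  rw [h1]
  exact FractionalIdeal.mul_mem_mul (FractionalIdeal.mem_spanSingleton_self _ _)
    (twist_mem_twistIdeal W hh)

variable [NeZero n]

/-- The function `f` has a simple pole at `∞`, so each application of `τ` lowers the order by `n`,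
in step with the index. At `Ξ` only the first `n` zeros are recorded: `τ` produces that many, and
more are never used. -/
theorem gExt_props (D : IsMotiveData W hΞ V f g) (m : ℕ) :
    gExt W f g m ≠ 0 ∧ ordInfty _ (gExt W f g m) = (n : ℤ) - 1 - m ∧ sgn _ (gExt W f g m) = 1 ∧
    gExt W f g m ∈ (poleModule V (Point.some θ η hΞ) n (min m n) :
      FractionalIdeal (W.baseChange L).toAffine.CoordinateRing⁰
        (W.baseChange L).toAffine.FunctionField) := by
  induction m using Nat.strong_induction_on with
  | _ m ih =>
    rcases lt_or_ge m n with hm | hm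
    · rw [gExt_of_lt hm, min_eq_left hm.le]
      exact ⟨(D.basis _).1.1, D.ordInfty_g _, (D.basis _).2, D.g_mem ⟨m, hm⟩⟩
    · obtain ⟨k, rfl⟩ := Nat.exists_eq_add_of_le' hm
      obtain ⟨h1, h2, h3, h4⟩ := ih k (by have := NeZero.pos n; omega)
      have ht := twist_ne_zero W h1
      have hfn := pow_ne_zero n D.f_ne_zero
      rw [gExt_add, min_eq_right hm]
      refine ⟨mul_ne_zero hfn ht, ?_, ?_, D.tau_mem (poleModule_anti _ _ _ (Nat.zero_le _) h4)⟩
      · rw [ordInfty_mul _ hfn ht, ordInfty_pow _ D.f_ne_zero, D.ordInfty_f, ordInfty_twist W h1,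
          h2]
        push_cast; ring
      · rw [sgn_mul _ hfn ht, sgn_pow _ D.f_ne_zero, D.sgn_f, sgn_twist W h1, h3]
        simp

theorem gExt_ne_zero (D : IsMotiveData W hΞ V f g) (m : ℕ) : gExt W f g m ≠ 0 :=
  (D.gExt_props m).1

theorem gExt_mem (D : IsMotiveData W hΞ V f g) {s m : ℕ} (hsm : s ≤ m) (hsn : s ≤ n) :
    gExt W f g m ∈ (poleModule V (Point.some θ η hΞ) n s :
      FractionalIdeal (W.baseChange L).toAffine.CoordinateRing⁰
        (W.baseChange L).toAffine.FunctionField) :=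
  poleModule_anti _ _ _ (le_min hsm hsn) (D.gExt_props m).2.2.2

/-- The case `s = n` is needed for `(t - θ) g_i` with the last index `i`. There the function is `τ`
of the first `g`, and its remaining zero is the Frobenius image of `nV`. -/
theorem exists_span_gExt (D : IsMotiveData W hΞ V f g) {s : ℕ} (hs : s ≤ n) :
    ∃ P : (W.baseChange L).toAffine.Point, P ≠ 0 ∧
      FractionalIdeal.spanSingleton (W.baseChange L).toAffine.CoordinateRing⁰ (gExt W f g s) =
        (poleModule V (Point.some θ η hΞ) n s * pointIdeal _ P :
          (FractionalIdeal (W.baseChange L).toAffine.CoordinateRing⁰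
            (W.baseChange L).toAffine.FunctionField)ˣ) := by
  rcases hs.lt_or_eq with hs | rfl
  · exact ⟨_, D.last_ne_zero s hs, by rw [gExt_of_lt hs, D.span_g]⟩
  · have hpos := NeZero.pos s
    refine ⟨frobPoint W (s • V), frobPoint_ne_zero ?_, ?_⟩
    · have := D.last_ne_zero 0 hpos
      rwa [zero_smul, zero_add, Nat.sub_zero] at this
    · have h := gExt_add (W := W) (f := f) (g := g) 0
      rw [zero_add] at h
      rw [h, gExt_of_lt hpos, ← FractionalIdeal.spanSingleton_mul_spanSingleton,
        ← FractionalIdeal.spanSingleton_pow, D.span_f, ← twistIdeal_spanSingleton, D.span_g]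
      simp only [zero_smul, zero_add, Nat.sub_zero]
      rw [twistIdeal_val, ← Units.val_pow_eq_pow_val, ← Units.val_mul, poleModule, poleModule, pow_zero,
        mul_one, map_mul, map_zpow, map_twistIdeal_pointIdeal, map_twistIdeal_pointIdeal, mul_pow,
        mul_pow, zpow_neg, zpow_neg, zpow_natCast, zpow_natCast]
      congr 1
      rw [inv_pow, ← mul_assoc]
      congr 1
      rw [mul_right_comm, mul_right_comm (_ ^ s), mul_inv_cancel, one_mul]

/-- Functions in the pole module are combinations of the `g_m`. -/
theorem exists_eq_sum_gExt (D : IsMotiveData W hΞ V f g) {s : ℕ} (hs : s ≤ n) (r : ℕ)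
    {h : (W.baseChange L).toAffine.FunctionField}
    (hh : h ∈ (poleModule V (Point.some θ η hΞ) n s :
      FractionalIdeal (W.baseChange L).toAffine.CoordinateRing⁰
        (W.baseChange L).toAffine.FunctionField))
    (hord : h = 0 ∨ (n : ℤ) - s - r ≤ ordInfty _ h) :
    ∃ c : ℕ → L, h = ∑ l ∈ Finset.range r, c l • gExt W f g (s + l) := by
  induction r generalizing h with
  | zero =>
    obtain ⟨P, hP, hspan⟩ := D.exists_span_gExt hs
    refine ⟨0, ?_⟩
    rw [Finset.range_zero, Finset.sum_empty]
    refine eq_zero_of_ordInfty_lt _ hP (D.gExt_ne_zero s) hspan hh (hord.imp_right fun ho => ?_)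
    rw [(D.gExt_props s).2.1]
    push_cast at ho; omega
  | succ r ih =>
    -- The lowest order allowed is exactly that of `g_{s+r}`; removing a multiple of it leaves a
    -- function covered by the induction hypothesis.
    have ho := (D.gExt_props (s + r)).2.1
    obtain ⟨c, hc, -⟩ := exists_ordInfty_sub_smul _ (D.gExt_ne_zero (s + r)) (h := h)
      (hord.imp_right fun h => by rw [ho]; push_cast at h ⊢; omega)
    obtain ⟨c', hc'⟩ := ih (h := h - c • gExt W f g (s + r))
      (sub_mem_fractionalIdeal _ hh (const_smul_mem _ c (D.gExt_mem (Nat.le_add_right s r) hs)))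
      (hc.imp_right fun h => by rw [ho] at h; push_cast at h ⊢; omega)
    refine ⟨Function.update c' r c, ?_⟩
    rw [Finset.sum_range_succ, Function.update_self, Finset.sum_congr rfl (g := fun l =>
      c' l • gExt W f g (s + l)), ← hc', sub_add_cancel]
    intro l hl
    rw [Function.update_of_ne (Finset.mem_range.mp hl).ne]

/-- As `exists_eq_sum_gExt`, for a function of sign `1` and known order. -/
theorem exists_eq_gExt_add_sum (D : IsMotiveData W hΞ V f g) {s : ℕ} (hs : s ≤ n) (r : ℕ)
    {h : (W.baseChange L).toAffine.FunctionField}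
    (hh : h ∈ (poleModule V (Point.some θ η hΞ) n s :
      FractionalIdeal (W.baseChange L).toAffine.CoordinateRing⁰
        (W.baseChange L).toAffine.FunctionField))
    (h0 : h ≠ 0) (hord : ordInfty _ h = (n : ℤ) - 1 - s - r) (hsgn : sgn _ h = 1) :
    ∃ c : ℕ → L, h = ∑ l ∈ Finset.range r, c l • gExt W f g (s + l) + gExt W f g (s + r) := by
  obtain ⟨-, ho, hs1, -⟩ := D.gExt_props (s + r)
  obtain ⟨c, hc, hc1⟩ := exists_ordInfty_sub_smul _ (D.gExt_ne_zero (s + r)) (h := h)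
    (Or.inr (by rw [ho, hord]; push_cast; omega))
  have hc1 : c = 1 := by
    rw [hc1 h0 (by rw [ho, hord]; push_cast; omega), hsgn, hs1, div_one]
  rw [hc1, one_smul] at hc
  obtain ⟨c', hc'⟩ := D.exists_eq_sum_gExt hs r (h := h - gExt W f g (s + r))
    (sub_mem_fractionalIdeal _ hh (D.gExt_mem (Nat.le_add_right s r) hs))
    (hc.imp_right fun h => by rw [ho] at h; push_cast at h ⊢; omega)
  exact ⟨c', by rw [← hc', sub_add_cancel]⟩

/-- `t g_i = θ g_i + a_i g_{i+1} + g_{i+2}`. -/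
theorem tFun_mul (D : IsMotiveData W hΞ V f g) (i : Fin n) :
    tFun (W.baseChange L).toAffine * g i = θ • g i +
      aConst W f g θ i • gExt W f g ((i : ℕ) + 1) + gExt W f g ((i : ℕ) + 2) := by
  refine Classical.epsilon_spec (p := fun a : L => tFun (W.baseChange L).toAffine * g i =
    θ • g i + a • gExt W f g ((i : ℕ) + 1) + gExt W f g ((i : ℕ) + 2)) ?_
  have hg0 : g i ≠ 0 := (D.basis i).1.1
  have hx0 := CoordinateRing.XClass_ne_zero (W' := (W.baseChange L).toAffine) θ
  have hx : algebraMap _ (W.baseChange L).toAffine.FunctionField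
      (CoordinateRing.XClass (W.baseChange L).toAffine θ) ≠ 0 :=
    (map_ne_zero_iff _ (IsFractionRing.injective _ _)).mpr hx0
  -- Since `t - θ` vanishes at `Ξ` and has a double pole at `∞` with sign `1`, the product has one
  -- more zero at `Ξ` than `g_i` and the order and sign of `g_{i+2}`. Only `g_{i+1}` can occur
  -- besides it.
  obtain ⟨c, hc⟩ := D.exists_eq_gExt_add_sum (s := i + 1) i.2 1
    (D.mul_mem_poleModule i (Ideal.subset_span (Set.mem_insert _ _)))
    (mul_ne_zero hx hg0)
    (by rw [ordInfty_mul _ hx hg0, D.ordInfty_g, ordInfty_algebraMap _ hx0,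
          (degA_sgnA_XClass _ θ).1]; push_cast; ring)
    (by rw [sgn_mul _ hx hg0, (D.basis i).2, sgn_algebraMap _ hx0, (degA_sgnA_XClass _ θ).2,
          one_mul])
  rw [tFun_sub_const, sub_eq_iff_eq_add', Finset.sum_range_one] at hc
  exact ⟨c 0, by rw [hc, ← add_assoc]⟩

/-- `y g_i = η g_i + y_i g_{i+1} + z_i g_{i+2} + g_{i+3}`. -/
theorem yFun_mul (D : IsMotiveData W hΞ V f g) (i : Fin n) :
    yFun (W.baseChange L).toAffine * g i = η • g i +
      (yzConst W f g η i).1 • gExt W f g ((i : ℕ) + 1) +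
      (yzConst W f g η i).2 • gExt W f g ((i : ℕ) + 2) + gExt W f g ((i : ℕ) + 3) := by
  refine Classical.epsilon_spec (p := fun b : L × L => yFun (W.baseChange L).toAffine * g i =
    η • g i + b.1 • gExt W f g ((i : ℕ) + 1) + b.2 • gExt W f g ((i : ℕ) + 2) +
      gExt W f g ((i : ℕ) + 3)) ?_
  have hg0 : g i ≠ 0 := (D.basis i).1.1
  have hx0 := CoordinateRing.YClass_ne_zero (W' := (W.baseChange L).toAffine) (C η)
  have hx : algebraMap _ (W.baseChange L).toAffine.FunctionField
      (CoordinateRing.YClass (W.baseChange L).toAffine (C η)) ≠ 0 :=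
    (map_ne_zero_iff _ (IsFractionRing.injective _ _)).mpr hx0
  obtain ⟨c, hc⟩ := D.exists_eq_gExt_add_sum (s := i + 1) i.2 2
    (D.mul_mem_poleModule i (Ideal.subset_span (Set.mem_insert_of_mem _ rfl)))
    (mul_ne_zero hx hg0)
    (by rw [ordInfty_mul _ hx hg0, D.ordInfty_g, ordInfty_algebraMap _ hx0,
          (degA_sgnA_YClass _ η).1]; push_cast; ring)
    (by rw [sgn_mul _ hx hg0, (D.basis i).2, sgn_algebraMap _ hx0, (degA_sgnA_YClass _ η).2,
          one_mul])
  rw [yFun_sub_const, sub_eq_iff_eq_add', Finset.sum_range_succ, Finset.sum_range_one] at hc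
  exact ⟨(c 0, c 1), by rw [hc, ← add_assoc, ← add_assoc]⟩

/-- The `g_m` are linearly independent. -/
theorem eq_zero_of_sum_gExt (D : IsMotiveData W hΞ V f g) (c : ℕ → L) (N : ℕ) :
    (∑ m ∈ Finset.range N, c m • gExt W f g m = 0 ∨
      (n : ℤ) - N ≤ ordInfty _ (∑ m ∈ Finset.range N, c m • gExt W f g m)) ∧
    (∑ m ∈ Finset.range N, c m • gExt W f g m = 0 → ∀ m < N, c m = 0) := by
  induction N with
  | zero => simp
  | succ N ih =>
    obtain ⟨ih1, ih2⟩ := ih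
    rw [Finset.sum_range_succ, add_comm]
    by_cases hc : c N = 0
    · rw [hc, zero_smul, zero_add]
      refine ⟨ih1.imp_right fun h => by push_cast; omega, fun h m hm => ?_⟩
      rcases (Nat.lt_succ_iff.mp hm).lt_or_eq with h' | rfl
      · exact ih2 h m h'
      · exact hc
    -- A nonzero last term has strictly smaller order than all the others, so it determines the
    -- order of the sum, which cannot vanish.
    · obtain ⟨h0, ho, -⟩ := D.gExt_props N
      have hlt := ordInfty_sgn_add_of_lt _ (smul_ne_zero hc h0) (ih1.imp_right fun h => by
        rw [ordInfty_const_smul _ hc h0, ho]; omega)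
      rw [ordInfty_const_smul _ hc h0, ho] at hlt
      exact ⟨Or.inr (by rw [hlt.2.1]; push_cast; omega), fun h => absurd h hlt.1⟩

end IsMotiveData

end MotiveBasis

end TensorDrinfeld

namespace TensorDrinfeld

/-! ### Specialization of the generic point. -/

section GenericPoint

variable {F : Type*} [Field F] {k : Type*} [Field k] [Algebra F k] {Ω : Type*} [Field Ω]
  [Algebra F Ω] [Algebra k Ω] [IsScalarTower F k Ω] (W : WeierstrassCurve F)

/-- A point with transcendental `x` is generic. Evaluation there is injective on the coordinate
ring, because the norm of a nonzero element is a nonzero polynomial in `t`, which cannot vanish at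
`x`; hence it extends to fractions. -/
theorem exists_functionField_algHom {x y : Ω} (hxy : (W.baseChange Ω).toAffine.Equation x y)
    (hx : Transcendental k x) :
    ∃ φ : (W.baseChange k).toAffine.FunctionField →ₐ[k] Ω, φ (tFun _) = x ∧ φ (yFun _) = y := by
  have h0 : (W.baseChange k).toAffine.polynomial.eval₂ ((aeval x : k[X] →ₐ[k] Ω) : k[X] →+* Ω) y
      = 0 := by
    rw [WeierstrassCurve.Affine.equation_iff'] at hxy
    rw [WeierstrassCurve.Affine.polynomial]
    simp [← IsScalarTower.algebraMap_apply, eval₂_pow] at hxy ⊢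
    linear_combination hxy
  let ψ : (W.baseChange k).toAffine.CoordinateRing →ₐ[k] Ω :=
    AdjoinRoot.liftAlgHom _ (aeval x : k[X] →ₐ[k] Ω) y h0
  have hψ : ∀ p : k[X], ψ (CoordinateRing.mk _ (C p)) = aeval x p := fun p =>
    (AdjoinRoot.liftAlgHom_of _ _ _ _ p)
  have hinj : Function.Injective ψ := by
    refine (injective_iff_map_eq_zero ψ).mpr fun a ha => ?_
    by_contra ha0
    obtain ⟨p, r, rfl⟩ := CoordinateRing.exists_smul_basis_eq a
    have hN := CoordinateRing.coe_norm_smul_basis (W' := (W.baseChange k).toAffine) p r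
    have hN0 : Algebra.norm k[X] (p • (1 : (W.baseChange k).toAffine.CoordinateRing) +
        r • CoordinateRing.mk _ X) ≠ 0 := by
      have := Module.Finite.of_basis (CoordinateRing.basis (W.baseChange k).toAffine)
      rwa [Ne, Algebra.norm_eq_zero_iff]
    refine (transcendental_iff.mp hx _).mt hN0 ?_
    rw [← hψ]
    refine (congr_arg ψ hN).trans ?_
    have hpr : CoordinateRing.mk (W.baseChange k).toAffine (C p + C r * X) =
        p • (1 : (W.baseChange k).toAffine.CoordinateRing) + r • CoordinateRing.mk _ X := by
      rw [CoordinateRing.smul, CoordinateRing.smul, mul_one, map_add, map_mul]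
    rw [map_mul, map_mul, hpr, ha, zero_mul]
  have hΦ : ∀ a, (IsFractionRing.liftAlgHom (g := ψ) hinj :
      (W.baseChange k).toAffine.FunctionField →ₐ[k] Ω)
        (algebraMap (W.baseChange k).toAffine.CoordinateRing _ a) = ψ a :=
    fun a => IsLocalization.lift_eq (M := (W.baseChange k).toAffine.CoordinateRing⁰)
      (S := (W.baseChange k).toAffine.FunctionField) _ a
  exact ⟨IsFractionRing.liftAlgHom (g := ψ) hinj, (hΦ _).trans ((hψ X).trans (aeval_X x)),
    (hΦ _).trans (AdjoinRoot.liftAlgHom_root _ _ _ _)⟩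

theorem equation_tFun_yFun : (W.baseChange (W.baseChange k).toAffine.FunctionField).toAffine.Equation
    (tFun _) (yFun _) := by
  rw [WeierstrassCurve.Affine.equation_iff', tFun, yFun]
  have h : CoordinateRing.mk (W.baseChange k).toAffine (W.baseChange k).toAffine.polynomial = 0 :=
    AdjoinRoot.mk_self
  have h2 := congr_arg (algebraMap _ (W.baseChange k).toAffine.FunctionField) h
  have hc : ∀ c : F, algebraMap F (W.baseChange k).toAffine.FunctionField c =
      algebraMap _ _ (CoordinateRing.mk (W.baseChange k).toAffine (C (C (algebraMap F k c)))) := by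
    intro c
    rw [IsScalarTower.algebraMap_apply F (W.baseChange k).toAffine.CoordinateRing,
      IsScalarTower.algebraMap_apply F k (W.baseChange k).toAffine.CoordinateRing]
    rfl
  change _ + algebraMap F _ W.a₁ * _ * _ + algebraMap F _ W.a₃ * _ - (_ + algebraMap F _ W.a₂ * _ +
    algebraMap F _ W.a₄ * _ + algebraMap F _ W.a₆) = 0
  simp only [hc]
  have hp : (W.baseChange k).toAffine.polynomial = X ^ 2 + C (C (algebraMap F k W.a₁) * X +
      C (algebraMap F k W.a₃)) * X - C (X ^ 3 + C (algebraMap F k W.a₂) * X ^ 2 +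
      C (algebraMap F k W.a₄) * X + C (algebraMap F k W.a₆)) := rfl
  rw [map_zero] at h2
  rw [← h2, congr_arg (CoordinateRing.mk (W.baseChange k).toAffine) hp]
  simp only [map_add, map_sub, map_mul, map_pow]
  ring

variable [W.IsElliptic] [DecidableEq k] [DecidableEq Ω]

/-- All points of `E(Ω)` with transcendental coordinates satisfy the same equations
`m P = T` with `T` in `E(k)`. -/
theorem nsmul_eq_of_transcendental {x y x' y' : Ω} (h : (W.baseChange Ω).toAffine.Nonsingular x y)
    (h' : (W.baseChange Ω).toAffine.Nonsingular x' y') (hx : Transcendental k x)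
    (hx' : Transcendental k x') {m : ℕ} {T : (W.baseChange k).toAffine.Point}
    (hm : m • Point.some x y h = Point.baseChange (W' := W) k Ω T) :
    m • Point.some x' y' h' = Point.baseChange (W' := W) k Ω T := by
  classical
  have : (W.baseChange (W.baseChange k).toAffine.FunctionField).IsElliptic :=
    inferInstanceAs (W.map _).IsElliptic
  obtain ⟨φ, hφx, hφy⟩ := exists_functionField_algHom W h.left hx
  obtain ⟨φ', hφx', hφy'⟩ := exists_functionField_algHom W h'.left hx'
  set gen : (W.baseChange (W.baseChange k).toAffine.FunctionField).toAffine.Point :=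
    Point.some _ _ ((WeierstrassCurve.Affine.equation_iff_nonsingular
      (W := W.baseChange (W.baseChange k).toAffine.FunctionField)).mp (equation_tFun_yFun W))
    with hgen
  have h1 : Point.map (W' := W) φ gen = Point.some x y h := by
    rw [hgen, WeierstrassCurve.Affine.Point.map_some]; simp only [hφx, hφy]
  have h2 : Point.map (W' := W) φ' gen = Point.some x' y' h' := by
    rw [hgen, WeierstrassCurve.Affine.Point.map_some]; simp only [hφx', hφy']
  -- Field embeddings are injective on points, so the relation lifts from one transcendental point
  -- to the generic point, and then specializes to any other.
  have hT : m • gen = Point.baseChange (W' := W) k _ T :=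
    WeierstrassCurve.Affine.Point.map_injective (W' := W) (f := φ) (by
      rw [map_nsmul, h1, hm, WeierstrassCurve.Affine.Point.map_baseChange])
  rw [← h2, ← map_nsmul, hT, WeierstrassCurve.Affine.Point.map_baseChange]

end GenericPoint

/-! ### Division polynomials for 2 and 3. -/

section Torsion

variable {L : Type*} [Field L] [DecidableEq L] (E : WeierstrassCurve.Affine L)

theorem two_nsmul_eq_zero_iff {x y : L} (h : E.Nonsingular x y) :
    2 • Point.some x y h = 0 ↔ 2 * y + E.a₁ * x + E.a₃ = 0 := by
  have : 2 • Point.some x y h = 0 ↔ Point.some x y h = -Point.some x y h := by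
    rw [two_nsmul, add_eq_zero_iff_eq_neg]
  rw [this, WeierstrassCurve.Affine.Point.neg_some, Point.some.injEq,
    WeierstrassCurve.Affine.negY, and_iff_right rfl, ← sub_eq_zero]
  ring_nf

/-- Let `u = 2y + a₁x + a₃` and let `m` be the numerator of the tangent slope. The polynomial is
`-u² (x(2P) - x(P))` when `u ≠ 0`, and equal `x`-coordinates mean `2P = ±P`, where `2P = P` is
impossible. When `u = 0` the point is 2-torsion, and the value `-m²` is nonzero by nonsingularity.
-/
theorem three_nsmul_eq_zero_iff {x y : L} (h : E.Nonsingular x y) :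
    3 • Point.some x y h = 0 ↔
      3 * x ^ 4 + E.b₂ * x ^ 3 + 3 * E.b₄ * x ^ 2 + 3 * E.b₆ * x + E.b₈ = 0 := by
  have heq := (WeierstrassCurve.Affine.equation_iff' ..).mp h.left
  have key : 3 * x ^ 4 + E.b₂ * x ^ 3 + 3 * E.b₄ * x ^ 2 + 3 * E.b₆ * x + E.b₈ =
      (3 * x + E.a₂) * (2 * y + E.a₁ * x + E.a₃) ^ 2 -
        (3 * x ^ 2 + 2 * E.a₂ * x + E.a₄ - E.a₁ * y) ^ 2 -
        E.a₁ * (3 * x ^ 2 + 2 * E.a₂ * x + E.a₄ - E.a₁ * y) * (2 * y + E.a₁ * x + E.a₃) := by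
    rw [WeierstrassCurve.b₂, WeierstrassCurve.b₄, WeierstrassCurve.b₆, WeierstrassCurve.b₈]
    linear_combination (-(12 * x + 4 * E.a₂ + E.a₁ ^ 2)) * heq
  have h3 : 3 • Point.some x y h = 0 ↔ Point.some x y h + Point.some x y h =
      -Point.some x y h := by
    rw [show 3 = 2 + 1 from rfl, succ_nsmul, two_nsmul, add_eq_zero_iff_eq_neg]
  rw [h3, key]
  by_cases hy : y = E.negY x y
  · have hu : 2 * y + E.a₁ * x + E.a₃ = 0 := by
      rw [WeierstrassCurve.Affine.negY] at hy
      linear_combination hy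
    rw [WeierstrassCurve.Affine.Point.add_self_of_Y_eq hy, hu]
    have hn : 3 * x ^ 2 + 2 * E.a₂ * x + E.a₄ - E.a₁ * y ≠ 0 := by
      rcases ((WeierstrassCurve.Affine.nonsingular_iff' ..).mp h).2 with h' | h'
      · exact fun h0 => h' (by linear_combination -h0)
      · exact absurd hu h'
    constructor
    · intro h0
      exact absurd (neg_eq_zero.mp h0.symm) (WeierstrassCurve.Affine.Point.some_ne_zero h)
    · intro h0
      exact absurd (pow_eq_zero_iff two_ne_zero |>.mp
        (by linear_combination -h0 : (3 * x ^ 2 + 2 * E.a₂ * x + E.a₄ - E.a₁ * y) ^ 2 = 0)) hn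
  · have hu : 2 * y + E.a₁ * x + E.a₃ ≠ 0 := fun hu => hy (by
      rw [WeierstrassCurve.Affine.negY]; linear_combination hu)
    rw [WeierstrassCurve.Affine.Point.add_self_of_Y_ne hy]
    have hX : E.addX x x (E.slope x x y y) = x ↔
        (3 * x + E.a₂) * (2 * y + E.a₁ * x + E.a₃) ^ 2 -
        (3 * x ^ 2 + 2 * E.a₂ * x + E.a₄ - E.a₁ * y) ^ 2 -
        E.a₁ * (3 * x ^ 2 + 2 * E.a₂ * x + E.a₄ - E.a₁ * y) * (2 * y + E.a₁ * x + E.a₃) = 0 := by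
      rw [WeierstrassCurve.Affine.slope_of_Y_ne rfl hy, WeierstrassCurve.Affine.addX,
        WeierstrassCurve.Affine.negY, show y - (-y - E.a₁ * x - E.a₃) =
          2 * y + E.a₁ * x + E.a₃ by ring, ← sub_eq_zero]
      rw [← mul_left_inj' (pow_ne_zero 2 hu), zero_mul, ← neg_eq_zero]
      refine Eq.congr ?_ rfl
      generalize 2 * y + E.a₁ * x + E.a₃ = u at hu ⊢
      generalize 3 * x ^ 2 + 2 * E.a₂ * x + E.a₄ - E.a₁ * y = m
      field_simp
      ring
    rw [← hX]
    constructor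
    · intro h0
      rw [WeierstrassCurve.Affine.Point.neg_some, Point.some.injEq] at h0
      exact h0.1
    · intro h0
      rcases WeierstrassCurve.Affine.Point.X_eq_iff.mp h0 with h1 | h1
      · rw [← WeierstrassCurve.Affine.Point.add_self_of_Y_ne hy (h₁ := h), add_eq_left] at h1
        exact absurd h1 (WeierstrassCurve.Affine.Point.some_ne_zero h)
      · exact h1

end Torsion

/-! ### Constant torsion, and why `V` is not a torsion point. -/

section ConstantPoints

variable {F : Type*} [Field F] {Ω : Type*} [Field Ω] [Algebra F Ω] (W : WeierstrassCurve F)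
  [DecidableEq Ω] [DecidableEq (algebraicClosure F Ω)]

/-- An affine point with algebraic `x`-coordinate comes from the algebraic closure of the base
field. -/
theorem exists_baseChange_eq_of_isAlgebraic {x y : Ω} (h : (W.baseChange Ω).toAffine.Nonsingular x y)
    (hx : IsAlgebraic F x) : ∃ T : (W.baseChange (algebraicClosure F Ω)).toAffine.Point,
      Point.baseChange (W' := W) (algebraicClosure F Ω) Ω T = Point.some x y h := by
  have hy : IsAlgebraic F y := by
    have hx' : x ∈ algebraicClosure F Ω := mem_algebraicClosure_iff.mpr hx
    set x₀ : algebraicClosure F Ω := ⟨x, hx'⟩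
    have hc : ∀ c : F, algebraMap (algebraicClosure F Ω) Ω (algebraMap F _ c) =
      algebraMap F Ω c := fun _ => rfl
    have hxe : algebraMap (algebraicClosure F Ω) Ω x₀ = x := rfl
    refine IsAlgebraic.restrictScalars F (S := algebraicClosure F Ω) ⟨X ^ 2 +
      C (algebraMap F _ W.a₁ * x₀ + algebraMap F _ W.a₃) * X - C (x₀ ^ 3 + algebraMap F _ W.a₂ *
        x₀ ^ 2 + algebraMap F _ W.a₄ * x₀ + algebraMap F _ W.a₆), fun h0 => ?_, ?_⟩
    · have hdeg : ∀ a b : algebraicClosure F Ω, (X ^ 2 + C a * X - C b).degree = 2 := fun a b => by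
        compute_degree!
      have := hdeg _ _ ▸ congr_arg degree h0
      simp at this
    · have heq := (WeierstrassCurve.Affine.equation_iff' ..).mp h.left
      change _ + algebraMap F _ W.a₁ * _ * _ + algebraMap F _ W.a₃ * _ - (_ + algebraMap F _ W.a₂ *
        _ + algebraMap F _ W.a₄ * _ + algebraMap F _ W.a₆) = 0 at heq
      rw [← heq]
      simp only [map_add, map_sub, map_mul, map_pow, aeval_X, aeval_C, hc, hxe]
      ring
  have hns : (W.baseChange (algebraicClosure F Ω)).toAffine.Nonsingular
      ⟨x, mem_algebraicClosure_iff.mpr hx⟩ ⟨y, mem_algebraicClosure_iff.mpr hy⟩ :=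
    (WeierstrassCurve.Affine.baseChange_nonsingular W
      (f := (Algebra.ofId (algebraicClosure F Ω) Ω).restrictScalars F)
      (RingHom.injective _) _ _).mp h
  exact ⟨Point.some _ _ hns, rfl⟩

variable [W.IsElliptic]

/-- For `ℓ = 2` or `ℓ = 3` different from the characteristic, the `ℓ`-torsion over an algebraically
closed field is not trivial and is defined over the algebraic closure of the base field. -/
theorem exists_prime_torsion [IsAlgClosed Ω] : ∃ l : ℕ, l.Prime ∧
    (∀ P : (W.baseChange Ω).toAffine.Point, l • P = 0 →
      ∃ T, Point.baseChange (W' := W) (algebraicClosure F Ω) Ω T = P) ∧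
    ∃ P : (W.baseChange Ω).toAffine.Point, P ≠ 0 ∧ l • P = 0 := by
  have hE : (W.baseChange Ω).IsElliptic := inferInstanceAs (W.map _).IsElliptic
  have key : ∀ (l : ℕ) (p : F[X]), p.degree ≠ 0 → p ≠ 0 →
      (∀ x y (h : (W.baseChange Ω).toAffine.Nonsingular x y),
        l • Point.some x y h = 0 ↔ aeval x p = 0) →
      (∀ P : (W.baseChange Ω).toAffine.Point, l • P = 0 →
        ∃ T, Point.baseChange (W' := W) (algebraicClosure F Ω) Ω T = P) ∧
      ∃ P : (W.baseChange Ω).toAffine.Point, P ≠ 0 ∧ l • P = 0 := by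
    intro l p hdeg hp h
    constructor
    · rintro (_ | ⟨x, y, hxy⟩) hP
      · exact ⟨0, rfl⟩
      · exact exists_baseChange_eq_of_isAlgebraic W hxy ⟨p, hp, (h x y hxy).mp hP⟩
    · obtain ⟨x, hx⟩ := IsAlgClosed.exists_aeval_eq_zero Ω p hdeg
      obtain ⟨y, hy⟩ := IsAlgClosed.exists_aeval_eq_zero Ω (X ^ 2 +
        C ((W.baseChange Ω).a₁ * x + (W.baseChange Ω).a₃) * X - C (x ^ 3 + (W.baseChange Ω).a₂ *
        x ^ 2 + (W.baseChange Ω).a₄ * x + (W.baseChange Ω).a₆)) (by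
          rw [show degree _ = 2 by compute_degree!]; norm_num)
      have heq : (W.baseChange Ω).toAffine.Equation x y := by
        rw [WeierstrassCurve.Affine.equation_iff', ← hy]
        simp only [map_add, map_sub, map_mul, map_pow, aeval_X, aeval_C, Algebra.algebraMap_self,
          RingHom.id_apply]
        ring
      have hns := (WeierstrassCurve.Affine.equation_iff_nonsingular (W := W.baseChange Ω)).mp heq
      exact ⟨Point.some x y hns, WeierstrassCurve.Affine.Point.some_ne_zero hns,
        (h x y hns).mpr hx⟩
  have hb : (W.baseChange Ω).b₂ = algebraMap F Ω W.b₂ ∧ (W.baseChange Ω).b₄ = algebraMap F Ω W.b₄ ∧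
      (W.baseChange Ω).b₆ = algebraMap F Ω W.b₆ ∧ (W.baseChange Ω).b₈ = algebraMap F Ω W.b₈ :=
    ⟨WeierstrassCurve.map_b₂ .., WeierstrassCurve.map_b₄ .., WeierstrassCurve.map_b₆ ..,
      WeierstrassCurve.map_b₈ ..⟩
  -- The division polynomials have leading coefficients `3` and `4`. The choice of `ℓ` keeps the
  -- leading coefficient nonzero, so that the polynomial has a root.
  by_cases h2 : (2 : F) = 0
  · have h3 : (3 : F) ≠ 0 := fun h3 => one_ne_zero (α := F) (by linear_combination h3 - h2)
    refine ⟨3, Nat.prime_three, ?_⟩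
    have hdeg : (C 3 * X ^ 4 + C W.b₂ * X ^ 3 + C (3 * W.b₄) * X ^ 2 + C (3 * W.b₆) * X +
      C W.b₈ : F[X]).degree = 4 := by compute_degree!
    refine key 3 _ (by rw [hdeg]; norm_num) (fun h => by rw [h] at hdeg; simp at hdeg) fun x y h => ?_
    rw [three_nsmul_eq_zero_iff]
    simp only [map_add, map_mul, map_pow, aeval_X, aeval_C, ← hb.1, ← hb.2.1, ← hb.2.2.1,
      ← hb.2.2.2, map_ofNat]
  · have h4 : (4 : F) ≠ 0 := fun h4 => h2 (pow_eq_zero_iff two_ne_zero |>.mp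
      (by linear_combination h4))
    refine ⟨2, Nat.prime_two, ?_⟩
    have hdeg : (C 4 * X ^ 3 + C W.b₂ * X ^ 2 + C (2 * W.b₄) * X + C W.b₆ : F[X]).degree = 3 := by
      compute_degree!
    refine key 2 _ (by rw [hdeg]; norm_num) (fun h => by rw [h] at hdeg; simp at hdeg) fun x y h => ?_
    have heq := (WeierstrassCurve.Affine.equation_iff' ..).mp h.left
    rw [two_nsmul_eq_zero_iff, ← pow_eq_zero_iff two_ne_zero]
    refine Eq.congr ?_ rfl
    simp only [map_add, map_mul, map_pow, aeval_X, aeval_C, ← hb.1, ← hb.2.1, ← hb.2.2.1]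
    rw [WeierstrassCurve.b₂, WeierstrassCurve.b₄, WeierstrassCurve.b₆]
    simp only [map_ofNat]
    linear_combination 4 * heq

/-- If `V - V'` and `V`, `V'` are transcendental points, then `V` is not a torsion point. -/
theorem nsmul_ne_zero_of_transcendental [IsAlgClosed Ω]
    (V V' : (W.baseChange Ω).toAffine.Point)
    (htr : ∀ P, P = V ∨ P = V' ∨ P = V - V' → ∃ x y, ∃ h : (W.baseChange Ω).toAffine.Nonsingular x y,
      P = Point.some x y h ∧ Transcendental F x) {n : ℕ} (hn : 0 < n) : n • V ≠ 0 := by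
  have htr' : ∀ P, P = V ∨ P = V' ∨ P = V - V' → ∃ x y, ∃ h : (W.baseChange Ω).toAffine.Nonsingular
      x y, P = Point.some x y h ∧ Transcendental (algebraicClosure F Ω) x := fun P hP => by
    obtain ⟨x, y, h, hPe, hx⟩ := htr P hP
    exact ⟨x, y, h, hPe, hx.algebraicClosure⟩
  obtain ⟨l, hl, hlT, T₀, hT₀, hlT₀⟩ := exists_prime_torsion (Ω := Ω) W
  obtain ⟨xV, yV, hV, hVe, hxV⟩ := htr' V (Or.inl rfl)
  induction n using Nat.strong_induction_on with
  | _ n ih =>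
    intro h0
    obtain ⟨T₁, hT₁⟩ := hlT T₀ hlT₀
    -- If `n` kills one transcendental point, it kills all of them.
    have hall : ∀ x y (h : (W.baseChange Ω).toAffine.Nonsingular x y),
        Transcendental (algebraicClosure F Ω) x → n • Point.some x y h = 0 := fun x y h hx => by
      refine (nsmul_eq_of_transcendental W hV h hxV hx (T := 0) ?_).trans (map_zero _)
      rw [← hVe, h0, map_zero]
    -- The translate `V + T₀` is again non-constant, as otherwise `V` would be constant. So `n`
    -- kills both `V` and `V + T₀`, hence `T₀`, which has exact order `ℓ`.
    have hnT₀ : n • T₀ = 0 := by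
      by_cases hVT : ∃ T, Point.baseChange (W' := W) (algebraicClosure F Ω) Ω T = V + T₀
      · obtain ⟨T, hT⟩ := hVT
        exfalso
        have hVc : Point.baseChange (W' := W) (algebraicClosure F Ω) Ω (T - T₁) = V := by
          rw [map_sub, hT, hT₁, add_sub_cancel_right]
        rw [hVe] at hVc
        cases hTT : T - T₁ with
        | zero =>
          rw [hTT] at hVc
          exact WeierstrassCurve.Affine.Point.some_ne_zero hV (hVc.symm.trans (map_zero _))
        | some x y h =>
          rw [hTT] at hVc
          have hx : algebraMap (algebraicClosure F Ω) Ω x = xV := (Point.some.inj hVc).1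
          exact hxV (hx ▸ isAlgebraic_algebraMap x)
      · have hsum : n • (V + T₀) = 0 := by
          cases hP : V + T₀ with
          | zero => exact nsmul_zero n
          | some x y h =>
            refine hall x y h fun hx => hVT ?_
            rw [hP]
            exact exists_baseChange_eq_of_isAlgebraic W h (hx.restrictScalars F)
        rwa [nsmul_add, h0, zero_add] at hsum
    have hdvd : l ∣ n := by
      by_contra hnd
      have hcop : Nat.Coprime l n := (Nat.Prime.coprime_iff_not_dvd hl).mpr hnd
      have h1 := addOrderOf_dvd_of_nsmul_eq_zero hlT₀
      have h2 := addOrderOf_dvd_of_nsmul_eq_zero hnT₀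
      have h3 := Nat.dvd_gcd h1 h2
      rw [hcop, Nat.dvd_one, AddMonoid.addOrderOf_eq_one_iff] at h3
      exact hT₀ h3
    obtain ⟨m, rfl⟩ := hdvd
    have hm : 0 < m := Nat.pos_of_mul_pos_left hn
    obtain ⟨T, hT⟩ := hlT (m • V) (by rw [smul_smul, h0])
    have hmT : ∀ P, P = V ∨ P = V' ∨ P = V - V' →
        m • P = Point.baseChange (W' := W) (algebraicClosure F Ω) Ω T := fun P hP => by
      obtain ⟨x, y, h, rfl, hx⟩ := htr' P hP
      exact nsmul_eq_of_transcendental W hV h hxV hx (by rw [← hVe, hT])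
    -- The constant value `T` of `m` on transcendental points is taken at `V`, `V'` and `V - V'`.
    -- Additivity gives `T = T - T = 0`, so `m < n` already kills `V`: descent.
    have hz : m • (V - V') = 0 := by
      rw [nsmul_sub, hmT V (Or.inl rfl), hmT V' (Or.inr (Or.inl rfl)), sub_self]
    refine ih m ?_ hm ?_
    · exact lt_mul_of_one_lt_left hm hl.one_lt
    · rw [hmT V (Or.inl rfl), ← hmT _ (Or.inr (Or.inr rfl)), hz]

end ConstantPoints

section Norm

/-- Elements algebraic over a finite field have norm at most one. -/
theorem transcendental_of_one_lt_norm (F : Type*) [Field F] [Finite F] {Ω : Type*} [NormedField Ω]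
    [Algebra F Ω] {x : Ω} (hx : 1 < ‖x‖) : Transcendental F x := by
  intro h
  have : FiniteDimensional F (IntermediateField.adjoin F {x}) :=
    IntermediateField.adjoin.finiteDimensional h.isIntegral
  have : Finite (IntermediateField.adjoin F {x}) := Module.finite_of_finite F
  have : Fintype (IntermediateField.adjoin F {x}) := Fintype.ofFinite _
  have h1 := FiniteField.pow_card (IntermediateField.AdjoinSimple.gen F x)
  have h2 := congr_arg (fun z : IntermediateField.adjoin F {x} => ‖(z : Ω)‖) h1
  simp only [SubmonoidClass.coe_pow, IntermediateField.AdjoinSimple.coe_gen, norm_pow] at h2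
  exact (lt_self_pow₀ hx Fintype.one_lt_card).ne' h2

end Norm

end TensorDrinfeld
namespace TensorDrinfeld

/-! ## The ring of twisted power series -/

section TwistedSeries

variable (F : Type*) [Field F] [Fintype F] (L : Type*) [Field L] [Algebra F L] (n : ℕ)

/-- The `j`-th power of the `q`-Frobenius on matrices. -/
noncomputable def frobMat (j : ℕ) : Matrix (Fin n) (Fin n) L →ₐ[F] Matrix (Fin n) (Fin n) L :=
  (FiniteField.frobeniusAlgHom F L ^ j).mapMatrix

variable {L n}

theorem frobeniusAlgHom_pow_apply (j : ℕ) (x : L) :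
    (FiniteField.frobeniusAlgHom F L ^ j) x = x ^ Fintype.card F ^ j := by
  rw [AlgHom.coe_pow, FiniteField.coe_frobeniusAlgHom, pow_iterate]

theorem twistMat_eq (j : ℕ) (M : Matrix (Fin n) (Fin n) L) :
    twistMat F j M = frobMat F L n j M := by
  ext a b
  exact (frobeniusAlgHom_pow_apply F j (M a b)).symm

theorem frobMat_frobMat (i j : ℕ) (M : Matrix (Fin n) (Fin n) L) :
    frobMat F L n i (frobMat F L n j M) = frobMat F L n (i + j) M := by
  simp only [← twistMat_eq]
  ext a b
  simp [twistMat, ← pow_mul, pow_add, mul_comm]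

theorem frobMat_zero (M : Matrix (Fin n) (Fin n) L) : frobMat F L n 0 M = M := by
  rw [← twistMat_eq]
  ext a b
  simp [twistMat]

theorem twMul_apply (A B : ℕ → Matrix (Fin n) (Fin n) L) (i : ℕ) :
    twMul F A B i = ∑ p ∈ Finset.HasAntidiagonal.antidiagonal i, A p.1 * frobMat F L n p.1 (B p.2) :=
  Finset.sum_congr rfl fun p _ => by rw [twistMat_eq]

theorem twMul_assoc (A B D : ℕ → Matrix (Fin n) (Fin n) L) :
    twMul F (twMul F A B) D = twMul F A (twMul F B D) := by
  ext1 i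
  simp only [twMul_apply, Finset.sum_mul, map_sum, Finset.mul_sum, Finset.sum_sigma']
  refine Finset.sum_nbij' (fun ⟨⟨_i, j⟩, ⟨k, l⟩⟩ => ⟨(k, l + j), (l, j)⟩)
    (fun ⟨⟨i, _j⟩, ⟨k, l⟩⟩ => ⟨(i + k, l), (i, k)⟩) ?_ ?_ ?_ ?_ ?_
  · rintro ⟨⟨a, b⟩, ⟨c, d⟩⟩ h
    simp only [Finset.mem_sigma, Finset.HasAntidiagonal.mem_antidiagonal] at h ⊢
    exact ⟨by omega, trivial⟩
  · rintro ⟨⟨a, b⟩, ⟨c, d⟩⟩ h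
    simp only [Finset.mem_sigma, Finset.HasAntidiagonal.mem_antidiagonal] at h ⊢
    exact ⟨by omega, trivial⟩
  · rintro ⟨⟨a, b⟩, ⟨c, d⟩⟩ h
    simp only [Finset.mem_sigma, Finset.HasAntidiagonal.mem_antidiagonal] at h ⊢
    obtain ⟨_, rfl⟩ := h
    rfl
  · rintro ⟨⟨a, b⟩, ⟨c, d⟩⟩ h
    simp only [Finset.mem_sigma, Finset.HasAntidiagonal.mem_antidiagonal] at h ⊢
    obtain ⟨_, rfl⟩ := h
    rfl
  · rintro ⟨⟨a, b⟩, ⟨c, d⟩⟩ h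
    simp only [Finset.mem_sigma, Finset.HasAntidiagonal.mem_antidiagonal] at h ⊢
    obtain ⟨_, rfl⟩ := h
    rw [map_mul, frobMat_frobMat, mul_assoc]

theorem twMul_single (A : ℕ → Matrix (Fin n) (Fin n) L) (M : Matrix (Fin n) (Fin n) L) (i : ℕ) :
    twMul F A (Pi.single 0 M) i = A i * frobMat F L n i M := by
  rw [twMul_apply, Finset.sum_eq_single (i, 0)]
  · simp
  · rintro ⟨a, b⟩ h hne
    have hb : b ≠ 0 := by
      rintro rfl
      simp at h
      exact hne (by rw [h])
    simp [hb]
  · simp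

theorem single_twMul (A : ℕ → Matrix (Fin n) (Fin n) L) (M : Matrix (Fin n) (Fin n) L) (i : ℕ) :
    twMul F (Pi.single 0 M) A i = M * A i := by
  rw [twMul_apply, Finset.sum_eq_single (0, i)]
  · simp [frobMat_zero]
  · rintro ⟨a, b⟩ h hne
    have hb : a ≠ 0 := by
      rintro rfl
      simp at h
      exact hne (by rw [h])
    simp [hb]
  · simp


/-- Twisted power series `∑ A_i τ^i` with matrix coefficients, as a ring. -/
def TwistedSeries (_F : Type*) (L : Type*) (n : ℕ) : Type _ := ℕ → Matrix (Fin n) (Fin n) L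

namespace TwistedSeries

noncomputable instance : AddCommGroup (TwistedSeries F L n) :=
  inferInstanceAs (AddCommGroup (ℕ → Matrix (Fin n) (Fin n) L))

noncomputable instance : Module F (TwistedSeries F L n) :=
  inferInstanceAs (Module F (ℕ → Matrix (Fin n) (Fin n) L))

noncomputable instance : Ring (TwistedSeries F L n) :=
  { (inferInstance : AddCommGroup (TwistedSeries F L n)) with
    mul := twMul F
    one := (Pi.single 0 1 : ℕ → Matrix (Fin n) (Fin n) L)
    zero_mul := fun a => by
      funext i
      refine (twMul_apply F _ _ i).trans (Finset.sum_eq_zero fun p _ => zero_mul _)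
    mul_zero := fun a => by
      funext i
      refine (twMul_apply F _ _ i).trans (Finset.sum_eq_zero fun p _ => ?_)
      exact (congrArg (a p.1 * ·) (map_zero _)).trans (mul_zero _)
    left_distrib := fun a b c => by
      funext i
      refine (twMul_apply F _ _ i).trans ?_
      refine Eq.trans ?_ (congrArg₂ (· + ·) (twMul_apply F a b i) (twMul_apply F a c i)).symm
      rw [← Finset.sum_add_distrib]
      refine Finset.sum_congr rfl fun p _ => ?_
      exact (congrArg (a p.1 * ·) (map_add _ _ _)).trans (mul_add _ _ _)
    right_distrib := fun a b c => by
      funext i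
      refine (twMul_apply F _ _ i).trans ?_
      refine Eq.trans ?_ (congrArg₂ (· + ·) (twMul_apply F a c i) (twMul_apply F b c i)).symm
      rw [← Finset.sum_add_distrib]
      exact Finset.sum_congr rfl fun p _ => add_mul _ _ _
    mul_assoc := twMul_assoc F
    one_mul := fun a => by
      funext i
      exact (single_twMul F a 1 i).trans (one_mul _)
    mul_one := fun a => by
      funext i
      exact (twMul_single F a 1 i).trans ((congrArg (a i * ·) (map_one _)).trans (mul_one _)) }

noncomputable instance : Algebra F (TwistedSeries F L n) :=
  Algebra.ofModule
    (fun r a b => by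
      funext i
      refine (twMul_apply F _ _ i).trans ?_
      refine Eq.trans ?_ (congrArg (r • ·) (twMul_apply F a b i)).symm
      rw [Finset.smul_sum]
      exact Finset.sum_congr rfl fun p _ => Matrix.smul_mul r (a p.1) (frobMat F L n p.1 (b p.2)))
    (fun r a b => by
      funext i
      refine (twMul_apply F _ _ i).trans ?_
      refine Eq.trans ?_ (congrArg (r • ·) (twMul_apply F a b i)).symm
      rw [Finset.smul_sum]
      refine Finset.sum_congr rfl fun p _ => ?_
      exact (congrArg (a p.1 * ·) (map_smul (frobMat F L n p.1) r (b p.2))).trans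
        (Matrix.mul_smul (a p.1) r (frobMat F L n p.1 (b p.2))))

variable {F}

theorem sub_apply (A B : TwistedSeries F L n) (i : ℕ) : (A - B) i = A i - B i := rfl

theorem pow_def (A : TwistedSeries F L n) (k : ℕ) : A ^ k = twPow F A k := by
  induction k with
  | zero => rfl
  | succ k ih => rw [pow_succ, ih]; rfl

variable (F L n) in
/-- The constant coefficient. -/
noncomputable def constCoeff : TwistedSeries F L n →ₐ[F] Matrix (Fin n) (Fin n) L :=
  AlgHom.ofLinearMap { toFun := fun A => A 0, map_add' := fun _ _ => rfl, map_smul' := fun _ _ => rfl }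
    rfl (fun A B => by
      refine (twMul_apply F A B 0).trans ?_
      rw [Finset.Nat.antidiagonal_zero, Finset.sum_singleton, frobMat_zero]
      rfl)

theorem constCoeff_apply (A : TwistedSeries F L n) : constCoeff F L n A = A 0 := rfl

variable (F) in
/-- The constant series with value `M`. -/
def const (M : Matrix (Fin n) (Fin n) L) : TwistedSeries F L n :=
  (Pi.single 0 M : ℕ → Matrix (Fin n) (Fin n) L)

theorem const_zero_apply (M : Matrix (Fin n) (Fin n) L) : (const F M) 0 = M :=
  Pi.single_eq_same (M := fun _ => Matrix (Fin n) (Fin n) L) _ _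

theorem mul_const_apply (A : TwistedSeries F L n) (M : Matrix (Fin n) (Fin n) L) (i : ℕ) :
    (A * const F M) i = A i * frobMat F L n i M := twMul_single F A M i

theorem const_mul_apply (A : TwistedSeries F L n) (M : Matrix (Fin n) (Fin n) L) (i : ℕ) :
    (const F M * A) i = M * A i := single_twMul F A M i

theorem const_mul_const (M N : Matrix (Fin n) (Fin n) L) :
    const F M * const F N = const F (M * N) := by
  funext i
  refine (const_mul_apply _ M i).trans ?_
  rcases eq_or_ne i 0 with rfl | hi
  · exact (congrArg (M * ·) (const_zero_apply N)).trans (const_zero_apply _).symm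
  · have h : ∀ X : Matrix (Fin n) (Fin n) L, (const F X) i = 0 := fun X =>
      Pi.single_eq_of_ne (M := fun _ => Matrix (Fin n) (Fin n) L) hi X
    rw [h, h, mul_zero]

theorem mul_apply (A B : TwistedSeries F L n) (i : ℕ) :
    (A * B) i = ∑ p ∈ Finset.HasAntidiagonal.antidiagonal i, A p.1 * frobMat F L n p.1 (B p.2) :=
  twMul_apply F A B i

end TwistedSeries

end TwistedSeries

/-! ## Twisted series acting on semilinear modules -/

section Action

variable {F : Type*} [Field F] [Fintype F] {L : Type*} [Field L] [Algebra F L] {n : ℕ}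
  {M : Type*} [AddCommGroup M] [Module L M]

theorem sum_range_sum_antidiagonal {A : Type*} [AddCommMonoid A] (φ : ℕ → ℕ → A) {N K : ℕ}
    (h : ∀ j l, N ≤ j ∨ K ≤ l → φ j l = 0) :
    ∑ s ∈ Finset.range (N + K), ∑ p ∈ Finset.HasAntidiagonal.antidiagonal s, φ p.1 p.2 =
      ∑ j ∈ Finset.range N, ∑ l ∈ Finset.range K, φ j l := by
  rw [← Finset.sum_product', Finset.sum_sigma']
  symm
  refine Finset.sum_of_injOn (fun p => ⟨p.1 + p.2, p⟩) ?_ ?_ ?_ ?_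
  · rintro p - r - hpr
    simpa using congrArg Sigma.snd hpr
  · rintro p hp
    simp at hp ⊢
    omega
  · rintro ⟨s, p⟩ hp hnot
    refine h _ _ ?_
    simp at hp hnot
    by_contra! hlt
    exact hnot hlt.1 hlt.2 hp.2
  · rintro p -
    rfl

/-- `H = A · G`, for a twisted polynomial `A` and `τ` acting on vectors over `M`. -/
def Represents (τ : M → M) (A : TwistedSeries F L n) (G H : Fin n → M) : Prop :=
  ∃ N : ℕ, (∀ j, N ≤ j → A j = 0) ∧
    ∀ i, H i = ∑ j ∈ Finset.range N, ∑ k, A j i k • τ^[j] (G k)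

variable {τ : M →+ M}

/-- Moving `τ^j` past a coefficient raises it to the power `q^j`, which is exactly the twist in the
product of twisted series. -/
theorem Represents.comp (hτ : ∀ (c : L) m, τ (c • m) = c ^ Fintype.card F • τ m)
    {A B : TwistedSeries F L n} {G H K : Fin n → M}
    (hA : Represents τ A G H) (hB : Represents τ B K G) : Represents τ (A * B) K H := by
  obtain ⟨N, hN, hA⟩ := hA
  obtain ⟨N', hN', hB⟩ := hB
  have hτj : ∀ (j : ℕ) (c : L) m, τ^[j] (c • m) = c ^ Fintype.card F ^ j • τ^[j] m := by
    intro j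
    induction j with
    | zero => simp
    | succ j ih =>
      intro c m
      rw [Function.iterate_succ_apply, hτ, ih, ← pow_mul, ← pow_succ', ← Function.iterate_succ_apply]
  have hs : ∀ j l, N ≤ j ∨ N' ≤ l → A j * frobMat F L n j (B l) = 0 := by
    rintro j l (h | h)
    · rw [hN j h, zero_mul]
    · rw [hN' l h, map_zero, mul_zero]
  refine ⟨N + N', fun s hs' => ?_, fun i => ?_⟩
  · rw [TwistedSeries.mul_apply]
    refine Finset.sum_eq_zero fun p hp => hs _ _ ?_
    rw [Finset.HasAntidiagonal.mem_antidiagonal] at hp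
    omega
  · have key : ∀ s ∈ Finset.range (N + N'), ∑ k, (A * B) s i k • τ^[s] (K k) =
        ∑ p ∈ Finset.HasAntidiagonal.antidiagonal s, ∑ k, (A p.1 * frobMat F L n p.1 (B p.2)) i k •
          τ^[p.1] (τ^[p.2] (K k)) := by
      intro s _
      rw [Finset.sum_comm]
      refine Finset.sum_congr rfl fun k _ => ?_
      rw [TwistedSeries.mul_apply, Matrix.sum_apply, Finset.sum_smul]
      refine Finset.sum_congr rfl fun p hp => ?_
      rw [← Function.iterate_add_apply, Finset.HasAntidiagonal.mem_antidiagonal.1 hp]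
    rw [Finset.sum_congr rfl key, sum_range_sum_antidiagonal
      (fun j l => ∑ k, (A j * frobMat F L n j (B l)) i k • τ^[j] (τ^[l] (K k)))
      (fun j l h => by simp [hs j l h]), hA i]
    refine Finset.sum_congr rfl fun j _ => ?_
    have hG : ∀ k, τ^[j] (G k) = ∑ l ∈ Finset.range N', ∑ m,
        frobMat F L n j (B l) k m • τ^[j] (τ^[l] (K m)) := by
      intro k
      have hsum : ∀ {ι : Type} (s : Finset ι) (φ : ι → M),
          τ^[j] (∑ x ∈ s, φ x) = ∑ x ∈ s, τ^[j] (φ x) := by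
        intro ι s φ
        exact map_sum ((show AddMonoid.End M from τ) ^ j) φ s
      rw [hB k, hsum]
      refine Finset.sum_congr rfl fun l _ => ?_
      rw [hsum]
      refine Finset.sum_congr rfl fun m _ => ?_
      rw [hτj, ← twistMat_eq]
      rfl
    simp_rw [hG, Finset.smul_sum, smul_smul]
    rw [Finset.sum_comm]
    refine Finset.sum_congr rfl fun l _ => ?_
    rw [Finset.sum_comm]
    refine Finset.sum_congr rfl fun m _ => ?_
    rw [Matrix.mul_apply, Finset.sum_smul]

theorem Represents.map {A : TwistedSeries F L n} {G H : Fin n → M}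
    (hA : Represents τ A G H) (T : M →ₗ[L] M) (hT : ∀ m, τ (T m) = T (τ m)) :
    Represents τ A (fun k => T (G k)) (fun k => T (H k)) := by
  obtain ⟨N, hN, hA⟩ := hA
  have hTj : ∀ (j : ℕ) m, τ^[j] (T m) = T (τ^[j] m) := fun j m =>
    (Function.Commute.iterate_left (f := τ) (g := T) hT j) m
  refine ⟨N, hN, fun i => ?_⟩
  simp only [hA i, map_sum, map_smul, hTj]

theorem Represents.extend {A : TwistedSeries F L n} {G H : Fin n → M} {N : ℕ}
    (hN : ∀ j, N ≤ j → A j = 0)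
    (hA : ∀ i, H i = ∑ j ∈ Finset.range N, ∑ k, A j i k • τ^[j] (G k)) {N' : ℕ} (h : N ≤ N') (i) :
    H i = ∑ j ∈ Finset.range N', ∑ k, A j i k • τ^[j] (G k) := by
  rw [hA i]
  refine Finset.sum_subset (by simpa using h) fun j _ hj => ?_
  rw [hN j (by simpa using hj)]
  simp

theorem Represents.sub {A B : TwistedSeries F L n} {G H H' : Fin n → M}
    (hA : Represents τ A G H) (hB : Represents τ B G H') : Represents τ (A - B) G (H - H') := by
  obtain ⟨N, hN, hA⟩ := hA
  obtain ⟨N', hN', hB⟩ := hB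
  refine ⟨max N N', fun j hj => ?_, fun i => ?_⟩
  · rw [TwistedSeries.sub_apply, hN j (by omega), hN' j (by omega), sub_zero]
  · rw [Pi.sub_apply, Represents.extend hN hA (le_max_left N N') i,
      Represents.extend hN' hB (le_max_right N N') i, ← Finset.sum_sub_distrib]
    refine Finset.sum_congr rfl fun j _ => ?_
    rw [← Finset.sum_sub_distrib]
    refine Finset.sum_congr rfl fun k _ => ?_
    rw [TwistedSeries.sub_apply, Matrix.sub_apply, sub_smul]

theorem Represents.zero (G : Fin n → M) : Represents τ (0 : TwistedSeries F L n) G 0 :=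
  ⟨0, fun _ _ => rfl, fun i => by simp⟩

theorem Represents.neg {A : TwistedSeries F L n} {G H : Fin n → M}
    (hA : Represents τ A G H) : Represents τ (-A) G (-H) := by
  simpa using (Represents.zero G).sub hA

theorem Represents.add {A B : TwistedSeries F L n} {G H H' : Fin n → M}
    (hA : Represents τ A G H) (hB : Represents τ B G H') : Represents τ (A + B) G (H + H') := by
  simpa using hA.sub hB.neg

theorem Represents.one (G : Fin n → M) : Represents τ (1 : TwistedSeries F L n) G G := by
  refine ⟨1, fun j hj => ?_, fun i => ?_⟩
  · exact Pi.single_eq_of_ne (M := fun _ => Matrix (Fin n) (Fin n) L) (by omega) 1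
  · have : (1 : TwistedSeries F L n) 0 = 1 :=
      Pi.single_eq_same (M := fun _ => Matrix (Fin n) (Fin n) L) 0 1
    simp [this, Matrix.one_apply]

theorem Represents.smul {A : TwistedSeries F L n} {G H : Fin n → M}
    (hA : Represents τ A G H) (c : F) :
    Represents τ (c • A) G (fun i => algebraMap F L c • H i) := by
  obtain ⟨N, hN, hA⟩ := hA
  have h : ∀ j, (c • A) j = c • A j := fun j => rfl
  refine ⟨N, fun j hj => by rw [h, hN j hj, smul_zero], fun i => ?_⟩
  simp only [hA i, Finset.smul_sum, h, Matrix.smul_apply, smul_smul, Algebra.smul_def]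

end Action

end TensorDrinfeld
namespace TensorDrinfeld

/-! ## The Anderson module as a commuting family of twisted polynomials -/

section AndersonModule

theorem sum_range_sum_fin {A : Type*} [AddCommMonoid A] (φ : ℕ → A) (n N : ℕ) :
    ∑ j ∈ Finset.range N, ∑ k : Fin n, φ (j * n + k) = ∑ m ∈ Finset.range (N * n), φ m := by
  induction N with
  | zero => simp
  | succ N ih =>
    rw [Finset.sum_range_succ, ih, Nat.succ_mul, Finset.sum_range_add, Finset.sum_range]
    simp only [Finset.sum_range]

variable {F : Type*} [Field F] [Fintype F] {L : Type*} [Field L] [DecidableEq L] [Algebra F L]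
  {W : WeierstrassCurve F} {θ η : L} {hΞ : (W.baseChange L).toAffine.Nonsingular θ η}
  {V : (W.baseChange L).toAffine.Point} {n : ℕ} [NeZero n]
  {f : (W.baseChange L).toAffine.FunctionField}
  {g : Fin n → (W.baseChange L).toAffine.FunctionField}

variable (W f n) in
/-- The semilinear operator `h ↦ f ^ n * h^{(1)}`. -/
noncomputable def tauHom :
    (W.baseChange L).toAffine.FunctionField →+ (W.baseChange L).toAffine.FunctionField :=
  (AddMonoidHom.mulLeft (f ^ n)).comp (twist W : _ →+* _).toAddMonoidHom

theorem tauHom_apply (h : (W.baseChange L).toAffine.FunctionField) :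
    tauHom W n f h = f ^ n * twist W h := rfl

theorem tauHom_smul (c : L) (h : (W.baseChange L).toAffine.FunctionField) :
    tauHom W n f (c • h) = c ^ Fintype.card F • tauHom W n f h := by
  rw [tauHom_apply, tauHom_apply, twist_const_smul, mul_smul_comm]

theorem gExt_mul_add (j : ℕ) (k : Fin n) :
    gExt W f g (j * n + k) = (tauHom W n f)^[j] (g k) := by
  induction j with
  | zero =>
    rw [zero_mul, zero_add, gExt_of_lt k.isLt]
    rfl
  | succ j ih =>
    rw [Function.iterate_succ_apply', ← ih, tauHom_apply, ← gExt_add]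
    congr 1
    ring

/-- Writing `m = jn + k` flattens the double sum over powers of `τ` and basis vectors into one sum
over the `g_m`. -/
theorem represents_iff_gExt {A : TwistedSeries F L n}
    {H : Fin n → (W.baseChange L).toAffine.FunctionField} :
    Represents (tauHom W n f) A g H ↔ ∃ N : ℕ, (∀ j, N ≤ j → A j = 0) ∧
      ∀ i, H i = ∑ m ∈ Finset.range (N * n), A (m / n) i (Fin.ofNat n m) • gExt W f g m := by
  refine exists_congr fun N => and_congr_right fun _ => forall_congr' fun i => ?_
  rw [← sum_range_sum_fin]
  have key : ∀ j (k : Fin n), A ((j * n + k) / n) i (Fin.ofNat n (j * n + k)) = A j i k := by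
    intro j k
    have h1 : (j * n + k) / n = j := by
      rw [mul_comm, Nat.mul_add_div (NeZero.pos n), Nat.div_eq_of_lt k.isLt, add_zero]
    have h2 : Fin.ofNat n (j * n + k) = k := by
      ext
      simp [Fin.ofNat, Nat.mod_eq_of_lt k.isLt]
    rw [h1, h2]
  simp only [key, gExt_mul_add]

namespace IsMotiveData

/-- By linear independence of the `g_m`. This transfers identities such as `t y = y t` and the
Weierstrass equation from the function field to twisted polynomials. -/
theorem eq_of_represents (D : IsMotiveData W hΞ V f g) {A B : TwistedSeries F L n}
    {H : Fin n → (W.baseChange L).toAffine.FunctionField}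
    (hA : Represents (tauHom W n f) A g H) (hB : Represents (tauHom W n f) B g H) : A = B := by
  have hC := hA.sub hB
  rw [sub_self, represents_iff_gExt] at hC
  obtain ⟨N, hN, hC⟩ := hC
  have h0 : ∀ j i k, (A - B) j i k = 0 := by
    intro j i k
    by_cases hj : N ≤ j
    · rw [hN j hj]; rfl
    have := (D.eq_zero_of_sum_gExt (fun m => (A - B) (m / n) i (Fin.ofNat n m)) (N * n)).2
      (hC i).symm (j * n + k) (by
        have := k.isLt
        have : (j + 1) * n ≤ N * n := Nat.mul_le_mul_right _ (by omega)
        rw [Nat.succ_mul] at this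
        omega)
    have h1 : (j * n + k) / n = j := by
      rw [mul_comm, Nat.mul_add_div (NeZero.pos n), Nat.div_eq_of_lt k.isLt, add_zero]
    have h2 : Fin.ofNat n (j * n + k) = k := by
      ext
      simp [Fin.ofNat, Nat.mod_eq_of_lt k.isLt]
    simpa only [h1, h2] using this
  funext j
  ext i k
  have := h0 j i k
  rw [TwistedSeries.sub_apply, Matrix.sub_apply, sub_eq_zero] at this
  exact this

theorem rhoT_apply_div (i : Fin n) (m : ℕ) :
    rhoT W f g θ (m / n) i (Fin.ofNat n m) = if m = (i : ℕ) then θ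
      else if m = (i : ℕ) + 1 then aConst W f g θ i else if m = (i : ℕ) + 2 then 1 else 0 := by
  have : m / n * n + ((Fin.ofNat n m : Fin n) : ℕ) = m := by
    rw [mul_comm]; exact Nat.div_add_mod m n
  rw [rhoT, Matrix.of_apply, this]

theorem rhoY_apply_div (i : Fin n) (m : ℕ) :
    rhoY W f g η (m / n) i (Fin.ofNat n m) = if m = (i : ℕ) then η
      else if m = (i : ℕ) + 1 then (yzConst W f g η i).1
      else if m = (i : ℕ) + 2 then (yzConst W f g η i).2
      else if m = (i : ℕ) + 3 then 1 else 0 := by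
  have : m / n * n + ((Fin.ofNat n m : Fin n) : ℕ) = m := by
    rw [mul_comm]; exact Nat.div_add_mod m n
  rw [rhoY, Matrix.of_apply, this]

/-- The largest index in `t g_i` is below `3n`. The bound is sharp for `n = 1`, where `ρ_t` has
degree `2` in `τ`; this degree matters for the growth of the exponential. -/
theorem rhoT_eq_zero {j : ℕ} (hj : 3 ≤ j) : rhoT W f g θ j = 0 := by
  ext i k
  have h := i.isLt
  have : 3 * n ≤ j * n := Nat.mul_le_mul_right _ hj
  have := NeZero.pos n
  rw [rhoT, Matrix.of_apply, if_neg (by omega), if_neg (by omega), if_neg (by omega)]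
  rfl

theorem rhoY_eq_zero {j : ℕ} (hj : 4 ≤ j) : rhoY W f g η j = 0 := by
  ext i k
  have h := i.isLt
  have : 4 * n ≤ j * n := Nat.mul_le_mul_right _ hj
  have := NeZero.pos n
  rw [rhoY, Matrix.of_apply, if_neg (by omega), if_neg (by omega), if_neg (by omega),
    if_neg (by omega)]
  rfl

theorem represents_rhoT (D : IsMotiveData W hΞ V f g) :
    Represents (tauHom W n f) (F := F) (rhoT W f g θ) g (fun i => tFun _ * g i) := by
  refine represents_iff_gExt.mpr ⟨3, fun j hj => rhoT_eq_zero hj, fun i => ?_⟩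
  have hi := i.isLt
  have hn := NeZero.pos n
  have key : ∀ m ∈ Finset.range (3 * n), rhoT W f g θ (m / n) i (Fin.ofNat n m) • gExt W f g m =
      (if m = (i : ℕ) then θ • gExt W f g m else 0) +
      (if m = (i : ℕ) + 1 then aConst W f g θ i • gExt W f g m else 0) +
      (if m = (i : ℕ) + 2 then gExt W f g m else 0) := by
    intro m _
    rw [rhoT_apply_div]
    split_ifs <;> first | omega | simp
  rw [Finset.sum_congr rfl key, Finset.sum_add_distrib, Finset.sum_add_distrib,
    Finset.sum_ite_eq', Finset.sum_ite_eq', Finset.sum_ite_eq',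
    if_pos (Finset.mem_range.mpr (by omega)), if_pos (Finset.mem_range.mpr (by omega)),
    if_pos (Finset.mem_range.mpr (by omega)), D.tFun_mul i, gExt_of_lt hi]

theorem represents_rhoY (D : IsMotiveData W hΞ V f g) :
    Represents (tauHom W n f) (F := F) (rhoY W f g η) g (fun i => yFun _ * g i) := by
  refine represents_iff_gExt.mpr ⟨4, fun j hj => rhoY_eq_zero hj, fun i => ?_⟩
  have hi := i.isLt
  have hn := NeZero.pos n
  have key : ∀ m ∈ Finset.range (4 * n), rhoY W f g η (m / n) i (Fin.ofNat n m) • gExt W f g m =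
      (if m = (i : ℕ) then η • gExt W f g m else 0) +
      (if m = (i : ℕ) + 1 then (yzConst W f g η i).1 • gExt W f g m else 0) +
      (if m = (i : ℕ) + 2 then (yzConst W f g η i).2 • gExt W f g m else 0) +
      (if m = (i : ℕ) + 3 then gExt W f g m else 0) := by
    intro m _
    rw [rhoY_apply_div]
    split_ifs <;> first | omega | simp
  rw [Finset.sum_congr rfl key, Finset.sum_add_distrib, Finset.sum_add_distrib,
    Finset.sum_add_distrib, Finset.sum_ite_eq', Finset.sum_ite_eq', Finset.sum_ite_eq',
    Finset.sum_ite_eq', if_pos (Finset.mem_range.mpr (by omega)),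
    if_pos (Finset.mem_range.mpr (by omega)), if_pos (Finset.mem_range.mpr (by omega)),
    if_pos (Finset.mem_range.mpr (by omega)), D.yFun_mul i, gExt_of_lt hi]

end IsMotiveData

variable (W n f g) in
/-- `A` represents multiplication by the twist-invariant function `a` in the `τ`-basis `g`. -/
def RepresentsMul (A : TwistedSeries F L n) (a : (W.baseChange L).toAffine.FunctionField) : Prop :=
  Represents (tauHom W n f) A g (fun i => a * g i) ∧ twist W a = a

namespace RepresentsMul

variable {A B : TwistedSeries F L n} {a b : (W.baseChange L).toAffine.FunctionField}

theorem mul (hA : RepresentsMul W n f g A a) (hB : RepresentsMul W n f g B b) :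
    RepresentsMul W n f g (A * B) (a * b) := by
  refine ⟨?_, by rw [map_mul, hA.2, hB.2]⟩
  -- Since `b` is fixed by twisting, multiplication by it commutes with `τ`, so it may be applied to
  -- the relation for `a` before composing.
  have h := (hA.1.map (LinearMap.mulLeft L b) fun m => by
    rw [LinearMap.mulLeft_apply, LinearMap.mulLeft_apply, tauHom_apply, tauHom_apply, map_mul,
      hB.2, mul_left_comm]).comp (fun c m => tauHom_smul c m) hB.1
  convert h using 2 with i
  rw [LinearMap.mulLeft_apply]
  ring

theorem add (hA : RepresentsMul W n f g A a) (hB : RepresentsMul W n f g B b) :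
    RepresentsMul W n f g (A + B) (a + b) := by
  refine ⟨?_, by rw [map_add, hA.2, hB.2]⟩
  convert hA.1.add hB.1 using 2 with i
  exact add_mul _ _ _

theorem one : RepresentsMul W n f g (1 : TwistedSeries F L n) 1 :=
  ⟨by simpa using Represents.one g, map_one _⟩

theorem smul (hA : RepresentsMul W n f g A a) (c : F) :
    RepresentsMul W n f g (c • A) (algebraMap F _ c * a) := by
  constructor
  · convert hA.1.smul c using 2 with i
    rw [mul_assoc, Algebra.smul_def, ← IsScalarTower.algebraMap_apply]
  · rw [map_mul, hA.2]
    congr 1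
    have h := twist_const_smul W (algebraMap F L c) (1 : (W.baseChange L).toAffine.FunctionField)
    rw [map_one, ← map_pow, FiniteField.pow_card, Algebra.smul_def, mul_one,
      ← IsScalarTower.algebraMap_apply] at h
    exact h

theorem pow (hA : RepresentsMul W n f g A a) (k : ℕ) : RepresentsMul W n f g (A ^ k) (a ^ k) := by
  induction k with
  | zero => simpa using one
  | succ k ih => rw [pow_succ, pow_succ]; exact ih.mul hA

theorem congr (D : IsMotiveData W hΞ V f g) (hA : RepresentsMul W n f g A a)
    (hB : RepresentsMul W n f g B b) (h : a = b) : A = B := by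
  subst h
  exact D.eq_of_represents hA.1 hB.1

end RepresentsMul

variable (W f g θ η) in
/-- The operator `ρ_t` in the ring of twisted series. -/
noncomputable def seriesT : TwistedSeries F L n := rhoT W f g θ

variable (W f g η) in
/-- The operator `ρ_y` in the ring of twisted series. -/
noncomputable def seriesY : TwistedSeries F L n := rhoY W f g η

namespace IsMotiveData

theorem representsMul_seriesT (D : IsMotiveData W hΞ V f g) :
    RepresentsMul W n f g (seriesT W θ f g) (tFun _) :=
  ⟨D.represents_rhoT, twist_tFun W⟩

theorem representsMul_seriesY (D : IsMotiveData W hΞ V f g) :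
    RepresentsMul W n f g (seriesY W η f g) (yFun _) :=
  ⟨D.represents_rhoY, twist_yFun W⟩

theorem commute_seriesT_seriesY (D : IsMotiveData W hΞ V f g) :
    Commute (seriesT W θ f g) (seriesY W η f g) :=
  RepresentsMul.congr D (D.representsMul_seriesT.mul D.representsMul_seriesY)
    (D.representsMul_seriesY.mul D.representsMul_seriesT) (mul_comm _ _)

theorem equation_series (D : IsMotiveData W hΞ V f g) :
    seriesY W η f g ^ 2 + W.a₁ • (seriesT W θ f g * seriesY W η f g) + W.a₃ • seriesY W η f g =
      seriesT W θ f g ^ 3 + W.a₂ • seriesT W θ f g ^ 2 + W.a₄ • seriesT W θ f g +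
        W.a₆ • (1 : TwistedSeries F L n) := by
  have hT := D.representsMul_seriesT
  have hY := D.representsMul_seriesY
  refine RepresentsMul.congr D (((hY.pow 2).add ((hT.mul hY).smul W.a₁)).add (hY.smul W.a₃))
    ((((hT.pow 3).add ((hT.pow 2).smul W.a₂)).add (hT.smul W.a₄)).add
      (RepresentsMul.one.smul W.a₆)) ?_
  have h := (WeierstrassCurve.Affine.equation_iff _ _).mp (equation_tFun_yFun (k := L) W)
  rw [mul_one, ← mul_assoc]
  exact h

end IsMotiveData

theorem aeval_seriesT (p : F[X]) :
    aeval (seriesT W θ f g) p = rhoPoly W f g θ p := by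
  rw [aeval_def, eval₂_eq_sum]
  refine Finset.sum_congr rfl fun i _ => ?_
  exact (Algebra.smul_def (p.coeff i) (seriesT W θ f g ^ i)).symm.trans
    (congrArg (p.coeff i • ·) (TwistedSeries.pow_def _ i))

variable (f g θ η) in
/-- The operator `ρ_a` in the ring of twisted series. -/
noncomputable def seriesRho (a : W.toAffine.CoordinateRing) : TwistedSeries F L n :=
  rho W f g θ η a

theorem seriesRho_eq (a : W.toAffine.CoordinateRing) :
    seriesRho θ η f g a = aeval (seriesT W θ f g) (partOne W.toAffine a) +
      seriesY W η f g * aeval (seriesT W θ f g) (partY W.toAffine a) := by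
  rw [aeval_seriesT, aeval_seriesT]
  rfl

theorem IsMotiveData.commute_seriesRho (D : IsMotiveData W hΞ V f g)
    (a : W.toAffine.CoordinateRing) :
    Commute (seriesRho θ η f g a) (seriesT W θ f g) := by
  rw [seriesRho_eq]
  have h : ∀ p : F[X], Commute (aeval (seriesT W θ f g) p) (seriesT W θ f g) := fun p => by
    have := (Commute.all p X).map (aeval (seriesT W θ f g))
    rwa [aeval_X] at this
  exact (h _).add_left (D.commute_seriesT_seriesY.symm.mul_left (h _))

end AndersonModule

end TensorDrinfeld
namespace TensorDrinfeld

/-! ## Weighted estimates for nearly scalar matrices -/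

section Weighted

/-- At the largest entry, the alternative `r v ≤ v` with `r > 1` forces `v = 0`. Thus an estimate in
terms of the unknown's own maximum absorbs itself. -/
theorem mul_le_of_forall_mul_le_max {ι : Type*} [Finite ι] {v : ι → ℝ} (hv : ∀ i, 0 ≤ v i)
    {r B : ℝ} (hr : 1 < r) (hB : 0 ≤ B)
    (h : ∀ m, 0 ≤ m → (∀ j, v j ≤ m) → ∀ i, r * v i ≤ max B m) (i : ι) : r * v i ≤ B := by
  have : Nonempty ι := ⟨i⟩
  obtain ⟨k, hk⟩ := Finite.exists_max v
  have h1 : r * v k ≤ B := by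
    rcases le_max_iff.mp (h (v k) (hv k) hk k) with h | h
    · exact h
    · have : v k ≤ 0 := by nlinarith
      nlinarith [hv k]
  exact (mul_le_mul_of_nonneg_left (hk i) (by linarith)).trans h1

variable {Ω : Type*} [NormedField Ω] [IsUltrametricDist Ω] {n : ℕ} {θ : Ω} {s : ℝ}

theorem norm_add_le_of_le {x y : Ω} {m : ℝ} (hx : ‖x‖ ≤ m) (hy : ‖y‖ ≤ m) : ‖x + y‖ ≤ m :=
  (IsUltrametricDist.norm_add_le_max x y).trans (max_le hx hy)

theorem norm_sub_le_of_le {x y : Ω} {m : ℝ} (hx : ‖x‖ ≤ m) (hy : ‖y‖ ≤ m) : ‖x - y‖ ≤ m := by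
  rw [sub_eq_add_neg]
  exact norm_add_le_of_le hx (by rwa [norm_neg])

theorem norm_pow_sub_self (hθ : 1 < ‖θ‖) {q : ℕ} (hq : 2 ≤ q) : ‖θ ^ q - θ‖ = ‖θ‖ ^ q := by
  have hlt : ‖θ‖ < ‖θ ^ q‖ := by
    rw [norm_pow]
    exact lt_self_pow₀ hθ hq
  rw [sub_eq_add_neg, IsUltrametricDist.norm_add_eq_max_of_norm_ne_norm (by
    rw [norm_neg]; exact hlt.ne'), norm_neg, max_eq_left hlt.le, norm_pow]

/-- The estimate for the solution of a Sylvester equation with nearly scalar coefficients. -/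
theorem sylvester_bound (hs : 1 ≤ s) (hθ : 1 < ‖θ‖) {q : ℕ} (hq : 2 ≤ q)
    {N N' X R : Matrix (Fin n) (Fin n) Ω}
    (hN : ∀ a b, ‖N a b‖ * s ^ (a : ℕ) ≤ s ^ (b : ℕ))
    (hN' : ∀ a b, ‖N' a b‖ * (s ^ (a : ℕ)) ^ q ≤ (s ^ (b : ℕ)) ^ q)
    (hX : X * (θ ^ q • 1 + N') - (θ • 1 + N) * X = R) {B : ℝ} (hB : 0 ≤ B)
    (hR : ∀ a b, ‖R a b‖ * s ^ (a : ℕ) / (s ^ (b : ℕ)) ^ q ≤ B) (a b : Fin n) :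
    ‖θ‖ ^ q * (‖X a b‖ * s ^ (a : ℕ) / (s ^ (b : ℕ)) ^ q) ≤ B := by
  have hs0 : 0 < s := by linarith
  refine mul_le_of_forall_mul_le_max (ι := Fin n × Fin n)
    (v := fun p => ‖X p.1 p.2‖ * s ^ (p.1 : ℕ) / (s ^ (p.2 : ℕ)) ^ q) (fun p => by positivity)
    (one_lt_pow₀ hθ (by omega)) hB (fun m hm0 hm p => ?_) (a, b)
  obtain ⟨a, b⟩ := p
  have hsa : 0 < s ^ (a : ℕ) := by positivity
  have hsb : 0 < (s ^ (b : ℕ)) ^ q := by positivity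
  have hm' : ∀ a b, ‖X a b‖ * s ^ (a : ℕ) ≤ m * (s ^ (b : ℕ)) ^ q := fun a b => by
    have := hm (a, b)
    rwa [div_le_iff₀ (by positivity)] at this
  -- The scalar parts are isolated. In the weighted norm the nilpotent parts have size at most `1`,
  -- whereas `|θ^q - θ| = |θ|^q > 1`.
  have e1 : (θ ^ q - θ) * X a b = R a b - (X * N') a b + (N * X) a b := by
    rw [← hX]
    simp only [Matrix.mul_add, Matrix.add_mul, Matrix.add_apply, Matrix.sub_apply, Matrix.mul_smul,
      Matrix.smul_mul, Matrix.mul_one, Matrix.one_mul, Matrix.smul_apply, smul_eq_mul]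
    ring
  have h1 : ‖(X * N') a b‖ ≤ m * (s ^ (b : ℕ)) ^ q / s ^ (a : ℕ) := by
    rw [Matrix.mul_apply]
    refine IsUltrametricDist.norm_sum_le_of_forall_le_of_nonneg (by positivity) fun c _ => ?_
    rw [le_div_iff₀ hsa, norm_mul]
    calc ‖X a c‖ * ‖N' c b‖ * s ^ (a : ℕ) = (‖X a c‖ * s ^ (a : ℕ)) * ‖N' c b‖ := by ring
      _ ≤ m * (s ^ (c : ℕ)) ^ q * ‖N' c b‖ :=
          mul_le_mul_of_nonneg_right (hm' a c) (norm_nonneg _)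
      _ = m * (‖N' c b‖ * (s ^ (c : ℕ)) ^ q) := by ring
      _ ≤ m * (s ^ (b : ℕ)) ^ q := mul_le_mul_of_nonneg_left (hN' c b) hm0
  have h2 : ‖(N * X) a b‖ ≤ m * (s ^ (b : ℕ)) ^ q / s ^ (a : ℕ) := by
    rw [Matrix.mul_apply]
    refine IsUltrametricDist.norm_sum_le_of_forall_le_of_nonneg (by positivity) fun c _ => ?_
    rw [le_div_iff₀ hsa, norm_mul]
    calc ‖N a c‖ * ‖X c b‖ * s ^ (a : ℕ) = (‖N a c‖ * s ^ (a : ℕ)) * ‖X c b‖ := by ring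
      _ ≤ s ^ (c : ℕ) * ‖X c b‖ := mul_le_mul_of_nonneg_right (hN a c) (norm_nonneg _)
      _ = ‖X c b‖ * s ^ (c : ℕ) := mul_comm _ _
      _ ≤ m * (s ^ (b : ℕ)) ^ q := hm' c b
  have h3 : ‖R a b‖ ≤ B * (s ^ (b : ℕ)) ^ q / s ^ (a : ℕ) := by
    rw [le_div_iff₀ hsa, ← div_le_iff₀ hsb]
    exact hR a b
  have hmono : ∀ y, y ≤ max B m → y * (s ^ (b : ℕ)) ^ q / s ^ (a : ℕ) ≤
      max B m * (s ^ (b : ℕ)) ^ q / s ^ (a : ℕ) := fun y hy => by gcongr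
  have h4 : ‖(θ ^ q - θ) * X a b‖ ≤ max B m * (s ^ (b : ℕ)) ^ q / s ^ (a : ℕ) := by
    rw [e1]
    exact norm_add_le_of_le (norm_sub_le_of_le (h3.trans (hmono _ (le_max_left _ _)))
      (h1.trans (hmono _ (le_max_right _ _)))) (h2.trans (hmono _ (le_max_right _ _)))
  rw [norm_mul, norm_pow_sub_self hθ hq, le_div_iff₀ hsa] at h4
  show ‖θ‖ ^ q * (‖X a b‖ * s ^ (a : ℕ) / (s ^ (b : ℕ)) ^ q) ≤ max B m
  rw [← mul_div_assoc, div_le_iff₀ hsb, ← mul_assoc]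
  exact h4

/-- The estimate for the solution of a linear system with nearly scalar coefficients. -/
theorem mulVec_bound (hs : 1 ≤ s) (hθ : 1 < ‖θ‖) {N : Matrix (Fin n) (Fin n) Ω}
    (hN : ∀ a b, ‖N a b‖ * s ^ (a : ℕ) ≤ s ^ (b : ℕ)) {x y : Fin n → Ω}
    (hxy : (θ • 1 + N).mulVec x = y) {B : ℝ} (hB : 0 ≤ B)
    (hy : ∀ a, ‖y a‖ * s ^ (a : ℕ) ≤ B) (a : Fin n) : ‖θ‖ * (‖x a‖ * s ^ (a : ℕ)) ≤ B := by
  have hs0 : 0 < s := by linarith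
  refine mul_le_of_forall_mul_le_max (v := fun a => ‖x a‖ * s ^ (a : ℕ)) (fun p => by positivity)
    hθ hB (fun m hm0 hm a => ?_) a
  have hsa : 0 < s ^ (a : ℕ) := by positivity
  have e1 : θ * x a = y a - N.mulVec x a := by
    rw [← hxy, Matrix.add_mulVec, Matrix.smul_mulVec, Matrix.one_mulVec]
    simp
  have h1 : ‖N.mulVec x a‖ ≤ m / s ^ (a : ℕ) := by
    rw [Matrix.mulVec, dotProduct]
    refine IsUltrametricDist.norm_sum_le_of_forall_le_of_nonneg (by positivity) fun c _ => ?_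
    rw [le_div_iff₀ hsa, norm_mul]
    calc ‖N a c‖ * ‖x c‖ * s ^ (a : ℕ) = (‖N a c‖ * s ^ (a : ℕ)) * ‖x c‖ := by ring
      _ ≤ s ^ (c : ℕ) * ‖x c‖ := mul_le_mul_of_nonneg_right (hN a c) (norm_nonneg _)
      _ = ‖x c‖ * s ^ (c : ℕ) := mul_comm _ _
      _ ≤ m := hm c
  have h2 : ‖y a‖ ≤ B / s ^ (a : ℕ) := by
    rw [le_div_iff₀ hsa]
    exact hy a
  have h4 : ‖θ * x a‖ ≤ max B m / s ^ (a : ℕ) := by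
    rw [e1]
    exact norm_sub_le_of_le (h2.trans (by gcongr; exact le_max_left _ _))
      (h1.trans (by gcongr; exact le_max_right _ _))
  rw [norm_mul, le_div_iff₀ hsa] at h4
  show ‖θ‖ * (‖x a‖ * s ^ (a : ℕ)) ≤ max B m
  rw [← mul_assoc]
  exact h4

/-- Conjugation by `diag(s^a)` divides an entry above the diagonal by at least `s`, so for large `s`
all entries have norm at most `1`. -/
theorem exists_weight (N : Matrix (Fin n) (Fin n) Ω) (hN : ∀ a b, b ≤ a → N a b = 0) :
    ∃ s : ℝ, 1 ≤ s ∧ ∀ a b, ‖N a b‖ * s ^ (a : ℕ) ≤ s ^ (b : ℕ) := by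
  refine ⟨1 + ∑ a, ∑ b, ‖N a b‖, ?_, fun a b => ?_⟩
  · have : 0 ≤ ∑ a, ∑ b, ‖N a b‖ := by positivity
    linarith
  · set s := 1 + ∑ a, ∑ b, ‖N a b‖ with hs
    have h0 : 0 ≤ ∑ a, ∑ b, ‖N a b‖ := by positivity
    have hs1 : 1 ≤ s := by linarith
    rcases le_or_gt b a with h | h
    · rw [hN a b h, norm_zero, zero_mul]
      positivity
    · have h1 : ‖N a b‖ ≤ s := by
        have h2 : ‖N a b‖ ≤ ∑ b, ‖N a b‖ :=
          Finset.single_le_sum (f := fun b => ‖N a b‖) (fun _ _ => norm_nonneg _) (Finset.mem_univ b)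
        have h3 : ∑ b, ‖N a b‖ ≤ ∑ a, ∑ b, ‖N a b‖ :=
          Finset.single_le_sum (f := fun a => ∑ b, ‖N a b‖)
            (fun _ _ => Finset.sum_nonneg fun _ _ => norm_nonneg _) (Finset.mem_univ a)
        linarith
      calc ‖N a b‖ * s ^ (a : ℕ) ≤ s * s ^ (a : ℕ) := by gcongr
        _ = s ^ ((a : ℕ) + 1) := by ring
        _ ≤ s ^ (b : ℕ) := pow_le_pow_right₀ hs1 h

end Weighted

/-! ## Solutions of `T Q = Q D` -/

section Solve

variable {F : Type*} [Field F] [Fintype F] {Ω : Type*} [NormedField Ω] [IsUltrametricDist Ω]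
  [Algebra F Ω] {n : ℕ}

/-- A matrix `θ + N` with `‖θ‖ > 1` and `N` strictly upper triangular. -/
structure IsUpperWithDiag (D : Matrix (Fin n) (Fin n) Ω) (θ : Ω) : Prop where
  one_lt : 1 < ‖θ‖
  diag : ∀ a, D a a = θ
  lower : ∀ a b, b < a → D a b = 0

namespace IsUpperWithDiag

variable {D : Matrix (Fin n) (Fin n) Ω} {θ : Ω}

theorem exists_weight (h : IsUpperWithDiag D θ) :
    ∃ s : ℝ, 1 ≤ s ∧ ∀ a b, ‖(D - θ • 1) a b‖ * s ^ (a : ℕ) ≤ s ^ (b : ℕ) := by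
  refine TensorDrinfeld.exists_weight _ fun a b hab => ?_
  rcases hab.lt_or_eq with hlt | rfl
  · simp [h.lower a b hlt, Matrix.one_apply_ne hlt.ne']
  · simp [h.diag]

theorem frobMat_bound {N : Matrix (Fin n) (Fin n) Ω} {s : ℝ} (hs : 1 ≤ s)
    (hN : ∀ a b, ‖N a b‖ * s ^ (a : ℕ) ≤ s ^ (b : ℕ)) (i : ℕ) (a b : Fin n) :
    ‖frobMat F Ω n i N a b‖ * (s ^ (a : ℕ)) ^ Fintype.card F ^ i ≤
      (s ^ (b : ℕ)) ^ Fintype.card F ^ i := by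
  rw [← twistMat_eq, twistMat, Matrix.map_apply, norm_pow, ← mul_pow]
  exact pow_le_pow_left₀ (by positivity) (hN a b) _

theorem frobMat_eq (D : Matrix (Fin n) (Fin n) Ω) (θ : Ω) (i : ℕ) :
    frobMat F Ω n i D = θ ^ Fintype.card F ^ i • 1 + frobMat F Ω n i (D - θ • 1) := by
  rw [map_sub, add_comm, sub_add_eq_add_sub, eq_comm, sub_eq_iff_eq_add, add_right_inj]
  simp only [← twistMat_eq]
  ext a b
  by_cases hab : a = b
  · subst hab
    simp [twistMat]
  · simp [twistMat, Matrix.one_apply_ne hab]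

theorem bound (h : IsUpperWithDiag D θ) {s : ℝ} (hs : 1 ≤ s)
    (hN : ∀ a b, ‖(D - θ • 1) a b‖ * s ^ (a : ℕ) ≤ s ^ (b : ℕ)) {i : ℕ} (hi : 1 ≤ i)
    {X R : Matrix (Fin n) (Fin n) Ω} (hX : X * frobMat F Ω n i D - D * X = R) {B : ℝ} (hB : 0 ≤ B)
    (hR : ∀ a b, ‖R a b‖ * s ^ (a : ℕ) / (s ^ (b : ℕ)) ^ Fintype.card F ^ i ≤ B) (a b : Fin n) :
    ‖θ‖ ^ Fintype.card F ^ i * (‖X a b‖ * s ^ (a : ℕ) / (s ^ (b : ℕ)) ^ Fintype.card F ^ i) ≤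
      B := by
  refine sylvester_bound hs h.one_lt ?_ hN (frobMat_bound (F := F) hs hN i)
    (N := D - θ • 1) ?_ hB hR a b
  · exact (Fintype.one_lt_card (α := F)).trans_le (Nat.le_self_pow (by omega) _)
  · rw [← frobMat_eq, add_sub_cancel]
    exact hX

theorem sylvester_injective (h : IsUpperWithDiag D θ) {i : ℕ} (hi : 1 ≤ i)
    {X : Matrix (Fin n) (Fin n) Ω} (hX : X * frobMat F Ω n i D - D * X = 0) : X = 0 := by
  obtain ⟨s, hs, hN⟩ := h.exists_weight
  ext a b
  have hb := h.bound (F := F) hs hN hi hX le_rfl (fun a b => by simp) a b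
  have hs0 : 0 < s := by linarith
  have h1 : 0 < ‖θ‖ ^ Fintype.card F ^ i := pow_pos (by linarith [h.one_lt]) _
  have h2 : ‖X a b‖ * s ^ (a : ℕ) / (s ^ (b : ℕ)) ^ Fintype.card F ^ i ≤ 0 := by
    by_contra! hc
    exact absurd (mul_pos h1 hc) (not_lt.mpr hb)
  rw [div_le_iff₀ (by positivity), zero_mul] at h2
  have h3 : ‖X a b‖ ≤ 0 := by
    by_contra! hc
    exact absurd (mul_pos hc (pow_pos hs0 _)) (not_lt.mpr h2)
  simpa using h3

/-- The map is linear in `X`, as only `D` is twisted; on a finite-dimensional space injectivity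
suffices. -/
theorem sylvester_surjective (h : IsUpperWithDiag D θ) {i : ℕ} (hi : 1 ≤ i)
    (R : Matrix (Fin n) (Fin n) Ω) : ∃ X, X * frobMat F Ω n i D - D * X = R := by
  let φ : Matrix (Fin n) (Fin n) Ω →ₗ[Ω] Matrix (Fin n) (Fin n) Ω :=
    LinearMap.mulRight Ω (frobMat F Ω n i D) - LinearMap.mulLeft Ω D
  have hinj : Function.Injective φ := by
    rw [← LinearMap.ker_eq_bot, LinearMap.ker_eq_bot']
    exact fun X hX => h.sylvester_injective (F := F) hi hX
  exact (LinearMap.injective_iff_surjective.mp hinj) R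

end IsUpperWithDiag

/-- The recursive solution of `T Q = Q D`, `Q_0 = 1`, given solutions `S i` of the
Sylvester equations. -/
noncomputable def solveSeries (T : TwistedSeries F Ω n)
    (S : ℕ → Matrix (Fin n) (Fin n) Ω → Matrix (Fin n) (Fin n) Ω) :
    ℕ → Matrix (Fin n) (Fin n) Ω
  | i => if i = 0 then 1 else S i (∑ p ∈ Finset.HasAntidiagonal.antidiagonal i,
      -- The test removes the pair `(0, i)`, whose term `T_0 Q_i` belongs to the left side of the
      -- Sylvester equation, and makes the recursion terminate.
      if _h : p.2 < i then T p.1 * frobMat F Ω n p.1 (solveSeries T S p.2) else 0)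

namespace TwistedSeries

theorem mul_apply_eq_add (T X : TwistedSeries F Ω n) (i : ℕ) :
    (T * X) i = T 0 * X i + ∑ p ∈ Finset.HasAntidiagonal.antidiagonal i,
      if p.2 < i then T p.1 * frobMat F Ω n p.1 (X p.2) else 0 := by
  rw [mul_apply, ← Finset.add_sum_erase _ _ (show (0, i) ∈ Finset.HasAntidiagonal.antidiagonal i by
    simp), ← Finset.add_sum_erase _ (fun p => ite _ _ _) (show (0, i) ∈
      Finset.HasAntidiagonal.antidiagonal i by simp), if_neg (lt_irrefl i), zero_add, frobMat_zero]
  congr 1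
  refine Finset.sum_congr rfl fun p hp => ?_
  rw [Finset.mem_erase, Finset.HasAntidiagonal.mem_antidiagonal] at hp
  have : p.1 ≠ 0 := fun h0 => hp.1 (Prod.ext h0 (by simp; omega))
  rw [if_pos (by omega)]

variable {T : TwistedSeries F Ω n} {θ : Ω}

theorem eq_zero_of_mul_eq (h : IsUpperWithDiag (T 0) θ) {X : TwistedSeries F Ω n} (h0 : X 0 = 0)
    (hX : X * const F (T 0) = T * X) : X = 0 := by
  funext i
  induction i using Nat.strong_induction_on with
  | _ i ih =>
    rcases Nat.eq_zero_or_pos i with rfl | hi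
    · exact h0
    have h1 := congrFun hX i
    rw [mul_const_apply, mul_apply_eq_add, Finset.sum_eq_zero, add_zero] at h1
    · exact h.sylvester_injective (F := F) hi (sub_eq_zero.mpr h1)
    · intro p _
      split_ifs with hp
      · have : X p.2 = 0 := ih _ hp
        rw [this, map_zero, mul_zero]
      · rfl

theorem exists_mul_eq (h : IsUpperWithDiag (T 0) θ) :
    ∃ Q : TwistedSeries F Ω n, Q 0 = 1 ∧ Q * const F (T 0) = T * Q := by
  -- At `i = 0` the Sylvester operator is a commutator and need not be invertible; nothing is asked
  -- there, as `Q_0 = 1` is prescribed.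
  have hS : ∀ (i : ℕ) (R : Matrix (Fin n) (Fin n) Ω), ∃ X, 1 ≤ i →
      X * frobMat F Ω n i (T 0) - T 0 * X = R := fun i R => by
    by_cases hi : 1 ≤ i
    · obtain ⟨X, hX⟩ := h.sylvester_surjective (F := F) hi R
      exact ⟨X, fun _ => hX⟩
    · exact ⟨0, fun h => absurd h hi⟩
  choose S hS using hS
  obtain ⟨Q, h0, hQ⟩ : ∃ Q : TwistedSeries F Ω n, Q 0 = 1 ∧ ∀ i, 1 ≤ i →
      Q i * frobMat F Ω n i (T 0) - T 0 * Q i = ∑ p ∈ Finset.HasAntidiagonal.antidiagonal i,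
        if p.2 < i then T p.1 * frobMat F Ω n p.1 (Q p.2) else 0 := by
    refine ⟨solveSeries T S, by rw [solveSeries, if_pos rfl], fun i hi => ?_⟩
    rw [solveSeries, if_neg (by omega), hS i _ hi]
    simp only [dite_eq_ite]
  refine ⟨Q, h0, ?_⟩
  funext i
  rw [mul_const_apply, mul_apply_eq_add]
  rcases Nat.eq_zero_or_pos i with rfl | hi
  · simp [h0, frobMat_zero]
  · rw [← sub_eq_iff_eq_add', hQ i hi]

/-- A solution of `T Q = Q T_0` intertwines everything that commutes with `T`. -/
theorem mul_eq_of_commute (h : IsUpperWithDiag (T 0) θ) {Q R : TwistedSeries F Ω n}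
    (h0 : Q 0 = 1) (hQ : Q * const F (T 0) = T * Q) (hR : Commute R T) :
    Q * const F (R 0) = R * Q := by
  have hc : T 0 * R 0 = R 0 * T 0 := by
    have := congrArg (constCoeff F Ω n) hR.eq
    rw [map_mul, map_mul] at this
    exact this.symm
  -- The difference has zero constant term and intertwines `T_0` with `T`, so it vanishes by
  -- `eq_zero_of_mul_eq`.
  have h1 : Q * const F (R 0) - R * Q = 0 := by
    refine eq_zero_of_mul_eq h ?_ ?_
    · rw [sub_apply, mul_const_apply, ← constCoeff_apply (R * Q), map_mul, constCoeff_apply,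
        constCoeff_apply, h0, frobMat_zero, one_mul, mul_one, sub_self]
    · rw [sub_mul, mul_sub, mul_assoc, const_mul_const, ← hc, ← const_mul_const, ← mul_assoc,
        hQ, mul_assoc, mul_assoc, hQ, ← mul_assoc, ← mul_assoc, ← mul_assoc, hR.eq]
  exact sub_eq_zero.mp h1

end TwistedSeries

end Solve

/-! ## The exponential series -/

section ExpCoeff

variable {F : Type*} [Field F] [Fintype F] {Ω : Type*} [NormedField Ω] [IsUltrametricDist Ω]
  [DecidableEq Ω] [Algebra F Ω]
  {W : WeierstrassCurve F} {θ η : Ω} {hΞ : (W.baseChange Ω).toAffine.Nonsingular θ η}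
  {V : (W.baseChange Ω).toAffine.Point} {n : ℕ} [NeZero n]
  {f : (W.baseChange Ω).toAffine.FunctionField}
  {g : Fin n → (W.baseChange Ω).toAffine.FunctionField}

theorem isUpperWithDiag_rhoT (hθ : 1 < ‖θ‖) : IsUpperWithDiag (rhoT W f g θ 0) θ := by
  refine ⟨hθ, fun a => by simp [rhoT], fun a b hab => ?_⟩
  have : (b : ℕ) < a := hab
  rw [rhoT, Matrix.of_apply, if_neg (by omega), if_neg (by omega), if_neg (by omega)]

theorem seriesRho_X : seriesRho θ η f g ((X : F[X]) • (1 : W.toAffine.CoordinateRing) +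
    (0 : F[X]) • CoordinateRing.mk W.toAffine X) = seriesT W θ f g := by
  rw [seriesRho_eq, partOne_smul_add_smul, partY_smul_add_smul, aeval_X, map_zero, mul_zero,
    add_zero]

variable (W f g θ η) in
/-- The exponential series in the ring of twisted series. -/
noncomputable def seriesExp : TwistedSeries F Ω n := expCoeff W f g θ η

/-- The chosen series is meaningful once one series works for all `a`. The solution for `ρ_t` alone
does, since every `ρ_a` commutes with `ρ_t`. -/
theorem IsMotiveData.seriesExp_spec (D : IsMotiveData W hΞ V f g) (hθ : 1 < ‖θ‖) :
    seriesExp W θ η f g 0 = 1 ∧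
      seriesExp W θ η f g * TwistedSeries.const F (rhoT W f g θ 0) =
        seriesT W θ f g * seriesExp W θ η f g := by
  have hT : IsUpperWithDiag (seriesT W θ f g 0) θ := isUpperWithDiag_rhoT hθ
  obtain ⟨Q, h0, hQ⟩ := TwistedSeries.exists_mul_eq hT
  have hex : ∃ Q : ℕ → Matrix (Fin n) (Fin n) Ω,
      Q 0 = 1 ∧ ∀ a : W.toAffine.CoordinateRing,
        twMul F Q (Pi.single 0 (rho W f g θ η a 0)) = twMul F (rho W f g θ η a) Q :=
    ⟨Q, h0, fun a => TwistedSeries.mul_eq_of_commute hT h0 hQ (D.commute_seriesRho a)⟩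
  have h := Classical.epsilon_spec hex
  refine ⟨h.1, ?_⟩
  have h2 : seriesExp W θ η f g * TwistedSeries.const F (seriesRho θ η f g ((X : F[X]) • 1 +
      (0 : F[X]) • CoordinateRing.mk W.toAffine X) 0) = seriesRho θ η f g ((X : F[X]) • 1 +
      (0 : F[X]) • CoordinateRing.mk W.toAffine X) * seriesExp W θ η f g := h.2 _
  rw [seriesRho_X] at h2
  exact h2

/-- The recursion for the coefficients of the exponential series. -/
theorem IsMotiveData.expCoeff_spec (D : IsMotiveData W hΞ V f g) (hθ : 1 < ‖θ‖) (i : ℕ) :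
    expCoeff W f g θ η i * frobMat F Ω n i (rhoT W f g θ 0) -
        rhoT W f g θ 0 * expCoeff W f g θ η i =
      ∑ p ∈ Finset.HasAntidiagonal.antidiagonal i,
        if p.2 < i then rhoT W f g θ p.1 * frobMat F Ω n p.1 (expCoeff W f g θ η p.2) else 0 := by
  have h := congrFun (D.seriesExp_spec (η := η) hθ).2 i
  rw [TwistedSeries.mul_const_apply, TwistedSeries.mul_apply_eq_add] at h
  exact sub_eq_iff_eq_add'.mpr h

end ExpCoeff

end TensorDrinfeld
namespace TensorDrinfeld

/-! ## Growth of the exponential series -/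

section Growth

variable {F : Type*} [Field F] [Fintype F] {Ω : Type*} [NormedField Ω] [IsUltrametricDist Ω]
  [Algebra F Ω] {n : ℕ}

/-- Solving the Sylvester equation gains a factor `|θ|^{-q^i} = q^{-2q^i}`. The right side involves
`Q_{i-1}` and `Q_{i-2}` only, and replacing `q^{-(i-2)}` by `q^{-i}` inside the `q^i`-th power costs
exactly this factor. Columns carry the twisted weight, with exponent `q^i`. -/
theorem IsUpperWithDiag.exists_growth {T : TwistedSeries F Ω n} {θ : Ω}
    (h : IsUpperWithDiag (T 0) θ) (hθ : ‖θ‖ = (Fintype.card F : ℝ) ^ 2)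
    (hT : ∀ j, 3 ≤ j → T j = 0) {Q : ℕ → Matrix (Fin n) (Fin n) Ω} (h0 : Q 0 = 1)
    (hQ : ∀ i, Q i * frobMat F Ω n i (T 0) - T 0 * Q i =
      ∑ p ∈ Finset.HasAntidiagonal.antidiagonal i,
        if p.2 < i then T p.1 * frobMat F Ω n p.1 (Q p.2) else 0) :
    ∃ K : ℝ, 1 ≤ K ∧ ∀ i a b, ‖Q i a b‖ ≤ (K / Fintype.card F ^ i) ^ Fintype.card F ^ i := by
  obtain ⟨s, hs, hN⟩ := h.exists_weight
  have hs0 : 0 < s := by linarith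
  set q : ℕ := Fintype.card F with hq
  have hq1 : 1 < q := Fintype.one_lt_card
  have hqR : (1 : ℝ) < q := by exact_mod_cast hq1
  have hqR0 : (0 : ℝ) < q := by linarith
  obtain ⟨β, hβ1, hβ⟩ : ∃ β : ℝ, 1 ≤ β ∧ ∀ j a c, j < 3 → ‖T j a c‖ * s ^ (a : ℕ) ≤ β := by
    refine ⟨1 + ∑ j ∈ Finset.range 3, ∑ a, ∑ c, ‖T j a c‖ * s ^ (a : ℕ), ?_, fun j a c hj => ?_⟩
    · have : 0 ≤ ∑ j ∈ Finset.range 3, ∑ a, ∑ c, ‖T j a c‖ * s ^ (a : ℕ) := by positivity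
      linarith
    · have h1 : ‖T j a c‖ * s ^ (a : ℕ) ≤ ∑ c, ‖T j a c‖ * s ^ (a : ℕ) :=
        Finset.single_le_sum (f := fun c => ‖T j a c‖ * s ^ (a : ℕ)) (fun _ _ => by positivity)
          (Finset.mem_univ c)
      have h2 : ∑ c, ‖T j a c‖ * s ^ (a : ℕ) ≤ ∑ a, ∑ c, ‖T j a c‖ * s ^ (a : ℕ) :=
        Finset.single_le_sum (f := fun a => ∑ c, ‖T j a c‖ * s ^ (a : ℕ))
          (fun _ _ => by positivity) (Finset.mem_univ a)
      have h3 : ∑ a, ∑ c, ‖T j a c‖ * s ^ (a : ℕ) ≤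
          ∑ j ∈ Finset.range 3, ∑ a, ∑ c, ‖T j a c‖ * s ^ (a : ℕ) :=
        Finset.single_le_sum (f := fun j => ∑ a, ∑ c, ‖T j a c‖ * s ^ (a : ℕ))
          (fun _ _ => by positivity) (Finset.mem_range.mpr hj)
      linarith
  have hβ0 : 0 < β := by linarith
  -- The extra factor `β` makes the induction close: after raising to the power `q^j ≥ 2` it yields
  -- `β²`, one factor of which pays for the size of `T_j`.
  have claim : ∀ i a b, β * (‖Q i a b‖ * s ^ (a : ℕ) / (s ^ (b : ℕ)) ^ q ^ i) ≤
      (β / q ^ i) ^ q ^ i := by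
    intro i
    induction i using Nat.strong_induction_on with
    | _ i ih =>
      intro a b
      rcases Nat.eq_zero_or_pos i with rfl | hi
      · rw [h0]
        by_cases hab : a = b
        · subst hab
          have : s ^ (a : ℕ) ≠ 0 := by positivity
          simp [this]
        · simp only [Matrix.one_apply_ne hab, norm_zero, zero_mul, zero_div, mul_zero]
          positivity
      set y : ℝ := (β / q ^ i * ‖θ‖) ^ q ^ i with hy
      have hR : ∀ a b, ‖(∑ p ∈ Finset.HasAntidiagonal.antidiagonal i,
          if p.2 < i then T p.1 * frobMat F Ω n p.1 (Q p.2) else 0) a b‖ * s ^ (a : ℕ) /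
          (s ^ (b : ℕ)) ^ q ^ i ≤ y / β := by
        intro a b
        rw [div_le_iff₀ (by positivity), ← le_div_iff₀ (by positivity), Matrix.sum_apply]
        refine IsUltrametricDist.norm_sum_le_of_forall_le_of_nonneg (by positivity) fun p hp => ?_
        rw [Finset.HasAntidiagonal.mem_antidiagonal] at hp
        split_ifs with hpi
        swap
        · rw [Matrix.zero_apply, norm_zero]
          positivity
        rcases le_or_gt 3 p.1 with h3 | h3
        · rw [hT _ h3, zero_mul, Matrix.zero_apply, norm_zero]
          positivity
        rw [Matrix.mul_apply]
        refine IsUltrametricDist.norm_sum_le_of_forall_le_of_nonneg (by positivity) fun c _ => ?_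
        rw [le_div_iff₀ (by positivity), ← twistMat_eq, twistMat, Matrix.map_apply, norm_mul,
          norm_pow]
        have hc := ih p.2 hpi c b
        rw [← mul_div_assoc, div_le_iff₀ (by positivity), mul_comm β, ← le_div_iff₀ hβ0] at hc
        have hle : ‖Q p.2 c b‖ ≤ (β / q ^ p.2) ^ q ^ p.2 * (s ^ (b : ℕ)) ^ q ^ p.2 / β :=
          (le_mul_of_one_le_right (norm_nonneg _) (one_le_pow₀ hs)).trans hc
        have hqq : q ^ p.2 * q ^ p.1 = q ^ i := by rw [← pow_add, add_comm, hp]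
        -- This uses `q^j ≤ q² = |θ|`, that is, the degree at most `2` of `T`.
        have hkey : β / q ^ p.2 ≤ β / q ^ i * ‖θ‖ := by
          rw [hθ, ← hp, pow_add, div_mul_eq_mul_div, div_le_div_iff₀ (by positivity)
            (by positivity)]
          have : (q : ℝ) ^ p.1 ≤ q ^ 2 := pow_le_pow_right₀ hqR.le (by omega)
          calc β * (q ^ p.1 * q ^ p.2) = β * q ^ p.1 * q ^ p.2 := by ring
            _ ≤ β * q ^ 2 * q ^ p.2 := by gcongr
        have hβp : β ^ 2 ≤ β ^ q ^ p.1 := by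
          refine pow_le_pow_right₀ hβ1 ?_
          calc 2 ≤ q := hq1
            _ ≤ q ^ p.1 := Nat.le_self_pow (by omega) _
        calc ‖T p.1 a c‖ * ‖Q p.2 c b‖ ^ q ^ p.1 * s ^ (a : ℕ)
            = (‖T p.1 a c‖ * s ^ (a : ℕ)) * ‖Q p.2 c b‖ ^ q ^ p.1 := by ring
          _ ≤ β * ((β / q ^ p.2) ^ q ^ p.2 * (s ^ (b : ℕ)) ^ q ^ p.2 / β) ^ q ^ p.1 := by
              gcongr
              exact hβ _ _ _ h3
          _ = β * ((β / q ^ p.2) ^ q ^ i * (s ^ (b : ℕ)) ^ q ^ i / β ^ q ^ p.1) := by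
              rw [div_pow, mul_pow, ← pow_mul (β / _), ← pow_mul (s ^ (b : ℕ)), hqq]
          _ ≤ β * (y * (s ^ (b : ℕ)) ^ q ^ i / β ^ 2) := by
              rw [hy]
              gcongr
          _ = y / β * (s ^ (b : ℕ)) ^ q ^ i := by field_simp
      have hb := h.bound (F := F) hs hN hi (hQ i) (by positivity) hR a b
      rw [le_div_iff₀ hβ0, hy, mul_pow, mul_assoc, mul_comm] at hb
      have hθ0 : 0 < ‖θ‖ ^ q ^ i := pow_pos (by linarith [h.one_lt]) _
      rw [mul_comm]
      exact le_of_mul_le_mul_right hb hθ0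
  refine ⟨β * s ^ n, one_le_mul_of_one_le_of_one_le hβ1 (one_le_pow₀ hs), fun i a b => ?_⟩
  have hc := claim i a b
  rw [← mul_div_assoc, div_le_iff₀ (by positivity)] at hc
  calc ‖Q i a b‖ ≤ β * (‖Q i a b‖ * s ^ (a : ℕ)) := by
        have h1 : ‖Q i a b‖ ≤ ‖Q i a b‖ * s ^ (a : ℕ) :=
          le_mul_of_one_le_right (norm_nonneg _) (one_le_pow₀ hs)
        exact h1.trans (le_mul_of_one_le_left (by positivity) hβ1)
    _ ≤ (β / q ^ i) ^ q ^ i * (s ^ (b : ℕ)) ^ q ^ i := hc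
    _ ≤ (β / q ^ i) ^ q ^ i * (s ^ n) ^ q ^ i := by
        gcongr
        exact b.isLt.le
    _ = (β * s ^ n / q ^ i) ^ q ^ i := by rw [← mul_pow]; ring

theorem tendsto_growth (K : ℝ) (hK : 0 ≤ K) {q : ℕ} (hq : 1 < q) :
    Filter.Tendsto (fun i : ℕ => (K / (q : ℝ) ^ i) ^ q ^ i) Filter.atTop (nhds 0) := by
  have hqR : (1 : ℝ) < q := by exact_mod_cast hq
  have h1 : Filter.Tendsto (fun i : ℕ => K / (q : ℝ) ^ i) Filter.atTop (nhds 0) :=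
    tendsto_const_nhds.div_atTop (tendsto_pow_atTop_atTop_of_one_lt hqR)
  have h2 : ∀ᶠ i : ℕ in Filter.atTop, (K / (q : ℝ) ^ i) ^ q ^ i ≤ (1 / 2 : ℝ) ^ i := by
    filter_upwards [h1.eventually (gt_mem_nhds (show (0 : ℝ) < 1 / 2 by norm_num))] with i hi
    calc (K / (q : ℝ) ^ i) ^ q ^ i ≤ (1 / 2 : ℝ) ^ q ^ i := by gcongr
      _ ≤ (1 / 2 : ℝ) ^ i :=
        pow_le_pow_of_le_one (by norm_num) (by norm_num) (Nat.lt_pow_self hq).le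
  exact squeeze_zero' (Filter.Eventually.of_forall fun i => by positivity) h2
    (tendsto_pow_atTop_nhds_zero_of_lt_one (by norm_num) (by norm_num))

end Growth

section Exponential

variable {F : Type*} [Field F] [Fintype F] {Ω : Type*} [NormedField Ω] [IsUltrametricDist Ω]
  [CompleteSpace Ω] [DecidableEq Ω] [Algebra F Ω]
  {W : WeierstrassCurve F} {θ η : Ω} {hΞ : (W.baseChange Ω).toAffine.Nonsingular θ η}
  {V : (W.baseChange Ω).toAffine.Point} {n : ℕ} [NeZero n]
  {f : (W.baseChange Ω).toAffine.FunctionField}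
  {g : Fin n → (W.baseChange Ω).toAffine.FunctionField}

variable (W f g θ η) in
/-- The coefficients of the exponential series decrease like those of an entire function. -/
def HasGrowth (K : ℝ) : Prop := 1 ≤ K ∧ ∀ i a b,
  ‖expCoeff W f g θ η i a b‖ ≤ (K / Fintype.card F ^ i) ^ Fintype.card F ^ i

theorem IsMotiveData.exists_hasGrowth (D : IsMotiveData W hΞ V f g)
    (hθ : ‖θ‖ = (Fintype.card F : ℝ) ^ 2) : ∃ K, HasGrowth W θ η f g K := by
  have hθ1 : 1 < ‖θ‖ := by
    rw [hθ]
    exact one_lt_pow₀ (by exact_mod_cast Fintype.one_lt_card) two_ne_zero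
  have hT : IsUpperWithDiag (seriesT W θ f g 0) θ := isUpperWithDiag_rhoT hθ1
  exact hT.exists_growth hθ (fun j hj => IsMotiveData.rhoT_eq_zero hj)
    (D.seriesExp_spec (η := η) hθ1).1 (D.expCoeff_spec hθ1)

namespace HasGrowth

variable {K : ℝ}

theorem norm_expTerm_le (hK : HasGrowth W θ η f g K) {z : Fin n → Ω} {ρ : ℝ} (hρ : 0 ≤ ρ)
    (hz : ∀ c, ‖z c‖ ≤ ρ) (i : ℕ) (k : Fin n) :
    ‖expTerm W f g θ η z i k‖ ≤
      (K / Fintype.card F ^ i) ^ Fintype.card F ^ i * ρ ^ Fintype.card F ^ i := by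
  have hK0 : 0 ≤ K := zero_le_one.trans hK.1
  rw [expTerm, Matrix.mulVec, dotProduct]
  refine IsUltrametricDist.norm_sum_le_of_forall_le_of_nonneg (by positivity) fun c _ => ?_
  rw [norm_mul, norm_pow]
  exact mul_le_mul (hK.2 i k c) (pow_le_pow_left₀ (norm_nonneg _) (hz c) _) (by positivity)
    (by positivity)

theorem summable_expTerm (hK : HasGrowth W θ η f g K) (z : Fin n → Ω) (k : Fin n) :
    Summable fun i => expTerm W f g θ η z i k := by
  refine NonarchimedeanAddGroup.summable_of_tendsto_cofinite_zero ?_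
  rw [Nat.cofinite_eq_atTop]
  have hK0 : 0 ≤ K := zero_le_one.trans hK.1
  have hz : ∀ c, ‖z c‖ ≤ ∑ c, ‖z c‖ := fun c =>
    Finset.single_le_sum (f := fun c => ‖z c‖) (fun _ _ => norm_nonneg _) (Finset.mem_univ c)
  have hρ : 0 ≤ ∑ c, ‖z c‖ := by positivity
  refine squeeze_zero_norm (fun i => hK.norm_expTerm_le hρ hz i k) ?_
  refine (tendsto_growth (K * ∑ c, ‖z c‖) (by positivity)
    (Fintype.one_lt_card (α := F))).congr fun i => ?_
  rw [← mul_pow]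
  ring

end HasGrowth

variable (W f g θ η) in
/-- The tail `∑_{i ≥ J} Q_i z^{(i)}` of the exponential series. -/
noncomputable def expTail (J : ℕ) (z : Fin n → Ω) (k : Fin n) : Ω :=
  ∑' i, expTerm W f g θ η z (i + J) k

namespace HasGrowth

variable {K : ℝ}

theorem expFun_eq (hK : HasGrowth W θ η f g K) (J : ℕ) (z : Fin n → Ω) (k : Fin n) :
    expFun W f g θ η z k = ∑ i ∈ Finset.range J, expTerm W f g θ η z i k +
      expTail W θ η f g J z k :=
  ((hK.summable_expTerm z k).sum_add_tsum_nat_add J).symm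

/-- The coefficients are bounded, and for arguments of norm at most `1` the first term of the tail
has the smallest exponent, `q^J`. -/
theorem exists_norm_expTail_le (hK : HasGrowth W θ η f g K) : ∃ M : ℝ, 0 ≤ M ∧
    ∀ (J : ℕ) (z : Fin n → Ω) (ρ : ℝ), 0 ≤ ρ → ρ ≤ 1 → (∀ c, ‖z c‖ ≤ ρ) → ∀ k,
      ‖expTail W θ η f g J z k‖ ≤ M * ρ ^ Fintype.card F ^ J := by
  have hK0 : 0 ≤ K := zero_le_one.trans hK.1
  have hq := Fintype.one_lt_card (α := F)
  obtain ⟨M, hM⟩ := (tendsto_growth K hK0 hq).bddAbove_range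
  have hM' : ∀ i : ℕ, (K / (Fintype.card F : ℝ) ^ i) ^ Fintype.card F ^ i ≤ M := fun i =>
    hM ⟨i, rfl⟩
  have hM0 : 0 ≤ M := le_trans (by positivity) (hM' 0)
  refine ⟨M, hM0, fun J z ρ hρ hρ1 hz k => ?_⟩
  refine IsUltrametricDist.norm_tsum_le_of_forall_le_of_nonneg (by positivity) fun i => ?_
  refine (hK.norm_expTerm_le hρ hz (i + J) k).trans ?_
  exact mul_le_mul (hM' _) (pow_le_pow_of_le_one hρ hρ1 (Nat.pow_le_pow_right (by omega)
    (by omega))) (by positivity) hM0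

end HasGrowth

end Exponential

end TensorDrinfeld
namespace TensorDrinfeld

/-! ## The meromorphic continuation of Anderson generating functions -/

section CharMat

variable {Ω : Type*} [NormedField Ω] {n : ℕ}

/-- The matrix `M - t` over the power series ring in `t`. -/
noncomputable def charMat (M : Matrix (Fin n) (Fin n) Ω) :
    Matrix (Fin n) (Fin n) (PowerSeries Ω) :=
  (PowerSeries.C (R := Ω)).mapMatrix M - (PowerSeries.X : PowerSeries Ω) • 1

theorem charMat_apply (M : Matrix (Fin n) (Fin n) Ω) (a b : Fin n) :
    charMat M a b = PowerSeries.C (M a b) - if a = b then PowerSeries.X else 0 := by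
  simp [charMat, Matrix.one_apply]

theorem det_charMat {M : Matrix (Fin n) (Fin n) Ω} {θ : Ω} (hd : ∀ a, M a a = θ)
    (hl : ∀ a b, b < a → M a b = 0) :
    (charMat M).det = (PowerSeries.C θ - PowerSeries.X) ^ n := by
  rw [Matrix.det_of_isUpperTriangular]
  · simp [charMat_apply, hd]
  · intro a b hab
    have : b < a := hab
    simp [charMat_apply, hl a b this, this.ne']

theorem C_sub_X_ne_zero (θ : Ω) : (PowerSeries.C θ - PowerSeries.X : PowerSeries Ω) ≠ 0 := by
  intro h
  have := congrArg (PowerSeries.coeff 1) h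
  simp at this

variable [IsUltrametricDist Ω]

variable (Ω) in
/-- The ring of power series that converge for `|t| ≤ r`. -/
noncomputable def restricted (r : ℝ) : Subring (PowerSeries Ω) := PowerSeries.IsRestricted.subring r

theorem C_mem_restricted (r : ℝ) (c : Ω) : PowerSeries.C c ∈ restricted Ω r :=
  PowerSeries.isRestricted_C r c

theorem X_mem_restricted (r : ℝ) : PowerSeries.X ∈ restricted Ω r :=
  PowerSeries.isRestricted_monomial r 1 1

theorem charMat_mem_restricted (r : ℝ) (M : Matrix (Fin n) (Fin n) Ω) (a b : Fin n) :
    charMat M a b ∈ restricted Ω r := by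
  rw [charMat_apply]
  refine sub_mem (C_mem_restricted r _) ?_
  split_ifs
  · exact X_mem_restricted r
  · exact zero_mem _

/-- Determinant and adjugate are polynomial in the entries, so they can be computed inside the
subring. -/
theorem det_adjugate_mem {R : Type*} [CommRing R] (S : Subring R)
    {M : Matrix (Fin n) (Fin n) R} (hM : ∀ a b, M a b ∈ S) :
    M.det ∈ S ∧ ∀ a b, M.adjugate a b ∈ S := by
  let M' : Matrix (Fin n) (Fin n) S := Matrix.of fun a b => ⟨M a b, hM a b⟩
  have h : M = S.subtype.mapMatrix M' := rfl
  rw [h, ← RingHom.map_det, ← RingHom.map_adjugate]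
  exact ⟨M'.det.2, fun a b => (M'.adjugate a b).2⟩

theorem det_charMat_mem_restricted (r : ℝ) (M : Matrix (Fin n) (Fin n) Ω) :
    (charMat M).det ∈ restricted Ω r :=
  (det_adjugate_mem _ (charMat_mem_restricted r M)).1

theorem adjugate_charMat_mem_restricted (r : ℝ) (M : Matrix (Fin n) (Fin n) Ω) (a b : Fin n) :
    (charMat M).adjugate a b ∈ restricted Ω r :=
  (det_adjugate_mem _ (charMat_mem_restricted r M)).2 a b

end CharMat

/-! ### Resolvents of the twisted matrices. -/

section GeomSeries

variable {F : Type*} [Field F] [Fintype F] {Ω : Type*} [NormedField Ω] [IsUltrametricDist Ω]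
  [Algebra F Ω] {n : ℕ} {D : Matrix (Fin n) (Fin n) Ω} {θ : Ω}

theorem IsUpperWithDiag.isUnit_det (h : IsUpperWithDiag D θ) : IsUnit D.det := by
  rw [Matrix.det_of_isUpperTriangular]
  · have : θ ≠ 0 := norm_pos_iff.mp (by linarith [h.one_lt])
    simp [h.diag, this]
  · exact fun a b hab => h.lower a b hab

theorem IsUpperWithDiag.mulVec_inv_pow (h : IsUpperWithDiag D θ) (u : Fin n → Ω) (i : ℕ) :
    D.mulVec ((D⁻¹ ^ (i + 1)).mulVec u) = (D⁻¹ ^ i).mulVec u := by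
  rw [Matrix.mulVec_mulVec, pow_succ', ← mul_assoc, Matrix.mul_nonsing_inv _ h.isUnit_det, one_mul]

/-- In the weighted norm each application of `D⁻¹` shrinks a vector by `|θ|`; the weights, at least
`1`, are dropped only at the end. -/
theorem IsUpperWithDiag.norm_inv_pow_le (h : IsUpperWithDiag D θ) (u : Fin n → Ω) :
    ∃ U : ℝ, 0 ≤ U ∧ ∀ i c, ‖(D⁻¹ ^ i).mulVec u c‖ ≤ U / ‖θ‖ ^ i := by
  obtain ⟨s, hs, hN⟩ := h.exists_weight
  have hθ0 : 0 < ‖θ‖ := by linarith [h.one_lt]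
  refine ⟨∑ c, ‖u c‖ * s ^ (c : ℕ), by positivity, fun i c => ?_⟩
  have key : ∀ i c, ‖(D⁻¹ ^ i).mulVec u c‖ * s ^ (c : ℕ) ≤
      (∑ c, ‖u c‖ * s ^ (c : ℕ)) / ‖θ‖ ^ i := by
    intro i
    induction i with
    | zero =>
      intro c
      rw [pow_zero, pow_zero, Matrix.one_mulVec, div_one]
      exact Finset.single_le_sum (f := fun c : Fin n => ‖u c‖ * s ^ (c : ℕ))
        (fun _ _ => by positivity) (Finset.mem_univ c)
    | succ i ih =>
      intro c
      have := mulVec_bound hs h.one_lt hN (x := (D⁻¹ ^ (i + 1)).mulVec u)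
        (y := (D⁻¹ ^ i).mulVec u) (by rw [add_sub_cancel]; exact h.mulVec_inv_pow u i)
        (by positivity) ih c
      rw [pow_succ ‖θ‖, ← div_div, le_div_iff₀ hθ0, mul_comm]
      exact this
  exact (le_mul_of_one_le_right (norm_nonneg _) (one_le_pow₀ hs)).trans (key i c)

variable (F) in
/-- The power series `∑ (D^{-i-1} u)^{(j)} t^i`. -/
noncomputable def geomSeries (D : Matrix (Fin n) (Fin n) Ω) (u : Fin n → Ω) (j : ℕ) (c : Fin n) :
    PowerSeries Ω :=
  PowerSeries.mk fun i => ((D⁻¹ ^ (i + 1)).mulVec u c) ^ Fintype.card F ^ j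

/-- The geometric series telescopes, so `geomSeries` is `(D^{(j)} - t)⁻¹ u^{(j)}`. By Cramer's rule
it becomes polynomial after multiplication by `(θ^{q^j} - t)^n`. -/
theorem charMat_mulVec_geomSeries (h : IsUpperWithDiag D θ) (u : Fin n → Ω) (j : ℕ) :
    (charMat (frobMat F Ω n j D)).mulVec (geomSeries F D u j) =
      fun c => PowerSeries.C (u c ^ Fintype.card F ^ j) := by
  have hfrob : ∀ (v : Fin n → Ω) (c : Fin n),
      ∑ b, frobMat F Ω n j D c b * v b ^ Fintype.card F ^ j =
        (D.mulVec v c) ^ Fintype.card F ^ j := by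
    intro v c
    simp only [← frobeniusAlgHom_pow_apply (F := F), Matrix.mulVec, dotProduct, map_sum, map_mul]
    rfl
  funext c
  have e : (charMat (frobMat F Ω n j D)).mulVec (geomSeries F D u j) c =
      ∑ b, PowerSeries.C (frobMat F Ω n j D c b) * geomSeries F D u j b -
        PowerSeries.X * geomSeries F D u j c := by
    simp only [Matrix.mulVec, dotProduct, charMat_apply, sub_mul, Finset.sum_sub_distrib, ite_mul,
      zero_mul, Finset.sum_ite_eq, Finset.mem_univ, if_true]
  rw [e]
  ext m
  rw [map_sub, map_sum]
  simp only [PowerSeries.coeff_C_mul]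
  have e2 : ∀ b, PowerSeries.coeff m (geomSeries F D u j b) =
      ((D⁻¹ ^ (m + 1)).mulVec u b) ^ Fintype.card F ^ j := fun b => PowerSeries.coeff_mk _ _
  simp only [e2]
  rw [hfrob, h.mulVec_inv_pow]
  cases m with
  | zero => simp
  | succ m =>
    rw [PowerSeries.coeff_succ_X_mul, PowerSeries.coeff_C, if_neg (Nat.succ_ne_zero m),
      geomSeries, PowerSeries.coeff_mk, sub_self]

theorem det_charMat_frobMat (h : IsUpperWithDiag D θ) (j : ℕ) :
    (charMat (frobMat F Ω n j D)).det =
      (PowerSeries.C (θ ^ Fintype.card F ^ j) - PowerSeries.X) ^ n := by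
  refine det_charMat (fun a => ?_) (fun a b hab => ?_)
  · rw [← twistMat_eq, twistMat, Matrix.map_apply, h.diag]
  · rw [← twistMat_eq, twistMat, Matrix.map_apply, h.lower a b hab, zero_pow]
    exact pow_ne_zero _ Fintype.card_ne_zero

theorem det_smul_geomSeries (h : IsUpperWithDiag D θ) (u : Fin n → Ω) (j : ℕ) :
    (charMat (frobMat F Ω n j D)).det • geomSeries F D u j =
      (charMat (frobMat F Ω n j D)).adjugate.mulVec
        fun c => PowerSeries.C (u c ^ Fintype.card F ^ j) := by
  rw [← charMat_mulVec_geomSeries h, Matrix.mulVec_mulVec, Matrix.adjugate_mul, Matrix.smul_mulVec,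
    Matrix.one_mulVec]

theorem isRestricted_det_mul_geomSeries (h : IsUpperWithDiag D θ) (u : Fin n → Ω) (j : ℕ)
    (r : ℝ) (c : Fin n) : PowerSeries.IsRestricted r
      ((charMat (frobMat F Ω n j D)).det * geomSeries F D u j c) := by
  have h1 := congrFun (det_smul_geomSeries (F := F) h u j) c
  rw [Pi.smul_apply, smul_eq_mul] at h1
  rw [h1, Matrix.mulVec, dotProduct]
  change _ ∈ restricted Ω r
  refine sum_mem
    fun b _ => mul_mem (adjugate_charMat_mem_restricted r _ _ _) (C_mem_restricted r _)

end GeomSeries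

/-! ### Denominators and continuation of `E_u` and `G_u`. -/

section AndersonE

variable {F : Type*} [Field F] [Fintype F] {Ω : Type*} [NormedField Ω] [IsUltrametricDist Ω]
  [CompleteSpace Ω] [DecidableEq Ω] [Algebra F Ω]
  {W : WeierstrassCurve F} {θ η : Ω} {n : ℕ} [NeZero n]
  {f : (W.baseChange Ω).toAffine.FunctionField}
  {g : Fin n → (W.baseChange Ω).toAffine.FunctionField}

variable (W f g θ η) in
/-- The part of `E_u` coming from the terms of index at least `J` of the exponential series. -/
noncomputable def andersonTail (J : ℕ) (u : Fin n → Ω) (k : Fin n) : PowerSeries Ω :=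
  PowerSeries.mk fun i =>
    expTail W θ η f g J ((((rhoT W f g θ 0)⁻¹) ^ (i + 1)).mulVec u) k

namespace HasGrowth

variable {K : ℝ}

/-- Splitting the exponential at `J` splits `E_u` into `J` rational summands and a tail with a large
disk of convergence. -/
theorem andersonE_eq (hK : HasGrowth W θ η f g K) (J : ℕ) (u : Fin n → Ω) (k : Fin n) :
    andersonE W f g θ η u k = ∑ j ∈ Finset.range J, ∑ c,
      PowerSeries.C (expCoeff W f g θ η j k c) * geomSeries F (rhoT W f g θ 0) u j c +
        andersonTail W θ η f g J u k := by
  ext i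
  simp only [map_add, map_sum, PowerSeries.coeff_C_mul]
  rw [andersonE, andersonTail, PowerSeries.coeff_mk, PowerSeries.coeff_mk, hK.expFun_eq J]
  congr 1
  refine Finset.sum_congr rfl fun j _ => ?_
  rw [expTerm, Matrix.mulVec, dotProduct]
  simp only [geomSeries, PowerSeries.coeff_mk]

/-- The argument `D^{-i-1} u` has size `O(|θ|^{-i})`, hence norm at most `1` for large `i`. The tail
raises it at least to the power `q^J`, so the `i`-th coefficient is `O(|θ|^{-i q^J})`. -/
theorem isRestricted_andersonTail (hK : HasGrowth W θ η f g K) (hθ : 1 < ‖θ‖) (J : ℕ)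
    (u : Fin n → Ω) (k : Fin n) {r : ℝ} (hr : 0 ≤ r) (hrJ : r < ‖θ‖ ^ Fintype.card F ^ J) :
    PowerSeries.IsRestricted r (andersonTail W θ η f g J u k) := by
  obtain ⟨M, hM0, hM⟩ := hK.exists_norm_expTail_le
  obtain ⟨U, hU0, hU⟩ := (isUpperWithDiag_rhoT (f := f) (g := g) (W := W) hθ).norm_inv_pow_le u
  have hθ0 : 0 < ‖θ‖ := by linarith
  set Q := Fintype.card F ^ J with hQ
  rw [PowerSeries.isRestricted_iff']
  have hlim : Filter.Tendsto (fun i : ℕ => U / ‖θ‖ ^ (i + 1)) Filter.atTop (nhds 0) :=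
    tendsto_const_nhds.div_atTop
      ((tendsto_pow_atTop_atTop_of_one_lt hθ).comp (Filter.tendsto_add_atTop_nat 1))
  have hev : ∀ᶠ i : ℕ in Filter.atTop,
      ‖PowerSeries.coeff i (andersonTail W θ η f g J u k)‖ * r ^ i ≤
        M * (U / ‖θ‖) ^ Q * (r / ‖θ‖ ^ Q) ^ i := by
    filter_upwards [hlim.eventually (ge_mem_nhds zero_lt_one)] with i hi
    rw [andersonTail, PowerSeries.coeff_mk]
    have := hM J _ _ (by positivity) hi (hU (i + 1)) k
    calc _ ≤ M * (U / ‖θ‖ ^ (i + 1)) ^ Q * r ^ i := by gcongr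
      _ = M * (U / ‖θ‖) ^ Q * (r / ‖θ‖ ^ Q) ^ i := by
        rw [pow_succ, div_pow, div_pow, div_pow, mul_pow, ← pow_mul, ← pow_mul, mul_comm i Q]
        field_simp
  refine squeeze_zero' (Filter.Eventually.of_forall fun i => by positivity) hev ?_
  have : r / ‖θ‖ ^ Q < 1 := (div_lt_one (by positivity)).mpr hrJ
  simpa using (tendsto_pow_atTop_nhds_zero_of_lt_one (by positivity) this).const_mul
    (M * (U / ‖θ‖) ^ Q)

variable (W f g θ) in
/-- The common denominator `∏_{j < J} det (d[θ]^{(j)} - t)`. -/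
noncomputable def _root_.TensorDrinfeld.andersonDenom (J : ℕ) : PowerSeries Ω :=
  ∏ j ∈ Finset.range J, (charMat (frobMat F Ω n j (rhoT W f g θ 0))).det

theorem _root_.TensorDrinfeld.andersonDenom_ne_zero (hθ : 1 < ‖θ‖) (J : ℕ) :
    andersonDenom W θ f g J ≠ 0 := by
  refine Finset.prod_ne_zero_iff.mpr fun j _ => ?_
  rw [det_charMat_frobMat (isUpperWithDiag_rhoT hθ)]
  exact pow_ne_zero _ (C_sub_X_ne_zero _)

theorem _root_.TensorDrinfeld.isRestricted_andersonDenom (J : ℕ) (r : ℝ) :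
    PowerSeries.IsRestricted r (andersonDenom W θ f g J) := by
  change _ ∈ restricted Ω r
  refine prod_mem fun j _ => ?_
  exact det_charMat_mem_restricted r _

theorem isRestricted_andersonE (hK : HasGrowth W θ η f g K) (hθ : 1 < ‖θ‖) (J : ℕ)
    (u : Fin n → Ω) (k : Fin n) {r : ℝ} (hr : 0 ≤ r) (hrJ : r < ‖θ‖ ^ Fintype.card F ^ J) :
    PowerSeries.IsRestricted r (andersonDenom W θ f g J * andersonE W f g θ η u k) := by
  rw [hK.andersonE_eq J, mul_add, Finset.mul_sum]
  change _ ∈ restricted Ω r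
  refine add_mem ?_ ?_
  · refine sum_mem fun j hj => ?_
    rw [Finset.mul_sum]
    refine sum_mem fun c _ => ?_
    rw [andersonDenom, ← Finset.mul_prod_erase _ _ hj]
    have e : ∀ a b x y : PowerSeries Ω, a * b * (x * y) = b * x * (a * y) := fun a b x y => by ring
    rw [e]
    refine mul_mem (mul_mem (prod_mem fun i _ => ?_) (C_mem_restricted r _))
      (isRestricted_det_mul_geomSeries (isUpperWithDiag_rhoT hθ) u j r c)
    exact det_charMat_mem_restricted r _
  · exact mul_mem (isRestricted_andersonDenom J r) (hK.isRestricted_andersonTail hθ J u k hr hrJ)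

theorem isRestricted_mul_andersonG (hK : HasGrowth W θ η f g K) (hθ : 1 < ‖θ‖) (J : ℕ)
    (u : Fin n → Ω) (k : Fin n) {r : ℝ} (hr : 0 ≤ r) (hrJ : r < ‖θ‖ ^ Fintype.card F ^ J) :
    PowerSeries.IsRestricted r (andersonDenom W θ f g J * (andersonG W f g θ η u k).1) ∧
      PowerSeries.IsRestricted r (andersonDenom W θ f g J * (andersonG W f g θ η u k).2) := by
  refine ⟨?_, hK.isRestricted_andersonE hθ J u k hr hrJ⟩
  rw [andersonG, mul_add, mul_left_comm]
  change _ ∈ restricted Ω r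
  refine add_mem
    (hK.isRestricted_andersonE hθ J _ k hr hrJ) (mul_mem (add_mem (mul_mem ?_ ?_) ?_)
      (hK.isRestricted_andersonE hθ J u k hr hrJ))
  · exact C_mem_restricted r _
  · exact X_mem_restricted r
  · exact C_mem_restricted r _

theorem isDenominator_andersonDenom (hK : HasGrowth W θ η f g K) (hθ : 1 < ‖θ‖) (J : ℕ)
    (u : Fin n → Ω) (k : Fin n) {r : ℝ} (hr : 0 ≤ r) (hrJ : r < ‖θ‖ ^ Fintype.card F ^ J) :
    IsDenominator r (andersonG W f g θ η u k) (andersonDenom W θ f g J) :=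
  ⟨andersonDenom_ne_zero hθ J, isRestricted_andersonDenom J r,
    hK.isRestricted_mul_andersonG hθ J u k hr hrJ⟩

theorem isMeromorphicOnU_andersonG (hK : HasGrowth W θ η f g K) (hθ : 1 < ‖θ‖)
    (u : Fin n → Ω) (k : Fin n) : IsMeromorphicOnU (andersonG W f g θ η u k) := by
  -- For `J = 0` there is no denominator and the radius is `|θ| > 1`, so the unit disk is covered.
  have h0 := hK.isRestricted_mul_andersonG hθ 0 u k zero_le_one (by simpa using hθ)
  have hd : andersonDenom W θ f g 0 = 1 := by simp [andersonDenom]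
  rw [hd, one_mul, one_mul] at h0
  refine ⟨h0.1, h0.2, fun r hr => ?_⟩
  obtain ⟨m, hm⟩ := pow_unbounded_of_one_lt r hθ
  refine ⟨_, hK.isDenominator_andersonDenom hθ m u k (by linarith) (hm.trans_le ?_)⟩
  exact pow_le_pow_right₀ hθ.le (Nat.lt_pow_self Fintype.one_lt_card).le

end HasGrowth

end AndersonE

end TensorDrinfeld
namespace TensorDrinfeld

/-! ## Taylor expansion of restricted power series -/

section Recenter

variable {Ω : Type*} [NormedField Ω] [IsUltrametricDist Ω] {θ : Ω}

/-- The terms of the Taylor expansion of `s` at `θ`. -/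
noncomputable def taylorTerm (θ : Ω) (s : PowerSeries Ω) (k p : ℕ) : Ω :=
  (p.choose k : Ω) * PowerSeries.coeff p s * θ ^ (p - k)

theorem norm_taylorTerm_le (hθ : θ ≠ 0) (s : PowerSeries Ω) (k p : ℕ) :
    ‖taylorTerm θ s k p‖ ≤ ‖PowerSeries.coeff p s‖ * ‖θ‖ ^ p / ‖θ‖ ^ k := by
  have hθ0 : 0 < ‖θ‖ := norm_pos_iff.mpr hθ
  rcases lt_or_ge p k with h | h
  · rw [taylorTerm, Nat.choose_eq_zero_of_lt h, Nat.cast_zero, zero_mul, zero_mul, norm_zero]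
    positivity
  · rw [taylorTerm, norm_mul, norm_mul, norm_pow, mul_div_assoc, div_eq_mul_inv (‖θ‖ ^ p),
      ← pow_sub₀ _ hθ0.ne' h]
    refine mul_le_mul_of_nonneg_right ?_ (by positivity)
    exact mul_le_of_le_one_left (norm_nonneg _) (IsUltrametricDist.norm_natCast_le_one Ω _)

theorem tendsto_taylorTerm {s : PowerSeries Ω} (hs : s ∈ restricted Ω ‖θ‖) (k : ℕ) :
    Filter.Tendsto (fun p => ‖PowerSeries.coeff p s‖ * ‖θ‖ ^ p / ‖θ‖ ^ k) Filter.atTop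
      (nhds 0) := by
  have := ((PowerSeries.isRestricted_iff' _ _).mp hs).div_const (‖θ‖ ^ k)
  rwa [zero_div] at this

variable [CompleteSpace Ω]

theorem summable_taylorTerm (hθ : θ ≠ 0) {s : PowerSeries Ω} (hs : s ∈ restricted Ω ‖θ‖) (k : ℕ) :
    Summable (taylorTerm θ s k) := by
  refine NonarchimedeanAddGroup.summable_of_tendsto_cofinite_zero ?_
  rw [Nat.cofinite_eq_atTop]
  exact squeeze_zero_norm (norm_taylorTerm_le hθ s k) (tendsto_taylorTerm hs k)

theorem coeff_recenter (hθ : θ ≠ 0) {s : PowerSeries Ω} (hs : s ∈ restricted Ω ‖θ‖) (k : ℕ) :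
    PowerSeries.coeff k (recenter θ s) = ∑' p, taylorTerm θ s k p := by
  rw [← (summable_taylorTerm hθ hs k).sum_add_tsum_nat_add k, Finset.sum_eq_zero, zero_add,
    recenter, PowerSeries.coeff_mk]
  · refine tsum_congr fun i => ?_
    rw [taylorTerm, Nat.add_sub_cancel]
  · intro p hp
    rw [taylorTerm, Nat.choose_eq_zero_of_lt (Finset.mem_range.mp hp), Nat.cast_zero, zero_mul,
      zero_mul]

theorem recenter_add (hθ : θ ≠ 0) {s s' : PowerSeries Ω} (hs : s ∈ restricted Ω ‖θ‖)
    (hs' : s' ∈ restricted Ω ‖θ‖) : recenter θ (s + s') = recenter θ s + recenter θ s' := by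
  ext k
  rw [map_add, coeff_recenter hθ hs, coeff_recenter hθ hs', coeff_recenter hθ (add_mem hs hs'),
    ← (summable_taylorTerm hθ hs k).tsum_add (summable_taylorTerm hθ hs' k)]
  refine tsum_congr fun p => ?_
  simp only [taylorTerm, map_add]
  ring

/-- Both sides are Cauchy products; their coefficients agree by Vandermonde's identity. -/
theorem recenter_mul (hθ : θ ≠ 0) {s s' : PowerSeries Ω} (hs : s ∈ restricted Ω ‖θ‖)
    (hs' : s' ∈ restricted Ω ‖θ‖) : recenter θ (s * s') = recenter θ s * recenter θ s' := by
  ext k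
  have hsum := summable_taylorTerm hθ hs
  have hsum' := summable_taylorTerm hθ hs'
  have : NonarchimedeanRing Ω := ⟨NonarchimedeanAddGroup.is_nonarchimedean⟩
  have hmul : ∀ p : ℕ × ℕ, Summable fun x : ℕ × ℕ =>
      taylorTerm θ s p.1 x.1 * taylorTerm θ s' p.2 x.2 := fun p =>
    (hsum p.1).mul_of_nonarchimedean (hsum' p.2)
  rw [PowerSeries.coeff_mul, coeff_recenter hθ (mul_mem hs hs')]
  have h1 : ∀ p ∈ Finset.HasAntidiagonal.antidiagonal k,
      PowerSeries.coeff p.1 (recenter θ s) * PowerSeries.coeff p.2 (recenter θ s') =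
        ∑' m, ∑ x ∈ Finset.HasAntidiagonal.antidiagonal m,
          taylorTerm θ s p.1 x.1 * taylorTerm θ s' p.2 x.2 := fun p _ => by
    rw [coeff_recenter hθ hs, coeff_recenter hθ hs']
    exact (hsum p.1).tsum_mul_tsum_eq_tsum_sum_antidiagonal (hsum' p.2)
      (hmul p)
  rw [Finset.sum_congr rfl h1, ← Summable.tsum_finsetSum fun p _ =>
    summable_sum_mul_antidiagonal_of_summable_mul (hmul p)]
  refine tsum_congr fun m => ?_
  rw [Finset.sum_comm, taylorTerm, PowerSeries.coeff_mul, Finset.mul_sum, Finset.sum_mul]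
  refine Finset.sum_congr rfl fun x hx => ?_
  rw [Finset.HasAntidiagonal.mem_antidiagonal] at hx
  rw [← hx, Nat.add_choose_eq, Nat.cast_sum, Finset.sum_mul, Finset.sum_mul]
  refine Finset.sum_congr rfl fun p hp => ?_
  rw [Finset.HasAntidiagonal.mem_antidiagonal] at hp
  rw [taylorTerm, taylorTerm]
  -- Where a subtraction in an exponent would truncate, the binomial coefficient vanishes.
  rcases lt_or_ge x.1 p.1 with h | h
  · simp [Nat.choose_eq_zero_of_lt h]
  rcases lt_or_ge x.2 p.2 with h' | h'
  · simp [Nat.choose_eq_zero_of_lt h']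
  have e : x.1 + x.2 - k = (x.1 - p.1) + (x.2 - p.2) := by omega
  rw [e, pow_add]
  push_cast
  ring

omit [IsUltrametricDist Ω] [CompleteSpace Ω] in
theorem recenter_C (a : Ω) : recenter θ (PowerSeries.C a) = PowerSeries.C a := by
  ext k
  rw [recenter, PowerSeries.coeff_mk, tsum_eq_single 0]
  · rcases eq_or_ne k 0 with rfl | hk <;> simp [PowerSeries.coeff_C, *]
  · intro i hi
    simp [PowerSeries.coeff_C, hi]

theorem recenter_X :
    recenter θ (PowerSeries.X : PowerSeries Ω) = PowerSeries.C θ + PowerSeries.X := by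
  ext k
  rw [recenter, PowerSeries.coeff_mk, tsum_eq_single (1 - k)]
  · rcases k with _ | _ | k
    · simp
    · simp
    · simp [PowerSeries.coeff_X]
  · intro i hi
    rw [PowerSeries.coeff_X, if_neg (by omega)]
    simp

/-- Taylor expansion at `θ` as a ring homomorphism. -/
noncomputable def recenterHom (hθ : θ ≠ 0) : restricted Ω ‖θ‖ →+* PowerSeries Ω where
  toFun s := recenter θ s
  map_one' := by
    have := recenter_C (θ := θ) 1
    rwa [map_one] at this
  map_mul' s s' := recenter_mul hθ s.2 s'.2
  map_zero' := by
    have := recenter_C (θ := θ) 0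
    rwa [map_zero] at this
  map_add' s s' := recenter_add hθ s.2 s'.2

/-- This is the coefficient of `x^k` in `((x - θ) + θ)^p`, expanded in powers of `x - θ`. -/
theorem sum_choose_mul_choose (p k : ℕ) :
    ∑ j ∈ Finset.range (p + 1), (j.choose k : Ω) * (-θ) ^ (j - k) * ((p.choose j : Ω) *
      θ ^ (p - j)) = if p = k then 1 else 0 := by
  rcases lt_or_ge p k with h | h
  · rw [if_neg (by omega)]
    refine Finset.sum_eq_zero fun j hj => ?_
    rw [Nat.choose_eq_zero_of_lt (by simp at hj; omega)]
    simp
  obtain ⟨m, rfl⟩ := Nat.exists_eq_add_of_le h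
  rw [add_assoc, Finset.sum_range_add, Finset.sum_eq_zero, zero_add]
  · have key : ∀ j ∈ Finset.range (m + 1), ((k + j).choose k : Ω) * (-θ) ^ (k + j - k) *
        (((k + m).choose (k + j) : Ω) * θ ^ (k + m - (k + j))) =
        ((k + m).choose k : Ω) * ((-θ) ^ j * θ ^ (m - j) * (m.choose j : Ω)) := by
      intro j _
      have := Nat.choose_mul (n := k + m) (k := k + j) (s := k) (by omega)
      rw [Nat.add_sub_cancel_left, Nat.add_sub_cancel_left] at this
      have h2 : ((k + m).choose (k + j) : Ω) * ((k + j).choose k : Ω) =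
          ((k + m).choose k : Ω) * (m.choose j : Ω) := by
        rw [← Nat.cast_mul, this, Nat.cast_mul]
      rw [Nat.add_sub_cancel_left, Nat.add_sub_add_left]
      linear_combination (-θ) ^ j * θ ^ (m - j) * h2
    rw [Finset.sum_congr rfl key, ← Finset.mul_sum, ← add_pow, neg_add_cancel]
    rcases Nat.eq_zero_or_pos m with rfl | hm
    · simp
    · rw [zero_pow (by omega), mul_zero, if_neg (by omega)]
  · intro j hj
    rw [Nat.choose_eq_zero_of_lt (Finset.mem_range.mp hj)]
    simp

/-- Expanding back around `0` recovers the coefficients of `s`, once the order of summation is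
exchanged. -/
theorem recenter_injective (hθ : θ ≠ 0) {s : PowerSeries Ω} (hs : s ∈ restricted Ω ‖θ‖)
    (h0 : recenter θ s = 0) : s = 0 := by
  ext k
  obtain ⟨Φ, hΦ⟩ : ∃ Φ : ℕ × ℕ → Ω, ∀ x, Φ x =
    (x.1.choose k : Ω) * (-θ) ^ (x.1 - k) * taylorTerm θ s x.1 x.2 := ⟨_, fun _ => rfl⟩
  have hθ0 : 0 < ‖θ‖ := norm_pos_iff.mpr hθ
  have hzero : ∀ x : ℕ × ℕ, x.2 < x.1 → Φ x = 0 := fun x hx => by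
    simp only [hΦ, taylorTerm, Nat.choose_eq_zero_of_lt hx, Nat.cast_zero, zero_mul, mul_zero]
  have hle : ∀ x : ℕ × ℕ, ‖Φ x‖ ≤ ‖PowerSeries.coeff x.2 s‖ * ‖θ‖ ^ x.2 / ‖θ‖ ^ k := by
    intro x
    rcases lt_or_ge x.1 k with h | h
    · simp only [hΦ, Nat.choose_eq_zero_of_lt h, Nat.cast_zero, zero_mul, norm_zero]
      positivity
    · simp only [hΦ]
      rw [norm_mul, norm_mul, norm_pow, norm_neg]
      calc _ ≤ 1 * ‖θ‖ ^ (x.1 - k) * (‖PowerSeries.coeff x.2 s‖ * ‖θ‖ ^ x.2 / ‖θ‖ ^ x.1) := by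
            gcongr
            · exact IsUltrametricDist.norm_natCast_le_one Ω _
            · exact norm_taylorTerm_le hθ s x.1 x.2
        _ = _ := by
            rw [pow_sub₀ _ hθ0.ne' h]
            field_simp
  -- The bound on `Φ (j, p)` depends only on `p` and tends to `0`, and only `j ≤ p` contributes; so
  -- all but finitely many terms are small, which suffices over a complete ultrametric field.
  have hsum : Summable Φ := by
    refine NonarchimedeanAddGroup.summable_of_tendsto_cofinite_zero ?_
    rw [Metric.tendsto_nhds]
    intro ε hε
    have hev := (tendsto_taylorTerm hs k).eventually (gt_mem_nhds hε)
    obtain ⟨N, hN⟩ := Filter.eventually_atTop.mp hev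
    refine Filter.eventually_cofinite.mpr (((Finset.range N ×ˢ Finset.range N).finite_toSet).subset
      fun x hx => ?_)
    simp only [Set.mem_ofPred_eq, dist_zero_right, not_lt] at hx
    have h1 : x.2 < N := by
      by_contra! hc
      exact absurd (hx.trans (hle x)) (not_le.mpr (hN _ hc))
    have h2 : x.1 ≤ x.2 := by
      by_contra! hc
      rw [hzero x hc, norm_zero] at hx
      linarith
    simp only [Finset.coe_product, Finset.coe_range, Set.mem_prod, Set.mem_Iio]
    omega
  have h1 : ∀ j, ∑' p, Φ (j, p) = 0 := fun j => by
    simp only [hΦ]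
    rw [tsum_mul_left, ← coeff_recenter hθ hs, h0, map_zero, mul_zero]
  have h2 : ∀ p, ∑' j, Φ (j, p) = if p = k then PowerSeries.coeff p s else 0 := fun p => by
    rw [tsum_eq_sum (s := Finset.range (p + 1)) fun j hj => hzero _ (by simp at hj; exact hj)]
    have := congrArg (PowerSeries.coeff p s * ·) (sum_choose_mul_choose (θ := θ) p k)
    simp only [Finset.mul_sum, mul_ite, mul_one, mul_zero] at this
    rw [← this]
    refine Finset.sum_congr rfl fun j _ => ?_
    simp only [hΦ, taylorTerm]
    ring
  have h4 : ∑' p, ∑' j, Φ (j, p) = ∑' j, ∑' p, Φ (j, p) := by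
    exact Summable.tsum_comm (f := fun j p => Φ (j, p)) hsum
  simp only [h1, h2, tsum_zero] at h4
  rw [tsum_ite_eq] at h4
  rw [h4, map_zero]

end Recenter

end TensorDrinfeld
namespace TensorDrinfeld

/-! ## The expansion of `y` at `Ξ` -/

section YExpansion

variable {F : Type*} [Field F] {Ω : Type*} [NormedField Ω] [Algebra F Ω]
  {W : WeierstrassCurve F} {θ η : Ω}

theorem equation_baseChange_iff {R : Type*} [CommRing R] [Algebra F R] {x y : R} :
    (W.baseChange R).toAffine.Equation x y ↔
      y ^ 2 + algebraMap F R W.a₁ * x * y + algebraMap F R W.a₃ * y =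
        x ^ 3 + algebraMap F R W.a₂ * x ^ 2 + algebraMap F R W.a₄ * x + algebraMap F R W.a₆ :=
  WeierstrassCurve.Affine.equation_iff x y

theorem constantCoeff_sub_mem_span {Y : PowerSeries Ω} {a : Ω}
    (h : Y - PowerSeries.C a ∈ Ideal.span {(PowerSeries.X : PowerSeries Ω)}) :
    PowerSeries.constantCoeff Y = a := by
  rw [Ideal.mem_span_singleton, PowerSeries.X_dvd_iff, map_sub, PowerSeries.constantCoeff_C,
    sub_eq_zero] at h
  exact h

/-- Hensel's lemma for the equation of the curve over the power series ring. -/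
theorem yExpansion_spec (hΞ : (W.baseChange Ω).toAffine.Equation θ η)
    (hω : 2 * η + algebraMap F Ω W.a₁ * θ + algebraMap F Ω W.a₃ ≠ 0) :
    PowerSeries.constantCoeff (yExpansion W θ η) = η ∧
      (W.baseChange (PowerSeries Ω)).toAffine.Equation (PowerSeries.C θ + PowerSeries.X)
        (yExpansion W θ η) := by
  apply Classical.epsilon_spec (p := fun Y : PowerSeries Ω => PowerSeries.constantCoeff Y = η ∧
      (W.baseChange (PowerSeries Ω)).toAffine.Equation (PowerSeries.C θ + PowerSeries.X) Y)
  set t : PowerSeries Ω := PowerSeries.C θ + PowerSeries.X with ht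
  have hal : ∀ c : F, algebraMap F (PowerSeries Ω) c = PowerSeries.C (algebraMap F Ω c) :=
    fun c => PowerSeries.algebraMap_apply
  let I : Ideal (PowerSeries Ω) := Ideal.span {PowerSeries.X}
  have hI : ∀ s, s ∈ I ↔ PowerSeries.constantCoeff s = 0 := fun s => by
    rw [Ideal.mem_span_singleton, PowerSeries.X_dvd_iff]
  let p : (PowerSeries Ω)[X] := X ^ 2 +
    (C (algebraMap F (PowerSeries Ω) W.a₁ * t + algebraMap F (PowerSeries Ω) W.a₃) * X -
    C (t ^ 3 + algebraMap F (PowerSeries Ω) W.a₂ * t ^ 2 + algebraMap F (PowerSeries Ω) W.a₄ * t +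
      algebraMap F (PowerSeries Ω) W.a₆))
  have hmonic : p.Monic := by
    refine monic_X_pow_add ?_
    refine (degree_sub_le _ _).trans_lt (max_lt ?_ ?_)
    · exact (degree_C_mul_X_le _).trans_lt (by norm_num)
    · exact degree_C_le.trans_lt (by norm_num)
  have hder : p.derivative = C 2 * X +
      C (algebraMap F (PowerSeries Ω) W.a₁ * t + algebraMap F (PowerSeries Ω) W.a₃) := by
    simp only [p, derivative_add, derivative_sub, derivative_X_pow, derivative_C_mul, derivative_X,
      derivative_C]
    simp
  have h1 : p.eval (PowerSeries.C η) ∈ I := by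
    rw [hI]
    have hΞ' := equation_baseChange_iff.mp hΞ
    simp only [p, eval_add, eval_sub, eval_pow, eval_mul, eval_X, eval_C, hal, ht, map_add, map_sub,
      map_mul, map_pow, PowerSeries.constantCoeff_C, PowerSeries.constantCoeff_X, add_zero]
    linear_combination hΞ'
  have h2 : IsUnit (Ideal.Quotient.mk I (p.derivative.eval (PowerSeries.C η))) := by
    refine IsUnit.map _ ?_
    rw [PowerSeries.isUnit_iff_constantCoeff, isUnit_iff_ne_zero, hder]
    simp only [eval_add, eval_mul, eval_X, eval_C, eval_ofNat, hal, ht, map_add, map_mul, map_ofNat,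
      PowerSeries.constantCoeff_C, PowerSeries.constantCoeff_X, add_zero]
    rwa [← add_assoc]
  obtain ⟨Y, hY, hYη⟩ := HenselianRing.is_henselian (I := I) p hmonic _ h1 h2
  refine ⟨Y, constantCoeff_sub_mem_span hYη, equation_baseChange_iff.mpr ?_⟩
  have hY' : p.eval Y = 0 := hY
  simp only [p, eval_add, eval_sub, eval_pow, eval_mul, eval_X, eval_C] at hY'
  linear_combination hY'

theorem norm_algebraMap_le_one [Fintype F] (c : F) : ‖algebraMap F Ω c‖ ≤ 1 := by
  by_contra! h
  have h1 := congrArg norm (congrArg (algebraMap F Ω) (FiniteField.pow_card c))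
  rw [map_pow, norm_pow] at h1
  exact absurd h1 (lt_self_pow₀ h Fintype.one_lt_card).ne'

theorem norm_algebraMap_of_ne_zero [Fintype F] {c : F} (hc : c ≠ 0) : ‖algebraMap F Ω c‖ = 1 := by
  refine le_antisymm (norm_algebraMap_le_one c) ?_
  have h := norm_algebraMap_le_one (Ω := Ω) c⁻¹
  rw [map_inv₀, norm_inv] at h
  have h0 : 0 < ‖algebraMap F Ω c‖ := norm_pos_iff.mpr ((_root_.map_ne_zero _).mpr hc)
  exact (inv_le_one₀ h0).mp h

/-- So `t - θ` is a uniformizer at `Ξ` and `λ` has neither zero nor pole there. The terms have norms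
`q³`, at most `q²` and at most `1`, so the first nonzero one dominates. In characteristic 2, `a₁ =
a₃ = 0` would make the discriminant vanish. -/
theorem two_mul_add_ne_zero [Fintype F] [IsUltrametricDist Ω] [W.IsElliptic]
    (hC : IsCInfty F θ η) :
    2 * η + algebraMap F Ω W.a₁ * θ + algebraMap F Ω W.a₃ ≠ 0 := by
  have hq : (1 : ℝ) < Fintype.card F := by exact_mod_cast Fintype.one_lt_card
  have ha3 : ‖algebraMap F Ω W.a₃‖ < (Fintype.card F : ℝ) ^ 2 :=
    (norm_algebraMap_le_one _).trans_lt (one_lt_pow₀ hq two_ne_zero)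
  by_cases h2 : (2 : F) = 0
  · have h2' : (2 : Ω) = 0 := by
      have := congrArg (algebraMap F Ω) h2
      rwa [map_ofNat, map_zero] at this
    rw [h2', zero_mul, zero_add]
    by_cases h1 : W.a₁ = 0
    · rw [h1, map_zero, zero_mul, zero_add]
      intro h3
      rw [map_eq_zero] at h3
      refine W.isUnit_Δ.ne_zero ?_
      simp only [WeierstrassCurve.Δ, WeierstrassCurve.b₂, WeierstrassCurve.b₄, WeierstrassCurve.b₆,
        WeierstrassCurve.b₈, h1, h3]
      linear_combination (-8 * W.a₂ ^ 2 * (4 * W.a₂ * W.a₆ - W.a₄ ^ 2) - 32 * W.a₄ ^ 3 -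
        216 * W.a₆ ^ 2 + 144 * W.a₂ * W.a₄ * W.a₆) * h2
    · intro h
      have h3 := congrArg norm (eq_neg_of_add_eq_zero_left h)
      rw [norm_neg, norm_mul, norm_algebraMap_of_ne_zero h1, one_mul, hC.norm_theta] at h3
      exact absurd h3 ha3.ne'
  · intro h
    rw [add_assoc] at h
    have h3 := congrArg norm (eq_neg_of_add_eq_zero_left h)
    have h4 : ‖(2 : Ω)‖ = 1 := by
      have := norm_algebraMap_of_ne_zero (Ω := Ω) h2
      rwa [map_ofNat] at this
    rw [norm_neg, norm_mul, h4, one_mul, hC.norm_eta] at h3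
    have h5 : ‖algebraMap F Ω W.a₁ * θ + algebraMap F Ω W.a₃‖ ≤ (Fintype.card F : ℝ) ^ 2 := by
      refine norm_add_le_of_le ?_ ha3.le
      rw [norm_mul, hC.norm_theta]
      exact mul_le_of_le_one_left (by positivity) (norm_algebraMap_le_one _)
    have h6 : (Fintype.card F : ℝ) ^ 2 < (Fintype.card F : ℝ) ^ 3 :=
      pow_lt_pow_right₀ hq (by norm_num)
    linarith

end YExpansion

end TensorDrinfeld
namespace TensorDrinfeld

/-! ### Factoring the difference of two Weierstrass equations. -/

section Factor

/-- In the difference of the equations for `(t, y)` and `(D, Y)`, `t y - D Y = t (y - Y) + (t - D)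
Y`. The multiples of `y - Y` are collected on one side; everything else is divisible by `t - D`. -/
theorem weierstrass_factor {R M : Type*} [CommRing R] [Ring M] [Algebra R M] {D Y : M}
    (h : Commute D Y) (t y a₁ a₂ a₃ a₄ a₆ : R)
    (hM : Y ^ 2 + a₁ • (D * Y) + a₃ • Y = D ^ 3 + a₂ • D ^ 2 + a₄ • D + a₆ • (1 : M))
    (hR : y ^ 2 + a₁ * t * y + a₃ * y = t ^ 3 + a₂ * t ^ 2 + a₄ * t + a₆) :
    ∃ S : M, (algebraMap R M y - Y) * (Y + algebraMap R M (y + a₁ * t + a₃)) =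
      (algebraMap R M t - D) * S := by
  have hcomm : ∀ a ∈ ({D, Y} : Set M), ∀ b ∈ ({D, Y} : Set M), a * b = b * a := by
    rintro a (rfl | rfl) b (rfl | rfl)
    · rfl
    · exact h
    · exact h.symm
    · rfl
  -- The identity lives in the commutative subalgebra generated by `D` and `Y`.
  have := Algebra.isMulCommutative_adjoin R hcomm
  let _ : CommRing (Algebra.adjoin R ({D, Y} : Set M)) :=
    { (inferInstance : Ring (Algebra.adjoin R ({D, Y} : Set M))) with
      mul_comm := this.is_comm.comm }
  let D' : Algebra.adjoin R ({D, Y} : Set M) := ⟨D, Algebra.subset_adjoin (by simp)⟩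
  let Y' : Algebra.adjoin R ({D, Y} : Set M) := ⟨Y, Algebra.subset_adjoin (by simp)⟩
  have hM' : Y' ^ 2 + algebraMap R _ a₁ * (D' * Y') + algebraMap R _ a₃ * Y' =
      D' ^ 3 + algebraMap R _ a₂ * D' ^ 2 + algebraMap R _ a₄ * D' + algebraMap R _ a₆ := by
    apply Subtype.ext
    rw [← mul_one (algebraMap R _ a₆)]
    simp only [← Algebra.smul_def]
    exact hM
  have hR' := congrArg (algebraMap R (Algebra.adjoin R ({D, Y} : Set M))) hR
  simp only [map_add, map_mul, map_pow] at hR'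
  let S' : Algebra.adjoin R ({D, Y} : Set M) := algebraMap R _ t ^ 2 + algebraMap R _ t * D' +
    D' ^ 2 + algebraMap R _ a₂ * (algebraMap R _ t + D') + algebraMap R _ a₄ - algebraMap R _ a₁ * Y'
  have key : (algebraMap R _ y - Y') * (Y' + algebraMap R _ (y + a₁ * t + a₃)) =
      (algebraMap R _ t - D') * S' := by
    simp only [map_add, map_mul, S']
    linear_combination hR' - hM'
  exact ⟨S', congrArg Subtype.val key⟩

end Factor

/-! ### Inverse of `N - x` for nilpotent `N`. -/

section Nilpotent

variable {Ω : Type*} [Field Ω] {n : ℕ}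

theorem pow_eq_zero_of_strictly_upper {N : Matrix (Fin n) (Fin n) Ω}
    (hN : ∀ a b, b ≤ a → N a b = 0) : N ^ n = 0 := by
  have h : N.charpoly = X ^ n := by
    rw [Matrix.charpoly_of_isUpperTriangular]
    · simp [hN _ _ le_rfl]
    · exact fun a b hab => hN a b (le_of_lt hab)
  have h2 := Matrix.aeval_self_charpoly N
  rwa [h, map_pow, aeval_X] at h2

/-- The inverse of `N - x` over the field of Laurent series. -/
noncomputable def laurentInv (N : Matrix (Fin n) (Fin n) Ω) :
    Matrix (Fin n) (Fin n) (LaurentSeries Ω) :=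
  -∑ k ∈ Finset.range n, (HahnSeries.single (-1 : ℤ) (1 : Ω)) ^ (k + 1) •
    (HahnSeries.C (Γ := ℤ) (R := Ω)).mapMatrix (N ^ k)

/-- A telescoping sum, whose last term vanishes because `N ^ n = 0`. -/
theorem mul_laurentInv {N : Matrix (Fin n) (Fin n) Ω} (hN : N ^ n = 0) :
    ((HahnSeries.C (Γ := ℤ) (R := Ω)).mapMatrix N - (HahnSeries.single (1 : ℤ) (1 : Ω)) • 1) *
      laurentInv N = 1 := by
  set x : LaurentSeries Ω := HahnSeries.single (1 : ℤ) (1 : Ω)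
  set x' : LaurentSeries Ω := HahnSeries.single (-1 : ℤ) (1 : Ω)
  have hx : x * x' = 1 := by
    simp only [x, x', HahnSeries.single_mul_single]
    simp
  set NK := (HahnSeries.C (Γ := ℤ) (R := Ω)).mapMatrix N with hNK
  have key : ∀ k ∈ Finset.range n, (NK - x • 1) * (x' ^ (k + 1) •
      (HahnSeries.C (Γ := ℤ) (R := Ω)).mapMatrix (N ^ k)) =
      x' ^ (k + 1) • NK ^ (k + 1) - x' ^ k • NK ^ k := by
    intro k _
    rw [map_pow, ← hNK, sub_mul, mul_smul_comm, ← pow_succ', smul_mul_assoc, one_mul, smul_smul,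
      pow_succ' x' k, ← mul_assoc, hx, one_mul]
  have hNn : NK ^ n = 0 := by rw [hNK, ← map_pow, hN, map_zero]
  rw [laurentInv, mul_neg, Finset.mul_sum, Finset.sum_congr rfl key,
    Finset.sum_range_sub (fun k => x' ^ k • NK ^ k), hNn]
  simp

/-- Only the summand `-N^0 x⁻¹` reaches the exponent `-1`: this is the residue of the theorem. -/
theorem coeff_laurentInv_mulVec (N : Matrix (Fin n) (Fin n) Ω) (u : Fin n → Ω) (k : Fin n) :
    HahnSeries.coeff ((laurentInv N).mulVec (fun c => HahnSeries.C (u c)) k) (-1) = -u k := by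
  have hn : 0 < n := Fin.pos k
  have hx : ∀ m : ℕ, (HahnSeries.single (-1 : ℤ) (1 : Ω)) ^ m = HahnSeries.single (-(m : ℤ)) 1 := by
    intro m
    rw [HahnSeries.single_pow]
    simp
  have e : ∀ c, HahnSeries.coeff (laurentInv N k c * HahnSeries.C (u c)) (-1) =
      if c = k then -u k else 0 := by
    intro c
    rw [laurentInv, Matrix.neg_apply, Matrix.sum_apply, neg_mul, HahnSeries.coeff_neg,
      Finset.sum_mul, HahnSeries.coeff_sum, Finset.sum_eq_single 0]
    · simp [hx, Matrix.one_apply, HahnSeries.C_apply]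
      split_ifs <;> simp_all
    · intro j _ hj
      simp only [Matrix.smul_apply, hx, RingHom.mapMatrix_apply, Matrix.map_apply, smul_eq_mul,
        HahnSeries.C_apply, HahnSeries.single_mul_single]
      rw [HahnSeries.coeff_single_of_ne]
      push_cast
      omega
    · simp [hn.ne']
  rw [Matrix.mulVec, dotProduct, HahnSeries.coeff_sum, Finset.sum_congr rfl fun c _ => e c]
  simp

end Nilpotent

end TensorDrinfeld
namespace TensorDrinfeld

/-! ## Laurent expansions at `Ξ` -/

section CharMatAt

variable {Ω : Type*} [NormedField Ω]

/-- The matrix `M - t` in terms of `x = t - θ`. -/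
noncomputable def charMatAt {n : ℕ} (θ : Ω) (M : Matrix (Fin n) (Fin n) Ω) :
    Matrix (Fin n) (Fin n) (PowerSeries Ω) :=
  (PowerSeries.C (R := Ω)).mapMatrix M - algebraMap (PowerSeries Ω) _ (PowerSeries.C θ + PowerSeries.X)

theorem charMatAt_apply {n : ℕ} (θ : Ω) (M : Matrix (Fin n) (Fin n) Ω) (a b : Fin n) :
    charMatAt θ M a b = PowerSeries.C (M a b) -
      if a = b then PowerSeries.C θ + PowerSeries.X else 0 := by
  rw [charMatAt, Matrix.sub_apply, Matrix.algebraMap_matrix_apply]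
  rfl

end CharMatAt

section LaurentExpansion

variable {F : Type*} [Field F] {Ω : Type*} [NormedField Ω] [IsUltrametricDist Ω] [Algebra F Ω]
  {W : WeierstrassCurve F} {θ η : Ω}

omit [IsUltrametricDist Ω] in
theorem isRestricted_of_le {r c : ℝ} (hc : 0 ≤ c) (hcr : c ≤ r) {s : PowerSeries Ω}
    (hs : PowerSeries.IsRestricted r s) : PowerSeries.IsRestricted c s := by
  rw [PowerSeries.isRestricted_iff'] at hs ⊢
  exact squeeze_zero (fun i => by positivity) (fun i => by gcongr) hs

variable [CompleteSpace Ω]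

/-- Two denominators are compared by cross-multiplication, and cancelled because `recenter` is
injective. Hence the residue may be computed from any expansion. -/
theorem IsLaurentExpansion.unique (hθ : θ ≠ 0) {h : PowerSeries Ω × PowerSeries Ω}
    {l l' : LaurentSeries Ω} (hl : IsLaurentExpansion W θ η h l)
    (hl' : IsLaurentExpansion W θ η h l') : l = l' := by
  obtain ⟨r, -, hr, d, ⟨hd0, hd, hda, hdb⟩, e⟩ := hl
  obtain ⟨r', -, hr', d', ⟨hd0', hd', hda', hdb'⟩, e'⟩ := hl'
  have mem : ∀ {s}, PowerSeries.IsRestricted r s → s ∈ restricted Ω ‖θ‖ :=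
    fun hs => isRestricted_of_le (norm_nonneg _) hr hs
  have mem' : ∀ {s}, PowerSeries.IsRestricted r' s → s ∈ restricted Ω ‖θ‖ :=
    fun hs => isRestricted_of_le (norm_nonneg _) hr' hs
  have hne : ∀ {s : PowerSeries Ω}, s ≠ 0 → s ∈ restricted Ω ‖θ‖ →
      HahnSeries.ofPowerSeries ℤ Ω (recenter θ s) ≠ 0 := fun hs hm h0 =>
    hs (recenter_injective hθ hm ((map_eq_zero_iff _ HahnSeries.ofPowerSeries_injective).mp h0))
  have ha : recenter θ d' * recenter θ (d * h.1) = recenter θ d * recenter θ (d' * h.1) := by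
    rw [← recenter_mul hθ (mem' hd') (mem hda), ← recenter_mul hθ (mem hd) (mem' hda'),
      mul_left_comm]
  have hb : recenter θ d' * recenter θ (d * h.2) = recenter θ d * recenter θ (d' * h.2) := by
    rw [← recenter_mul hθ (mem' hd') (mem hdb), ← recenter_mul hθ (mem hd) (mem' hdb'),
      mul_left_comm]
  have hab : recenter θ d' * (recenter θ (d * h.1) + recenter θ (d * h.2) * yExpansion W θ η) =
      recenter θ d * (recenter θ (d' * h.1) + recenter θ (d' * h.2) * yExpansion W θ η) := by
    linear_combination ha + yExpansion W θ η * hb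
  have h1 := congrArg (HahnSeries.ofPowerSeries ℤ Ω) hab
  rw [map_mul, map_mul, ← e, ← e', mul_left_comm] at h1
  exact mul_left_cancel₀ (hne hd0' (mem' hd')) (mul_left_cancel₀ (hne hd0 (mem hd)) h1)

theorem recenter_sum (hθ : θ ≠ 0) {ι : Type*} (s : Finset ι) {φ : ι → PowerSeries Ω}
    (hφ : ∀ i, φ i ∈ restricted Ω ‖θ‖) :
    recenter θ (∑ i ∈ s, φ i) = ∑ i ∈ s, recenter θ (φ i) := by
  have h := map_sum (recenterHom hθ) (fun i => (⟨φ i, hφ i⟩ : restricted Ω ‖θ‖)) s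
  have h2 : recenterHom hθ (∑ i ∈ s, (⟨φ i, hφ i⟩ : restricted Ω ‖θ‖)) =
      recenter θ (∑ i ∈ s, φ i) := by
    change recenter θ ((restricted Ω ‖θ‖).subtype (∑ i ∈ s, _)) = _
    rw [map_sum]
    rfl
  exact h2.symm.trans h

theorem recenter_charMat {n : ℕ} (hθ : θ ≠ 0) (M : Matrix (Fin n) (Fin n) Ω) :
    recenter θ (charMat M).det = (charMatAt θ M).det ∧
      ∀ a b, recenter θ ((charMat M).adjugate a b) = (charMatAt θ M).adjugate a b := by
  let M' : Matrix (Fin n) (Fin n) (restricted Ω ‖θ‖) :=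
    Matrix.of fun a b => ⟨charMat M a b, charMat_mem_restricted _ M a b⟩
  have h1 : (restricted Ω ‖θ‖).subtype.mapMatrix M' = charMat M := rfl
  have h2 : (recenterHom hθ).mapMatrix M' = charMatAt θ M := by
    ext1 a b
    change recenter θ (charMat M a b) = _
    rw [charMat_apply, charMatAt_apply]
    split_ifs
    · have := recenter_add hθ (C_mem_restricted ‖θ‖ (M a b)) (neg_mem (X_mem_restricted ‖θ‖))
      have hneg : recenter θ (-PowerSeries.X : PowerSeries Ω) = -(PowerSeries.C θ + PowerSeries.X) := by
        rw [← recenter_X]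
        exact map_neg (recenterHom hθ) ⟨PowerSeries.X, X_mem_restricted _⟩
      rw [sub_eq_add_neg, this, hneg, recenter_C, ← sub_eq_add_neg]
    · simp only [sub_zero, recenter_C]
  rw [← h1, ← h2, ← RingHom.map_det, ← RingHom.map_adjugate, ← RingHom.map_det,
    ← RingHom.map_adjugate]
  exact ⟨rfl, fun a b => rfl⟩

end LaurentExpansion

/-! ### The principal part at `Ξ`. -/

section PrincipalPart

variable {F : Type*} [Field F] [Fintype F] {Ω : Type*} [NormedField Ω] [IsUltrametricDist Ω]
  [Algebra F Ω] {W : WeierstrassCurve F} {θ η : Ω} {n : ℕ}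
  {D Y : Matrix (Fin n) (Fin n) Ω}

variable (W θ η) in
/-- The expansion of `2 y + c₁ t + c₃` at `Ξ`. -/
noncomputable def omegaExpansion : PowerSeries Ω :=
  2 * yExpansion W θ η +
      PowerSeries.C (algebraMap F Ω W.a₁) * (PowerSeries.C θ + PowerSeries.X) +
      PowerSeries.C (algebraMap F Ω W.a₃)

variable (W θ η) in
/-- The matrix `d[y] + y + c₁ t + c₃` expanded at `Ξ`. -/
noncomputable def conjSum (Y : Matrix (Fin n) (Fin n) Ω) :
    Matrix (Fin n) (Fin n) (PowerSeries Ω) :=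
  (PowerSeries.C (R := Ω)).mapMatrix Y + algebraMap (PowerSeries Ω) _ (yExpansion W θ η +
    PowerSeries.C (algebraMap F Ω W.a₁) * (PowerSeries.C θ + PowerSeries.X) +
      PowerSeries.C (algebraMap F Ω W.a₃))

-- With `Z = conjSum` and `ω = omegaExpansion` one has `ω - Z = y - Y`, and `(y - Y) Z = (t - D) S`.
-- At `x = 0` the matrix `Z` is upper triangular with diagonal `2η + c₁θ + c₃ ≠ 0`, so it is
-- invertible, and `y - Y = (t - D) S Z⁻¹`.
omit [IsUltrametricDist Ω] [Fintype F] in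
theorem exists_conjSum_eq (hΞ : (W.baseChange Ω).toAffine.Equation θ η)
    (hω : 2 * η + algebraMap F Ω W.a₁ * θ + algebraMap F Ω W.a₃ ≠ 0)
    (hd : ∀ a, Y a a = η) (hl : ∀ a b, b < a → Y a b = 0) (hcomm : Commute D Y)
    (hDY : Y ^ 2 + W.a₁ • (D * Y) + W.a₃ • Y =
      D ^ 3 + W.a₂ • D ^ 2 + W.a₄ • D + W.a₆ • (1 : Matrix (Fin n) (Fin n) Ω)) :
    ∃ S : Matrix (Fin n) (Fin n) (PowerSeries Ω), conjSum W θ η Y =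
      algebraMap (PowerSeries Ω) _ (omegaExpansion W θ η) + charMatAt θ D * S := by
  obtain ⟨hy0, hy⟩ := yExpansion_spec hΞ hω
  set y := yExpansion W θ η with hydef
  set t : PowerSeries Ω := PowerSeries.C θ + PowerSeries.X with ht
  set cm := (PowerSeries.C (R := Ω)).mapMatrix (m := Fin n) with hcm
  have hal : ∀ c : F, algebraMap F (PowerSeries Ω) c = PowerSeries.C (algebraMap F Ω c) :=
    fun c => PowerSeries.algebraMap_apply
  have hsm : ∀ (c : F) (M : Matrix (Fin n) (Fin n) Ω),
      cm (c • M) = PowerSeries.C (algebraMap F Ω c) • cm M := by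
    intro c M
    ext1 a b
    simp only [hcm, RingHom.mapMatrix_apply, Matrix.map_apply, Matrix.smul_apply, smul_eq_mul]
    rw [Algebra.smul_def, map_mul]
  have h1 := congrArg cm hDY
  simp only [map_add, map_mul, map_pow, hsm, map_one] at h1
  have h2 := equation_baseChange_iff.mp hy
  simp only [hal] at h2
  obtain ⟨S, hS⟩ := weierstrass_factor (hcomm.map cm) t y _ _ _ _ _ h1 h2
  have hZ : conjSum W θ η Y = cm Y + algebraMap (PowerSeries Ω) _ (y +
    PowerSeries.C (algebraMap F Ω W.a₁) * t + PowerSeries.C (algebraMap F Ω W.a₃)) := rfl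
  rw [← hZ] at hS
  have hunit : IsUnit (conjSum W θ η Y).det := by
    rw [PowerSeries.isUnit_iff_constantCoeff, isUnit_iff_ne_zero, RingHom.map_det]
    have hmat : PowerSeries.constantCoeff.mapMatrix (conjSum W θ η Y) =
        Matrix.of fun a b => Y a b + if a = b then η + algebraMap F Ω W.a₁ * θ + algebraMap F Ω W.a₃
          else 0 := by
      ext1 a b
      rw [hZ]
      simp only [RingHom.mapMatrix_apply, Matrix.map_apply, Matrix.add_apply, hcm, map_add,
        PowerSeries.constantCoeff_C, Matrix.algebraMap_matrix_apply, Matrix.of_apply]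
      congr 1
      split_ifs
      · simp [hy0, ht]
      · simp
    rw [hmat, Matrix.det_of_isUpperTriangular]
    · simp only [Matrix.of_apply, if_true, hd, Finset.prod_const]
      refine pow_ne_zero _ ?_
      convert hω using 1
      ring
    · intro a b hab
      have : b < a := hab
      simp [hl a b this, this.ne']
  refine ⟨S * (conjSum W θ η Y)⁻¹, ?_⟩
  have h3 : charMatAt θ D = -(algebraMap (PowerSeries Ω) _ t - cm D) := by
    rw [charMatAt, neg_sub]
  rw [h3, ← mul_assoc, neg_mul, ← hS, neg_mul, mul_assoc, Matrix.mul_nonsing_inv _ hunit, mul_one]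
  have h4 : omegaExpansion W θ η = y + (y + PowerSeries.C (algebraMap F Ω W.a₁) * t +
      PowerSeries.C (algebraMap F Ω W.a₃)) := by
    rw [omegaExpansion]
    ring
  rw [h4, map_add, hZ]
  abel

omit [IsUltrametricDist Ω] in
theorem ofPowerSeries_charMatAt (D : Matrix (Fin n) (Fin n) Ω) :
    (HahnSeries.ofPowerSeries ℤ Ω).mapMatrix (charMatAt θ D) =
      (HahnSeries.C (Γ := ℤ) (R := Ω)).mapMatrix (D - θ • 1) -
        (HahnSeries.single (1 : ℤ) (1 : Ω)) • 1 := by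
  ext1 a b
  simp only [RingHom.mapMatrix_apply, Matrix.map_apply, charMatAt_apply, Matrix.sub_apply,
    Matrix.smul_apply, Matrix.one_apply]
  split_ifs <;> simp [sub_sub]

end PrincipalPart

end TensorDrinfeld
namespace TensorDrinfeld

/-! ## Residues of Anderson generating functions -/

section ConstantTerms

variable {F : Type*} [Field F] [Fintype F] {L : Type*} [Field L] [DecidableEq L] [Algebra F L]
  {W : WeierstrassCurve F} {θ η : L} {hΞ : (W.baseChange L).toAffine.Nonsingular θ η}
  {V : (W.baseChange L).toAffine.Point} {n : ℕ} [NeZero n]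
  {f : (W.baseChange L).toAffine.FunctionField}
  {g : Fin n → (W.baseChange L).toAffine.FunctionField}

theorem rhoY_diag (a : Fin n) : rhoY W f g η 0 a a = η := by simp [rhoY]

theorem rhoY_lower (a b : Fin n) (hab : b < a) : rhoY W f g η 0 a b = 0 := by
  have : (b : ℕ) < a := hab
  rw [rhoY, Matrix.of_apply, if_neg (by omega), if_neg (by omega), if_neg (by omega),
    if_neg (by omega)]

theorem IsMotiveData.commute_rho_zero (D : IsMotiveData W hΞ V f g) :
    Commute (rhoT W f g θ 0) (rhoY W f g η 0) :=
  D.commute_seriesT_seriesY.map (TwistedSeries.constCoeff F L n)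

theorem IsMotiveData.equation_rho_zero (D : IsMotiveData W hΞ V f g) :
    rhoY W f g η 0 ^ 2 + W.a₁ • (rhoT W f g θ 0 * rhoY W f g η 0) + W.a₃ • rhoY W f g η 0 =
      rhoT W f g θ 0 ^ 3 + W.a₂ • rhoT W f g θ 0 ^ 2 + W.a₄ • rhoT W f g θ 0 +
        W.a₆ • (1 : Matrix (Fin n) (Fin n) L) := by
  have h := congrArg (TwistedSeries.constCoeff F L n) D.equation_series
  simp only [map_add, map_smul, map_mul, map_pow, map_one] at h
  exact h

end ConstantTerms

section Residue

variable {F : Type*} [Field F] [Fintype F] {Ω : Type*} [NormedField Ω] [IsUltrametricDist Ω]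
  [CompleteSpace Ω] [DecidableEq Ω] [Algebra F Ω]
  {W : WeierstrassCurve F} {θ η : Ω} {hΞ : (W.baseChange Ω).toAffine.Nonsingular θ η}
  {V : (W.baseChange Ω).toAffine.Point} {n : ℕ} [NeZero n]
  {f : (W.baseChange Ω).toAffine.FunctionField}
  {g : Fin n → (W.baseChange Ω).toAffine.FunctionField} {K : ℝ}

theorem andersonDenom_one : andersonDenom W θ f g 1 = (charMat (rhoT W f g θ 0)).det := by
  rw [andersonDenom, Finset.prod_range_one, frobMat_zero]

/-- For `J = 1` the only rational summand is `(D - t)⁻¹ u`, as `Q_0 = 1`; the tail converges for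
`|t| < |θ|^q`, a disk containing `θ`. -/
theorem HasGrowth.det_mul_andersonE (hK : HasGrowth W θ η f g K)
    (h0 : expCoeff W f g θ η 0 = 1) (hθ : 1 < ‖θ‖) (u : Fin n → Ω) (k : Fin n) :
    andersonDenom W θ f g 1 * andersonE W f g θ η u k =
      ∑ c, (charMat (rhoT W f g θ 0)).adjugate k c * PowerSeries.C (u c) +
        andersonDenom W θ f g 1 * andersonTail W θ η f g 1 u k := by
  have h1 := congrFun (det_smul_geomSeries (F := F) (isUpperWithDiag_rhoT (f := f) (g := g)
    (W := W) hθ) u 0) k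
  rw [frobMat_zero, Pi.smul_apply, smul_eq_mul, Matrix.mulVec, dotProduct] at h1
  simp only [pow_zero, pow_one] at h1
  rw [hK.andersonE_eq 1, Finset.sum_range_one, h0, mul_add, andersonDenom_one, ← h1]
  congr 2
  rw [Finset.sum_eq_single k]
  · rw [Matrix.one_apply_eq, map_one, one_mul]
  · intro c _ hc
    rw [Matrix.one_apply_ne' hc, map_zero, zero_mul]
  · simp

theorem HasGrowth.recenter_mul_andersonE (hK : HasGrowth W θ η f g K)
    (h0 : expCoeff W f g θ η 0 = 1) (hθ : 1 < ‖θ‖) (u : Fin n → Ω) (k : Fin n) :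
    recenter θ (andersonDenom W θ f g 1 * andersonE W f g θ η u k) =
      (charMatAt θ (rhoT W f g θ 0)).adjugate.mulVec (fun c => PowerSeries.C (u c)) k +
        (charMatAt θ (rhoT W f g θ 0)).det * recenter θ (andersonTail W θ η f g 1 u k) := by
  have hθ0 : θ ≠ 0 := norm_pos_iff.mp (by linarith)
  have hq : ‖θ‖ < ‖θ‖ ^ Fintype.card F ^ 1 := by
    rw [pow_one]
    exact lt_self_pow₀ hθ Fintype.one_lt_card
  have hd : andersonDenom W θ f g 1 ∈ restricted Ω ‖θ‖ := isRestricted_andersonDenom 1 _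
  have ht : andersonTail W θ η f g 1 u k ∈ restricted Ω ‖θ‖ :=
    hK.isRestricted_andersonTail hθ 1 u k (norm_nonneg _) hq
  have hm : ∀ c, (charMat (rhoT W f g θ 0)).adjugate k c * PowerSeries.C (u c) ∈
      restricted Ω ‖θ‖ := fun c =>
    mul_mem (adjugate_charMat_mem_restricted _ _ _ _) (C_mem_restricted _ _)
  rw [hK.det_mul_andersonE h0 hθ, recenter_add hθ0 (sum_mem fun c _ => hm c) (mul_mem hd ht),
    recenter_mul hθ0 hd ht, recenter_sum hθ0 _ hm, andersonDenom_one,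
    (recenter_charMat hθ0 _).1]
  congr 1
  refine Finset.sum_congr rfl fun c _ => ?_
  rw [recenter_mul hθ0 (adjugate_charMat_mem_restricted _ _ _ _) (C_mem_restricted _ _),
    (recenter_charMat hθ0 _).2, recenter_C]

variable (W f g θ η) in
/-- The holomorphic part of the expansion of `G_u` at `Ξ` coming from the tail of the exponential
series. -/
noncomputable def tailExpansion (u : Fin n → Ω) (k : Fin n) : PowerSeries Ω :=
  recenter θ (andersonTail W θ η f g 1 ((rhoY W f g η 0).mulVec u) k) +
    (yExpansion W θ η + PowerSeries.C (algebraMap F Ω W.a₁) * (PowerSeries.C θ + PowerSeries.X) +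
      PowerSeries.C (algebraMap F Ω W.a₃)) * recenter θ (andersonTail W θ η f g 1 u k)

theorem HasGrowth.recenter_mul_andersonG (hK : HasGrowth W θ η f g K)
    (h0 : expCoeff W f g θ η 0 = 1) (hθ : 1 < ‖θ‖) (u : Fin n → Ω) (k : Fin n) :
    recenter θ (andersonDenom W θ f g 1 * (andersonG W f g θ η u k).1) +
      recenter θ (andersonDenom W θ f g 1 * (andersonG W f g θ η u k).2) * yExpansion W θ η =
    (charMatAt θ (rhoT W f g θ 0)).adjugate.mulVec ((conjSum W θ η (rhoY W f g η 0)).mulVec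
      (fun c => PowerSeries.C (u c))) k +
      (charMatAt θ (rhoT W f g θ 0)).det * tailExpansion W θ η f g u k := by
  have hθ0 : θ ≠ 0 := norm_pos_iff.mp (by linarith)
  have hq : ‖θ‖ < ‖θ‖ ^ Fintype.card F ^ 1 := by
    rw [pow_one]
    exact lt_self_pow₀ hθ Fintype.one_lt_card
  have hE : ∀ u, andersonDenom W θ f g 1 * andersonE W f g θ η u k ∈ restricted Ω ‖θ‖ := fun u =>
    hK.isRestricted_andersonE hθ 1 u k (norm_nonneg _) hq
  have hC := C_mem_restricted (Ω := Ω) ‖θ‖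
  have hX := X_mem_restricted (Ω := Ω) ‖θ‖
  have hZ : (conjSum W θ η (rhoY W f g η 0)).mulVec (fun c => PowerSeries.C (u c)) =
      (fun c => PowerSeries.C ((rhoY W f g η 0).mulVec u c)) + (yExpansion W θ η +
        PowerSeries.C (algebraMap F Ω W.a₁) * (PowerSeries.C θ + PowerSeries.X) +
          PowerSeries.C (algebraMap F Ω W.a₃)) • (fun c => PowerSeries.C (u c)) := by
    rw [conjSum, Matrix.add_mulVec, Algebra.algebraMap_eq_smul_one, Matrix.smul_mulVec,
      Matrix.one_mulVec]
    congr 1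
    funext c
    simp [Matrix.mulVec, dotProduct]
  rw [hZ, Matrix.mulVec_add, Matrix.mulVec_smul, andersonG, mul_add, mul_left_comm,
    recenter_add hθ0 (hE _) (mul_mem (add_mem (mul_mem (hC _) hX) (hC _)) (hE _)),
    recenter_mul hθ0 (add_mem (mul_mem (hC _) hX) (hC _)) (hE _),
    recenter_add hθ0 (mul_mem (hC _) hX) (hC _), recenter_mul hθ0 (hC _) hX, recenter_C, recenter_C,
    recenter_X, hK.recenter_mul_andersonE h0 hθ, hK.recenter_mul_andersonE h0 hθ, tailExpansion,
    Pi.add_apply, Pi.smul_apply, smul_eq_mul]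
  ring

/-- The Laurent expansion of `G_u` at `Ξ`. -/
theorem IsMotiveData.exists_isLaurentExpansion (D : IsMotiveData W hΞ V f g)
    (hK : HasGrowth W θ η f g K) (hθ : 1 < ‖θ‖)
    (hω : 2 * η + algebraMap F Ω W.a₁ * θ + algebraMap F Ω W.a₃ ≠ 0) (u : Fin n → Ω)
    (k : Fin n) : ∃ s : PowerSeries Ω, IsLaurentExpansion W θ η (andersonG W f g θ η u k)
      (HahnSeries.ofPowerSeries ℤ Ω (omegaExpansion W θ η) *
        (laurentInv (rhoT W f g θ 0 - θ • 1)).mulVec (fun c => HahnSeries.C (u c)) k +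
          HahnSeries.ofPowerSeries ℤ Ω s) := by
  have hq : ‖θ‖ < ‖θ‖ ^ Fintype.card F ^ 1 := by
    rw [pow_one]
    exact lt_self_pow₀ hθ Fintype.one_lt_card
  have h0 : expCoeff W f g θ η 0 = 1 := (D.seriesExp_spec (η := η) hθ).1
  have hT := isUpperWithDiag_rhoT (W := W) (f := f) (g := g) hθ
  have hθ0 : θ ≠ 0 := norm_pos_iff.mp (by linarith)
  obtain ⟨S, hS⟩ := exists_conjSum_eq hΞ.1 hω rhoY_diag rhoY_lower D.commute_rho_zero
    D.equation_rho_zero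
  refine ⟨S.mulVec (fun c => PowerSeries.C (u c)) k + tailExpansion W θ η f g u k, ‖θ‖, hθ.le,
    le_rfl, _, hK.isDenominator_andersonDenom hθ 1 u k (norm_nonneg _) hq, ?_⟩
  rw [hK.recenter_mul_andersonG h0 hθ, andersonDenom_one, (recenter_charMat hθ0 _).1]
  set P := charMatAt θ (rhoT W f g θ 0) with hP
  set ι := HahnSeries.ofPowerSeries ℤ Ω with hι
  set N := rhoT W f g θ 0 - θ • 1 with hN
  have hNn : N ^ n = 0 := pow_eq_zero_of_strictly_upper fun a b hab => by
    rcases hab.lt_or_eq with hlt | rfl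
    · simp [hN, hT.lower a b hlt, Matrix.one_apply_ne hlt.ne']
    · simp [hN, hT.diag]
  have hPL : ι.mapMatrix P * laurentInv N = 1 := by
    rw [hP, hι, ofPowerSeries_charMatAt]
    exact mul_laurentInv hNn
  have hLP : laurentInv N * ι.mapMatrix P = 1 := mul_eq_one_comm.mp hPL
  -- The expansion of `D - t` at `Ξ` is `N - x`, so its inverse over Laurent series is `laurentInv
  -- N`.
  have hadj : ι.mapMatrix P.adjugate = ι P.det • laurentInv N := by
    rw [RingHom.map_adjugate, RingHom.map_det, ← mul_one (Matrix.adjugate _), ← hPL, ← mul_assoc,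
      Matrix.adjugate_mul, smul_mul_assoc, one_mul]
  -- The congruence of `Z` to the scalar `ω` modulo `D - t` turns `(D - t)⁻¹ Z` into `ω (D - t)⁻¹`
  -- plus a power series matrix.
  have hLZ : laurentInv N * ι.mapMatrix (conjSum W θ η (rhoY W f g η 0)) =
      ι (omegaExpansion W θ η) • laurentInv N + ι.mapMatrix S := by
    rw [hS, map_add, map_mul, mul_add, ← mul_assoc, hLP, one_mul]
    congr 1
    have : ι.mapMatrix (algebraMap (PowerSeries Ω) (Matrix (Fin n) (Fin n) (PowerSeries Ω))
        (omegaExpansion W θ η)) = ι (omegaExpansion W θ η) • 1 := by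
      rw [Algebra.algebraMap_eq_smul_one]
      ext1 a b
      simp only [RingHom.mapMatrix_apply, Matrix.map_apply, Matrix.smul_apply, smul_eq_mul,
        map_mul, Matrix.one_apply]
      split_ifs <;> simp
    rw [this, mul_smul_comm, mul_one]
  have hvec : ∀ (M : Matrix (Fin n) (Fin n) (PowerSeries Ω)) (v : Fin n → PowerSeries Ω),
      (fun c => ι (M.mulVec v c)) = (ι.mapMatrix M).mulVec (fun c => ι (v c)) := fun M v => by
    funext c
    simp [Matrix.mulVec, dotProduct]
  have hu : (fun c => ι (PowerSeries.C (u c))) = fun c => HahnSeries.C (u c) := by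
    funext c
    exact HahnSeries.ofPowerSeries_C _
  have h1 : ι (P.adjugate.mulVec ((conjSum W θ η (rhoY W f g η 0)).mulVec
      (fun c => PowerSeries.C (u c))) k) = ι P.det * (ι (omegaExpansion W θ η) *
      (laurentInv N).mulVec (fun c => HahnSeries.C (u c)) k +
        ι (S.mulVec (fun c => PowerSeries.C (u c)) k)) := by
    refine (congrFun (hvec P.adjugate _) k).trans ?_
    rw [hvec, hu, hadj, Matrix.smul_mulVec, Matrix.mulVec_mulVec, hLZ, Matrix.add_mulVec,
      Matrix.smul_mulVec, ← hu, ← hvec S, hu]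
    rfl
  rw [map_add, map_add, h1, map_mul]
  ring

theorem coeff_ofPowerSeries_neg_one (s : PowerSeries Ω) :
    HahnSeries.coeff (HahnSeries.ofPowerSeries ℤ Ω s) (-1) = 0 := by
  rw [PowerSeries.coeff_coe, if_pos (by norm_num)]

/-- The differential is `dx / ω`, so it cancels the scalar `ω` in the principal part. As `ω` is a
unit, the holomorphic part stays holomorphic. -/
theorem IsMotiveData.residueXi_andersonG (D : IsMotiveData W hΞ V f g)
    (hK : HasGrowth W θ η f g K) (hθ : 1 < ‖θ‖)
    (hω : 2 * η + algebraMap F Ω W.a₁ * θ + algebraMap F Ω W.a₃ ≠ 0) (u : Fin n → Ω)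
    (k : Fin n) : residueXi W θ η (andersonG W f g θ η u k) = -u k := by
  obtain ⟨s, hs⟩ := D.exists_isLaurentExpansion hK hθ hω u k
  have hθ0 : θ ≠ 0 := norm_pos_iff.mp (by linarith)
  have hl := (Classical.epsilon_spec (p := fun l => IsLaurentExpansion W θ η
    (andersonG W f g θ η u k) l) ⟨_, hs⟩).unique hθ0 hs
  have hω0 : PowerSeries.constantCoeff (omegaExpansion W θ η) ≠ 0 := by
    rw [omegaExpansion]
    simp only [map_add, map_mul, map_ofNat, PowerSeries.constantCoeff_C,
      PowerSeries.constantCoeff_X, add_zero, (yExpansion_spec hΞ.1 hω).1]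
    exact hω
  have hω1 := PowerSeries.mul_inv_cancel _ hω0
  have hlam : HahnSeries.ofPowerSeries ℤ Ω (omegaExpansion W θ η) * lambdaExpansion W θ η = 1 := by
    refine mul_inv_cancel₀ ((map_ne_zero_iff _ HahnSeries.ofPowerSeries_injective).mpr ?_)
    rintro h
    rw [h, map_zero] at hω0
    exact hω0 rfl
  have hlam2 : lambdaExpansion W θ η =
      HahnSeries.ofPowerSeries ℤ Ω (omegaExpansion W θ η)⁻¹ := by
    have h1 := congrArg (HahnSeries.ofPowerSeries ℤ Ω) hω1
    rw [map_mul, map_one, ← hlam] at h1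
    exact (mul_left_cancel₀ (left_ne_zero_of_mul (hlam.trans_ne one_ne_zero)) h1).symm
  rw [residueXi, hl, add_mul, mul_right_comm, hlam, one_mul, hlam2, ← map_mul,
    HahnSeries.coeff_add, coeff_ofPowerSeries_neg_one, add_zero, coeff_laurentInv_mulVec]

end Residue

end TensorDrinfeld


/-! ### Assembly of the theorem. -/

theorem propositionP {F : Type*} [Field F] [Fintype F]
    {C : Type*} [NormedField C] [IsUltrametricDist C] [CompleteSpace C] [IsAlgClosed C]
    [DecidableEq C] [Algebra F C]
    (W : WeierstrassCurve F) [W.IsElliptic]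
    (θ η : C) (hC : IsCInfty F θ η)
    (hΞ : (W.baseChange C).toAffine.Nonsingular θ η)
    (V : (W.baseChange C).toAffine.Point)
    (hV : V - frobPoint W V = Point.some θ η hΞ)
    (hVdeg : ∃ (α β : C) (h : (W.baseChange C).toAffine.Nonsingular α β),
      V = Point.some α β h ∧ 1 < ‖α‖ ∧ 1 < ‖β‖)
    (f : (W.baseChange C).toAffine.FunctionField)
    (hf : IsShtuka W V (Point.some θ η hΞ) f)
    (n : ℕ) [NeZero n]
    (hn : ∀ j : ℕ, 1 ≤ j → j < n → j • frobPoint W V + (n - j) • V ≠ 0)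
    (g : Fin n → (W.baseChange C).toAffine.FunctionField)
    (hg : IsMotiveBasis W V (Point.some θ η hΞ) n g)
    (u : Fin n → C) :
    (∀ (z : Fin n → C) (k : Fin n), Summable fun i => expTerm W f g θ η z i k) ∧
    (∀ k : Fin n, IsMeromorphicOnU (andersonG W f g θ η u k)) ∧
    RES W θ η (andersonG W f g θ η u) = -u := by
  obtain ⟨α, β, h, hVα, hα, -⟩ := hVdeg
  have hq : (1 : ℝ) < Fintype.card F := by exact_mod_cast Fintype.one_lt_card
  have hθ : 1 < ‖θ‖ := by
    rw [hC.norm_theta]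
    exact one_lt_pow₀ hq two_ne_zero
  -- All three points have `x`-coordinates of norm greater than `1`, while elements algebraic over
  -- `𝔽_q` have norm at most `1`.
  have htr : ∀ P, P = V ∨ P = frobPoint W V ∨ P = V - frobPoint W V →
      ∃ x y, ∃ h, P = Point.some x y h ∧ Transcendental F x := by
    rintro P (rfl | rfl | rfl)
    · exact ⟨α, β, h, hVα, transcendental_of_one_lt_norm F hα⟩
    · rw [hVα]
      refine ⟨_, _, _, rfl, transcendental_of_one_lt_norm F ?_⟩
      rw [FiniteField.coe_frobeniusAlgHom, norm_pow]
      exact one_lt_pow₀ hα Fintype.card_ne_zero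
    · exact ⟨θ, η, hΞ, hV, transcendental_of_one_lt_norm F hθ⟩
  have hnV : n • V ≠ 0 := by
    classical
    exact nsmul_ne_zero_of_transcendental W V (frobPoint W V) htr (NeZero.pos n)
  have D : IsMotiveData W hΞ V f g := by
    refine ⟨?_, hf, hg, fun j hj => ?_⟩
    · rw [hVα]
      exact Point.some_ne_zero _
    -- The case `j = 0`, the last zero `nV` of the first function, is outside the range of `hn` and
    -- comes from transcendence.
    · rcases Nat.eq_zero_or_pos j with rfl | hj0
      · simpa using hnV
      · exact hn j hj0 hj
  obtain ⟨K, hK⟩ := D.exists_hasGrowth hC.norm_theta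
  refine ⟨hK.summable_expTerm, hK.isMeromorphicOnU_andersonG hθ u, ?_⟩
  funext k
  exact D.residueXi_andersonG hK hθ (two_mul_add_ne_zero hC) u k
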